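/- For $K\ge 0$ and $0\le\rho\le 2$ consider the oriented octupolar potential at $\chi=-\pi/2$, $$\Phi(x,y,z)=z^3-3y^2z-\tfrac32(\rho+1)(x^2-y^2)z+Ky(y^2-3x^2),$$ restricted to the unit sphere $S^2\subset\mathbb R^3$. Critical points, (local) maxima and minima, Hessians and Poincaré–Hopf indices $\iota$ of the gradient field are those of this restriction; a saddle is a critical point that is neither a local maximum nor a local minimum; a critical point is degenerate if the Hessian on its tangent plane is singular; a monkey saddle is a saddle of index $-2$ at which the Hessian vanishes. Let $$g(\rho)=\begin{cases}\sqrt{\dfrac{2\rho^2(1-\rho)}{3(6-\rho)}} & 0\le\rho\le1,\\[2mm] \sqrt{2(2-\rho)(\rho-1)} & 1\le\rho\le2,\end{cases}$$ which is a continuous function on $[0,2]$. 1. If $K>g(\rho)$ and $\rho<2$, there are exactly 14 critical points: the two poles $(0,0,\pm1)$, four further ones on the great circle $x=0$, and eight with $x\ne0$. Four are maxima, four are minima, and six are saddles. 2. If $K<g(\rho)$, there are exactly 10 critical points: three maxima, three minima and four saddles. 3. Let $K=g(\rho)$. If $0<\rho<1$, there are exactly 10 critical points: three maxima, three minima and four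 saddles; exactly two of the saddles are degenerate, and all four have index $-1$. If $1<\rho<2$, there are exactly 12 critical points: three maxima, three minima and six saddles; exactly two of the saddles are degenerate and these have index $0$, while the other four are non-degenerate and have index $-1$. 4. Let $K=g(\rho)$. If $\rho=1$ (so $K=0$), there are exactly 8 critical points: three maxima, three minima and two degenerate saddles, which are monkey saddles of index $-2$. If $\rho=2$ (so $K=0$), there are exactly 10 critical points: three maxima, three minima and four saddles; the saddles are non-degenerate and have index $-1$, while the North Pole $(0,0,1)$ is a degenerate maximum and the South Pole $(0,0,-1)$ a degenerate minimum. -/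

import Mathlib

namespace Octupole

noncomputable section

/-- Euclidean three-space. The coordinates `x, y, z` of `p` are `p 0, p 1, p 2`. -/
abbrev E3 : Type := EuclideanSpace ℝ (Fin 3)

/-- The unit sphere `S²`. -/
def unitSphere : Set E3 := Metric.sphere (0 : E3) 1

def northPole : E3 := !₂[0, 0, 1]

def southPole : E3 := !₂[0, 0, -1]

/-- The oriented octupolar potential with parameters `K`, `ρ`, `χ`, a cubic form on `ℝ³`. -/
def octupolarPotential (K ρ χ : ℝ) (p : E3) : ℝ :=
  p 2 ^ 3 - 3 * p 1 ^ 2 * p 2 + 3 * ρ * Real.cos χ * p 0 * p 1 * p 2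
    + 3 / 2 * (ρ * Real.sin χ - 1) * (p 0 ^ 2 - p 1 ^ 2) * p 2
    + K * p 1 * (p 1 ^ 2 - 3 * p 0 ^ 2)

/-- The gradient of the restriction of `Φ` to the unit sphere, at a point `p` of the sphere: the
orthogonal projection of the gradient of `Φ` on the tangent plane `p^⊥`. -/
def sphereGradient (Φ : E3 → ℝ) (p : E3) : E3 :=
  gradient Φ p - inner ℝ p (gradient Φ p) • p

/-- The critical points of the restriction of `Φ` to the unit sphere. -/
def critPts (Φ : E3 → ℝ) : Set E3 :=
  {p | p ∈ unitSphere ∧ sphereGradient Φ p = 0}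

/-- The critical points that are local maxima of `Φ` on the unit sphere. -/
def maxPts (Φ : E3 → ℝ) : Set E3 :=
  {p | p ∈ critPts Φ ∧ IsLocalMaxOn Φ unitSphere p}

/-- The critical points that are local minima of `Φ` on the unit sphere. -/
def minPts (Φ : E3 → ℝ) : Set E3 :=
  {p | p ∈ critPts Φ ∧ IsLocalMinOn Φ unitSphere p}

/-- The saddles: critical points that are neither local maxima nor local minima. -/
def saddles (Φ : E3 → ℝ) : Set E3 :=
  {p | p ∈ critPts Φ ∧ ¬ IsLocalMaxOn Φ unitSphere p ∧ ¬ IsLocalMinOn Φ unitSphere p}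

/-- The Hessian, at a critical point `p`, of the restriction of `Φ` to the unit sphere, as a
bilinear form in the tangent vectors `u, v ∈ p^⊥`. It is the Hessian of the function
`Φ - (μ / 2) |x|²`, where `μ = ⟨p, ∇Φ(p)⟩` is the Lagrange multiplier of the constraint. -/
def sphereHessian (Φ : E3 → ℝ) (p u v : E3) : ℝ :=
  inner ℝ (fderiv ℝ (gradient Φ) p u) v - inner ℝ p (gradient Φ p) * inner ℝ u v

/-- The Hessian at `p` is degenerate on the tangent plane `p^⊥`. -/
def IsDegenerateAt (Φ : E3 → ℝ) (p : E3) : Prop :=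
  ∃ u : E3, u ≠ 0 ∧ inner ℝ p u = 0 ∧ ∀ v : E3, inner ℝ p v = 0 → sphereHessian Φ p u v = 0

/-- `w`, restricted to `[0, 2π]`, does not vanish and turns `k` times around the origin: it has a
continuous argument `θ` whose total increment is `2πk`. -/
def HasWindingNumber (w : ℝ → ℂ) (k : ℤ) : Prop :=
  ∃ θ : ℝ → ℝ, ContinuousOn θ (Set.Icc 0 (2 * Real.pi)) ∧
    (∀ t ∈ Set.Icc 0 (2 * Real.pi),
      w t ≠ 0 ∧ w t = (‖w t‖ : ℂ) * Complex.exp ((θ t : ℂ) * Complex.I)) ∧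
    θ (2 * Real.pi) - θ 0 = 2 * Real.pi * (k : ℝ)

/-- The circle on the unit sphere with centre `p` and spherical radius `r`, traversed in the sense
from `e₁` to `e₂`, where `p, e₁, e₂` are orthonormal. -/
def geodesicCircle (p e₁ e₂ : E3) (r t : ℝ) : E3 :=
  Real.cos r • p + Real.sin r • (Real.cos t • e₁ + Real.sin t • e₂)

/-- The point `p` of the unit sphere is an isolated zero (or a regular point) of the tangential
gradient of `Φ`, of Poincaré–Hopf index `k`: along every sufficiently small circle around `p` the
tangential gradient does not vanish, and it turns `k` times when it is read in the trivialization
of the tangent bundle near `p` given by the orthogonal projection on the tangent plane at `p`, with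
orthonormal basis `e₁, e₂`. (The index does not depend on the choice of that basis.) -/
def HasIndex (Φ : E3 → ℝ) (p : E3) (k : ℤ) : Prop :=
  ∃ e₁ e₂ : E3, Orthonormal ℝ ![p, e₁, e₂] ∧
    ∀ᶠ r in nhdsWithin (0 : ℝ) (Set.Ioi 0),
      HasWindingNumber (fun t =>
        ((inner ℝ e₁ (sphereGradient Φ (geodesicCircle p e₁ e₂ r t)) : ℝ) : ℂ)
          + ((inner ℝ e₂ (sphereGradient Φ (geodesicCircle p e₁ e₂ r t)) : ℝ) : ℂ) * Complex.I) k

/-- A monkey saddle: a saddle at which the Hessian vanishes on the whole tangent plane, and whose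
index is `-2`. -/
def IsMonkeySaddle (Φ : E3 → ℝ) (p : E3) : Prop :=
  p ∈ saddles Φ ∧
    (∀ u v : E3, inner ℝ p u = 0 → inner ℝ p v = 0 → sphereHessian Φ p u v = 0) ∧
    HasIndex Φ p (-2)

/-- The function `g` whose graph is the bifurcation curve; it is used for `0 ≤ ρ ≤ 2` only. -/
def bifurcationCurve (ρ : ℝ) : ℝ :=
  if ρ ≤ 1 then Real.sqrt (2 * ρ ^ 2 * (1 - ρ) / (3 * (6 - ρ)))
  else Real.sqrt (2 * (2 - ρ) * (ρ - 1))

end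

end Octupole

open Octupole

/-! The potential is an odd cubic form, even in `x`. By Euler's identity a unit vector is critical
exactly when `∇Φ(p) = 3Φ(p) p`, and this system splits along the mirror plane `x = 0`.

In the mirror plane the critical points are the poles and the lines `z = t y` with `2(2-ρ)t² - 2Kt +
(ρ-1) = 0` (`formE`), of reduced discriminant `K² - 2(2-ρ)(ρ-1)`. Off it the multiplier can be
eliminated. What remains is `formC`, a traceless quadratic form in `(y, z)` and hence a pair of
perpendicular lines, together with `formB`, which determines `x²`. The line in the first quadrant
always carries four points (`orbitW_pos_card`). On the perpendicular line, for `K > 0`, the value of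
`x²` prescribed by `formB` has the sign of `branchDisc = 3(6-ρ)K² - 2ρ²(1-ρ)` (`orbitW_neg_sign`).
The vanishing of the two discriminants is what produces the two branches of the bifurcation curve.

The types follow from signs of Hessian determinants. Off the mirror plane the determinant has the
sign of `yz` when `K > 0` (`det_mul_yz`), so the first line carries extrema and the second saddles.
In the mirror plane the Hessian is diagonal: the larger root `t` gives saddles, while the type at
the smaller root is again decided by `branchDisc` (`lower_root_sign`). The antipodal map exchanges
maxima and minima, so each make up half of the extrema (`counts`).

On the curve the Hessian degenerates and higher order terms decide. On the first branch the smaller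
root is a pitchfork, treated by a bent curve of order four; on the second the double root is a fold
with nonzero cubic term; at the cusp the whole Hessian vanishes. Indices are computed by dividing
the tangential gradient on a small circle by `sin r` and checking that the resulting loop is nowhere
antiparallel to a reference loop of known winding number (`HasWindingNumber.of_slitPlane`). -/

/-! ### Winding numbers of plane loops -/

theorem Octupole.winding_exp (β : ℂ) (hβ : β ≠ 0) (k : ℤ) :
    HasWindingNumber (fun t => β * Complex.exp (((k * t : ℝ) : ℂ) * Complex.I)) k := by
  refine ⟨fun t => Complex.arg β + k * t, by fun_prop, fun t _ => ⟨?_, ?_⟩, by ring⟩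
  · exact mul_ne_zero hβ (Complex.exp_ne_zero _)
  · rw [norm_mul, Complex.norm_exp_ofReal_mul_I, mul_one, Complex.ofReal_add, add_mul,
      Complex.exp_add, ← mul_assoc, Complex.norm_mul_exp_arg_mul_I]

/-- Two closed loops that are nowhere antiparallel have the same winding number. -/
theorem Octupole.HasWindingNumber.of_slitPlane {w w' : ℝ → ℂ} {k : ℤ} (h : HasWindingNumber w k)
    (hw : ContinuousOn w (Set.Icc 0 (2 * Real.pi)))
    (hw' : ContinuousOn w' (Set.Icc 0 (2 * Real.pi)))
    (hp : w (2 * Real.pi) = w 0) (hp' : w' (2 * Real.pi) = w' 0)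
    (hs : ∀ t ∈ Set.Icc 0 (2 * Real.pi), w' t * starRingEnd ℂ (w t) ∈ Complex.slitPlane) :
    HasWindingNumber w' k := by
  obtain ⟨θ, hθ, hθw, hk⟩ := h
  -- The principal argument of `w' / w` is continuous because the quotient avoids the cut, and it
  -- has no increment because both loops close up.
  refine ⟨fun t => θ t + Complex.arg (w' t * starRingEnd ℂ (w t)), hθ.add ?_, fun t ht => ?_, ?_⟩
  · intro t ht
    have hc : ContinuousWithinAt (fun t => w' t * starRingEnd ℂ (w t))
        (Set.Icc 0 (2 * Real.pi)) t :=
      (hw' t ht).mul (Complex.continuous_conj.continuousAt.comp_continuousWithinAt (hw t ht))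
    exact ContinuousAt.comp_continuousWithinAt (g := Complex.arg)
      (f := fun t => w' t * starRingEnd ℂ (w t)) (Complex.continuousAt_arg (hs t ht)) hc
  · obtain ⟨h0, he⟩ := hθw t ht
    have hne := Complex.slitPlane_ne_zero (hs t ht)
    refine ⟨left_ne_zero_of_mul hne, ?_⟩
    have hn : (‖w t‖ : ℂ) ≠ 0 := by simpa using h0
    have key := Complex.norm_mul_exp_arg_mul_I (w' t * starRingEnd ℂ (w t))
    have h1 : w t * starRingEnd ℂ (w t) = (‖w t‖ : ℂ) ^ 2 := Complex.mul_conj' _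
    have h2 : ((‖w' t * starRingEnd ℂ (w t)‖ : ℝ) : ℂ) = ‖w' t‖ * ‖w t‖ := by
      rw [norm_mul, RCLike.norm_conj]; push_cast; rfl
    rw [h2] at key
    rw [Complex.ofReal_add, add_mul, Complex.exp_add]
    refine mul_left_cancel₀ (pow_ne_zero 2 hn) ?_
    calc (‖w t‖ : ℂ) ^ 2 * w' t = w t * (w' t * starRingEnd ℂ (w t)) := by rw [← h1]; ring
      _ = ((‖w t‖ : ℂ) * Complex.exp ((θ t : ℂ) * Complex.I)) *
          (‖w' t‖ * ‖w t‖ * Complex.exp ((Complex.arg (w' t * starRingEnd ℂ (w t)) : ℂ)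
            * Complex.I)) := by rw [← he, key]
      _ = _ := by ring
  · simp only [hp, hp']; rw [← hk]; ring

/-- The comparison principle with the pure rotation `β exp(ikt)` as reference loop; it closes up
because `k` is an integer. -/
theorem Octupole.winding_of_re_pos {w : ℝ → ℂ} (β : ℂ) (hβ : β ≠ 0) (k : ℤ)
    (hw : ContinuousOn w (Set.Icc 0 (2 * Real.pi))) (hp : w (2 * Real.pi) = w 0)
    (hs : ∀ t ∈ Set.Icc 0 (2 * Real.pi),
      w t * starRingEnd ℂ (β * Complex.exp (((k * t : ℝ) : ℂ) * Complex.I))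
        ∈ Complex.slitPlane) : HasWindingNumber w k := by
  refine (winding_exp β hβ k).of_slitPlane (by fun_prop) hw ?_ hp hs
  simp only [mul_zero, Complex.ofReal_zero, zero_mul, Complex.exp_zero]
  rw [show (((k * (2 * Real.pi) : ℝ) : ℂ) * Complex.I) = k * (2 * Real.pi * Complex.I) by
    push_cast; ring, Complex.exp_int_mul_two_pi_mul_I]

/-- A loop `(cos t · a, b)` such that `a < 0` where `b` vanishes, and `b` has the sign of `sin t`
where `cos t` vanishes, turns once in the negative sense. -/
theorem Octupole.winding_neg_one {a b : ℝ → ℝ} (ha : Continuous a) (hb : Continuous b)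
    (pa : a (2 * Real.pi) = a 0) (pb : b (2 * Real.pi) = b 0)
    (hab : ∀ t ∈ Set.Icc 0 (2 * Real.pi), b t = 0 → a t < 0)
    (hcos : ∀ t ∈ Set.Icc 0 (2 * Real.pi), Real.cos t = 0 → 0 < b t * Real.sin t) :
    HasWindingNumber (fun t => ((Real.cos t * a t : ℝ) : ℂ) + (b t : ℂ) * Complex.I) (-1) := by
  -- Two comparisons are chained: from `-exp(-it) = (-cos t, sin t)` to `(-cos t, b)`, and from
  -- there to `(cos t · a, b)`.
  have h1 : HasWindingNumber (fun t => ((-Real.cos t : ℝ) : ℂ) + (b t : ℂ) * Complex.I) (-1) := by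
    refine winding_of_re_pos (-1) (by norm_num) (-1) (by fun_prop) (by simp [pb]) fun t ht => ?_
    rw [Complex.mem_slitPlane_iff]
    have e : Complex.exp ((((-1 : ℤ) * t : ℝ) : ℂ) * Complex.I)
        = ((Real.cos t : ℝ) : ℂ) - (Real.sin t : ℝ) * Complex.I := by
      rw [Complex.exp_mul_I, ← Complex.ofReal_cos, ← Complex.ofReal_sin]
      simp [sub_eq_add_neg]
    rw [e]
    simp only [map_mul, map_sub, map_neg, map_one, Complex.conj_ofReal, Complex.conj_I,
      Complex.mul_re, Complex.add_re, Complex.ofReal_re, Complex.ofReal_im, Complex.I_re,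
      Complex.I_im, Complex.mul_im, Complex.add_im, Complex.sub_re, Complex.sub_im,
      Complex.neg_re, Complex.neg_im, Complex.one_re, Complex.one_im]
    by_cases hc : Real.cos t = 0
    · left
      have := hcos t ht hc
      rw [hc]; nlinarith
    · by_contra hcon
      push Not at hcon
      obtain ⟨hre, him⟩ := hcon
      ring_nf at hre him
      have h2 : b t * Real.cos t = Real.cos t * Real.sin t := by linarith
      have h3 : b t = Real.sin t := mul_left_cancel₀ hc (by linarith)
      rw [h3] at hre
      nlinarith [Real.sin_sq_add_cos_sq t]
  refine h1.of_slitPlane (by fun_prop) (by fun_prop) (by simp [pb]) (by simp [pa, pb])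
    fun t ht => ?_
  rw [Complex.mem_slitPlane_iff]
  simp only [map_mul, map_add, Complex.conj_ofReal, Complex.conj_I,
      Complex.mul_re, Complex.add_re, Complex.ofReal_re, Complex.ofReal_im, Complex.I_re,
      Complex.I_im, Complex.mul_im, Complex.add_im,
      Complex.neg_re, Complex.neg_im]
  by_contra hcon
  push Not at hcon
  obtain ⟨hre, him⟩ := hcon
  ring_nf at hre him
  by_cases hb0 : b t = 0
  · have h2 := hab t ht hb0
    have hc : Real.cos t ≠ 0 := fun hc => by have := hcos t ht hc; simp [hb0] at this
    rw [hb0] at hre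
    nlinarith [mul_pos (neg_pos.2 h2) (pow_pos (abs_pos.2 hc) 2), sq_abs (Real.cos t)]
  · have h3 : Real.cos t * (1 + a t) = 0 := mul_left_cancel₀ hb0 (by linarith)
    rcases mul_eq_zero.1 h3 with hc | ha1
    · rw [hc] at hre
      nlinarith [pow_pos (abs_pos.2 hb0) 2, sq_abs (b t)]
    · have : a t = -1 := by linarith
      rw [this] at hre
      nlinarith [pow_pos (abs_pos.2 hb0) 2, sq_abs (b t), sq_nonneg (Real.cos t)]

/-- This removes the factor `sin r` that the tangential gradient carries on a small circle. -/
theorem Octupole.HasWindingNumber.pos_mul {w w' : ℝ → ℂ} {k : ℤ} (h : HasWindingNumber w k)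
    {c : ℝ} (hc : 0 < c) (hw : ∀ t ∈ Set.Icc 0 (2 * Real.pi), w' t = c * w t) :
    HasWindingNumber w' k := by
  obtain ⟨θ, hθ, hθw, hk⟩ := h
  refine ⟨θ, hθ, fun t ht => ?_, hk⟩
  obtain ⟨h0, he⟩ := hθw t ht
  rw [hw t ht]
  refine ⟨mul_ne_zero (by exact_mod_cast hc.ne') h0, ?_⟩
  rw [norm_mul, Complex.norm_real, Real.norm_of_nonneg hc.le, Complex.ofReal_mul, mul_assoc, ← he]

/-- Changing the sign of a loop does not change its winding number. -/
theorem Octupole.HasWindingNumber.neg {w w' : ℝ → ℂ} {k : ℤ} (h : HasWindingNumber w k)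
    (hw : ∀ t ∈ Set.Icc 0 (2 * Real.pi), w' t = - w t) : HasWindingNumber w' k := by
  obtain ⟨θ, hθ, hθw, hk⟩ := h
  refine ⟨fun t => θ t + Real.pi, by fun_prop, fun t ht => ?_, by rw [← hk]; ring⟩
  obtain ⟨h0, he⟩ := hθw t ht
  rw [hw t ht]
  refine ⟨neg_ne_zero.2 h0, ?_⟩
  rw [norm_neg, Complex.ofReal_add, add_mul, Complex.exp_add, Complex.exp_pi_mul_I, ← mul_assoc,
    ← he]
  ring

/-! ### The cubic form, its derivatives and its expansion on the sphere -/

/-- The octupolar potential at `χ = -π/2`. -/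
noncomputable def Octupole.pot (K ρ : ℝ) (p : E3) : ℝ :=
  p 2 ^ 3 - 3 * p 1 ^ 2 * p 2 - 3 / 2 * (ρ + 1) * (p 0 ^ 2 - p 1 ^ 2) * p 2
    + K * p 1 * (p 1 ^ 2 - 3 * p 0 ^ 2)

/-- The gradient of `pot`. -/
noncomputable def Octupole.gradPot (K ρ : ℝ) (p : E3) : E3 :=
  !₂[-3 * (ρ + 1) * p 0 * p 2 - 6 * K * p 0 * p 1,
    3 * (ρ - 1) * p 1 * p 2 + 3 * K * (p 1 ^ 2 - p 0 ^ 2),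
    3 * p 2 ^ 2 - 3 / 2 * (ρ + 1) * p 0 ^ 2 + 3 / 2 * (ρ - 1) * p 1 ^ 2]

/-- The derivative of `gradPot` at `p` in the direction `u`. -/
noncomputable def Octupole.hessPot (K ρ : ℝ) (p u : E3) : E3 :=
  !₂[-3 * (ρ + 1) * (p 0 * u 2 + u 0 * p 2) - 6 * K * (p 0 * u 1 + u 0 * p 1),
    3 * (ρ - 1) * (p 1 * u 2 + u 1 * p 2) + 6 * K * (p 1 * u 1 - p 0 * u 0),
    6 * p 2 * u 2 - 3 * (ρ + 1) * p 0 * u 0 + 3 * (ρ - 1) * p 1 * u 1]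

/-- The Hessian of the restriction of `pot` to the sphere, at a critical point `p`. -/
noncomputable def Octupole.tanHess (K ρ : ℝ) (p u v : E3) : ℝ :=
  inner ℝ (hessPot K ρ p u) v - 3 * pot K ρ p * inner ℝ u v

theorem Octupole.octupolarPotential_eq (K ρ : ℝ) :
    octupolarPotential K ρ (-(Real.pi / 2)) = pot K ρ := by
  funext p
  simp only [octupolarPotential, pot, Real.cos_neg, Real.sin_neg, Real.cos_pi_div_two,
    Real.sin_pi_div_two]
  ring

theorem Octupole.inner_coord (u v : E3) :
    inner ℝ u v = u 0 * v 0 + u 1 * v 1 + u 2 * v 2 := by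
  simp [PiLp.inner_apply, Fin.sum_univ_three, mul_comm]

theorem Octupole.mem_unitSphere (p : E3) :
    p ∈ unitSphere ↔ p 0 ^ 2 + p 1 ^ 2 + p 2 ^ 2 = 1 := by
  rw [unitSphere, mem_sphere_zero_iff_norm]
  have h : ‖p‖ ^ 2 = p 0 ^ 2 + p 1 ^ 2 + p 2 ^ 2 := by
    rw [EuclideanSpace.norm_sq_eq, Fin.sum_univ_three]; simp
  rw [← h]
  constructor
  · intro h; rw [h]; norm_num
  · intro h; exact (pow_eq_one_iff_of_nonneg (norm_nonneg _) two_ne_zero).1 h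

theorem Octupole.hasFDerivAt_coord (i : Fin 3) (p : E3) :
    HasFDerivAt (fun q : E3 => q i) (EuclideanSpace.proj i : E3 →L[ℝ] ℝ) p :=
  (EuclideanSpace.proj i : E3 →L[ℝ] ℝ).hasFDerivAt

theorem Octupole.ext3 {p q : E3} (h0 : p 0 = q 0) (h1 : p 1 = q 1) (h2 : p 2 = q 2) : p = q := by
  ext i
  fin_cases i
  · exact h0
  · exact h1
  · exact h2

theorem Octupole.gradient_pot (K ρ : ℝ) : gradient (pot K ρ) = gradPot K ρ := by
  funext p
  apply HasGradientAt.gradient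
  rw [hasGradientAt_iff_hasFDerivAt]
  have h0 := hasFDerivAt_coord 0 p
  have h1 := hasFDerivAt_coord 1 p
  have h2 := hasFDerivAt_coord 2 p
  have h := ((((h2.pow 3).sub (((h1.pow 2).const_mul 3).mul h2)).sub
    ((((h0.pow 2).sub (h1.pow 2)).const_mul (3 / 2 * (ρ + 1))).mul h2)).add
    ((h1.const_mul K).mul ((h1.pow 2).sub ((h0.pow 2).const_mul 3))))
  refine h.congr_fderiv ?_
  ext u
  simp [inner_coord, gradPot]
  ring

theorem Octupole.fderiv_gradPot (K ρ : ℝ) (p u : E3) :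
    fderiv ℝ (gradPot K ρ) p u = hessPot K ρ p u := by
  have h0 := hasFDerivAt_coord 0 p
  have h1 := hasFDerivAt_coord 1 p
  have h2 := hasFDerivAt_coord 2 p
  have hd : DifferentiableAt ℝ (gradPot K ρ) p := by
    rw [differentiableAt_euclidean]
    intro i
    fin_cases i <;> simp [gradPot] <;> fun_prop
  have hc (i : Fin 3) : fderiv ℝ (gradPot K ρ) p u i
      = fderiv ℝ (fun q => gradPot K ρ q i) p u :=
    by
    have := ((EuclideanSpace.proj i : E3 →L[ℝ] ℝ).hasFDerivAt.comp p hd.hasFDerivAt).fderiv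
    exact (DFunLike.congr_fun this u).symm
  apply ext3
  · rw [hc]
    have h := ((h0.const_mul (-3 * (ρ + 1))).mul h2).sub ((h0.const_mul (6 * K)).mul h1)
    have e : (fun q : E3 => gradPot K ρ q 0) = fun q =>
      -3 * (ρ + 1) * q 0 * q 2 - 6 * K * q 0 * q 1 := by funext q; simp [gradPot]
    rw [e]
    refine (DFunLike.congr_fun h.fderiv u).trans ?_
    simp [hessPot]; ring
  · rw [hc]
    have h := ((h1.const_mul (3 * (ρ - 1))).mul h2).add
      (((h1.pow 2).sub (h0.pow 2)).const_mul (3 * K))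
    have e : (fun q : E3 => gradPot K ρ q 1) = fun q =>
      3 * (ρ - 1) * q 1 * q 2 + 3 * K * (q 1 ^ 2 - q 0 ^ 2) := by funext q; simp [gradPot]
    rw [e]
    refine (DFunLike.congr_fun h.fderiv u).trans ?_
    simp [hessPot]; ring
  · rw [hc]
    have h := (((h2.pow 2).const_mul 3).sub ((h0.pow 2).const_mul (3 / 2 * (ρ + 1)))).add
      ((h1.pow 2).const_mul (3 / 2 * (ρ - 1)))
    have e : (fun q : E3 => gradPot K ρ q 2) = fun q =>
      3 * q 2 ^ 2 - 3 / 2 * (ρ + 1) * q 0 ^ 2 + 3 / 2 * (ρ - 1) * q 1 ^ 2 := by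
        funext q; simp [gradPot]
    rw [e]
    refine (DFunLike.congr_fun h.fderiv u).trans ?_
    simp [hessPot]; ring

/-- Euler's identity for a form of degree three; it identifies the Lagrange multiplier. -/
theorem Octupole.inner_gradPot_self (K ρ : ℝ) (p : E3) :
    inner ℝ p (gradPot K ρ p) = 3 * pot K ρ p := by
  simp [inner_coord, gradPot, pot]; ring

theorem Octupole.sphereGradient_pot (K ρ : ℝ) (p : E3) :
    sphereGradient (pot K ρ) p = gradPot K ρ p - (3 * pot K ρ p) • p := by
  rw [sphereGradient, gradient_pot, inner_gradPot_self]

theorem Octupole.sphereHessian_pot (K ρ : ℝ) (p u v : E3) :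
    sphereHessian (pot K ρ) p u v = tanHess K ρ p u v := by
  rw [sphereHessian, gradient_pot, inner_gradPot_self, fderiv_gradPot, tanHess]

/-- Taylor's formula, exact because the form is cubic. All local expansions below are therefore
identities, without remainder terms. -/
theorem Octupole.pot_combination (K ρ a b : ℝ) (p u : E3) :
    pot K ρ (a • p + b • u) = a ^ 3 * pot K ρ p + a ^ 2 * b * inner ℝ (gradPot K ρ p) u
      + a * b ^ 2 / 2 * inner ℝ (hessPot K ρ p u) u + b ^ 3 * pot K ρ u := by
  simp [inner_coord, gradPot, pot, hessPot]; ring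

theorem Octupole.gradPot_combination (K ρ a b : ℝ) (p u : E3) :
    gradPot K ρ (a • p + b • u) = a ^ 2 • gradPot K ρ p + (a * b) • hessPot K ρ p u
      + b ^ 2 • gradPot K ρ u := by
  apply ext3 <;> simp [gradPot, hessPot] <;> ring

theorem Octupole.hessPot_combination (K ρ a b : ℝ) (p u v : E3) :
    hessPot K ρ p (a • u + b • v) = a • hessPot K ρ p u + b • hessPot K ρ p v := by
  apply ext3 <;> simp [hessPot] <;> ring

theorem Octupole.inner_hessPot_comm (K ρ : ℝ) (p u v : E3) :
    inner ℝ (hessPot K ρ p u) v = inner ℝ (hessPot K ρ p v) u := by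
  simp [inner_coord, hessPot]; ring

theorem Octupole.tanHess_comm (K ρ : ℝ) (p u v : E3) :
    tanHess K ρ p u v = tanHess K ρ p v u := by
  rw [tanHess, tanHess, inner_hessPot_comm, real_inner_comm v u]

theorem Octupole.tanHess_combination (K ρ a b : ℝ) (p u v w : E3) :
    tanHess K ρ p (a • u + b • v) w = a * tanHess K ρ p u w + b * tanHess K ρ p v w := by
  simp only [tanHess, hessPot_combination, inner_add_left, real_inner_smul_left]; ring

theorem Octupole.tanHess_combination_self (K ρ a b : ℝ) (p u v : E3) :
    tanHess K ρ p (a • u + b • v) (a • u + b • v) = a ^ 2 * tanHess K ρ p u u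
      + 2 * a * b * tanHess K ρ p u v + b ^ 2 * tanHess K ρ p v v := by
  rw [tanHess_combination, tanHess_comm K ρ p u, tanHess_comm K ρ p v, tanHess_combination,
    tanHess_combination, tanHess_comm K ρ p v u]
  ring

theorem Octupole.mem_critPts (K ρ : ℝ) (p : E3) :
    p ∈ critPts (pot K ρ) ↔ p ∈ unitSphere ∧ gradPot K ρ p = (3 * pot K ρ p) • p := by
  rw [critPts, Set.mem_ofPred_eq, sphereGradient_pot, sub_eq_zero]

/-- Oddness makes the antipodal map exchange maxima and minima, so only maxima need a separate
analysis. -/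
theorem Octupole.pot_neg (K ρ : ℝ) (p : E3) : pot K ρ (-p) = - pot K ρ p := by
  simp [pot]; ring

theorem Octupole.gradPot_neg (K ρ : ℝ) (p : E3) : gradPot K ρ (-p) = gradPot K ρ p := by
  apply ext3 <;> simp [gradPot]

theorem Octupole.continuous_pot (K ρ : ℝ) : Continuous (pot K ρ) := by
  unfold pot; fun_prop

theorem Octupole.continuous_tanHess (K ρ : ℝ) (p : E3) :
    Continuous fun u => tanHess K ρ p u u := by
  simp only [tanHess, inner_coord, hessPot]
  simp
  fun_prop

/-- The potential along the sphere near a critical point. -/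
theorem Octupole.pot_sphere_expansion (K ρ : ℝ) {p : E3} (hp : p ∈ critPts (pot K ρ)) (w : E3)
    (hw : inner ℝ p w = 0) (a : ℝ) (ha : a ^ 2 + inner ℝ w w = 1) :
    pot K ρ (a • p + w) - pot K ρ p = - (pot K ρ p / 2) * (1 - a) ^ 2 * (a + 2)
      + a / 2 * tanHess K ρ p w w + pot K ρ w := by
  -- The linear term drops out because the gradient at `p` is radial. With `|w|² = 1 - a²` the terms
  -- in `Φ(p)` combine to `a³ - 3a + 2 = (1-a)²(a+2)`, whose double root at `a = 1` makes this
  -- contribution of order `|w|⁴`.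
  have h := pot_combination K ρ a 1 p w
  rw [one_smul] at h
  rw [h, ((mem_critPts K ρ p).1 hp).2, real_inner_smul_left, hw, tanHess]
  have : inner ℝ w w = 1 - a ^ 2 := by linarith
  rw [this]
  ring

theorem Octupole.neg_mem_unitSphere {p : E3} : -p ∈ unitSphere ↔ p ∈ unitSphere := by
  simp [mem_unitSphere]

theorem Octupole.neg_mem_critPts {K ρ : ℝ} {p : E3} :
    -p ∈ critPts (pot K ρ) ↔ p ∈ critPts (pot K ρ) := by
  rw [mem_critPts, mem_critPts, neg_mem_unitSphere, gradPot_neg, pot_neg]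
  simp

theorem Octupole.isLocalMaxOn_neg {K ρ : ℝ} {p : E3} :
    IsLocalMaxOn (pot K ρ) unitSphere (-p) ↔ IsLocalMinOn (pot K ρ) unitSphere p := by
  have key (q : E3) : Filter.Tendsto (fun x : E3 => -x) (nhdsWithin (-q) unitSphere)
      (nhdsWithin q unitSphere) := by
    have h := (continuous_neg (G := E3)).continuousWithinAt.tendsto_nhdsWithin
      (s := unitSphere) (t := unitSphere) (x := -q) (fun x hx => neg_mem_unitSphere.2 hx)
    rwa [neg_neg] at h
  constructor
  · intro h
    have h2 := (key (-p)).eventually h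
    rw [neg_neg] at h2
    filter_upwards [h2] with x hx
    rw [pot_neg, pot_neg] at hx
    linarith
  · intro h
    have h2 := (key p).eventually h
    filter_upwards [h2] with x hx
    rw [pot_neg] at hx ⊢
    linarith

theorem Octupole.isLocalMinOn_neg {K ρ : ℝ} {p : E3} :
    IsLocalMinOn (pot K ρ) unitSphere (-p) ↔ IsLocalMaxOn (pot K ρ) unitSphere p := by
  rw [← isLocalMaxOn_neg, neg_neg]

theorem Octupole.neg_mem_saddles {K ρ : ℝ} {p : E3} :
    -p ∈ saddles (pot K ρ) ↔ p ∈ saddles (pot K ρ) := by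
  simp only [saddles, Set.mem_ofPred_eq, neg_mem_critPts, isLocalMaxOn_neg, isLocalMinOn_neg]
  tauto

theorem Octupole.tanHess_neg (K ρ : ℝ) (p u v : E3) :
    tanHess K ρ (-p) u v = - tanHess K ρ p u v := by
  have h : hessPot K ρ (-p) u = - hessPot K ρ p u := by
    apply ext3 <;> simp [hessPot] <;> ring
  rw [tanHess, tanHess, h, pot_neg, inner_neg_left]
  ring

/-! ### Second-derivative tests on the sphere -/

/-- A curve on the sphere along which the potential increases excludes a local maximum. -/
theorem Octupole.not_isLocalMaxOn_of_curve {K ρ : ℝ} {p : E3} {γ : ℝ → E3} {F : ℝ → ℝ} (n : ℕ)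
    (hγ : ContinuousAt γ 0) (h0 : γ 0 = p) (hs : ∀ᶠ s in nhds 0, γ s ∈ unitSphere)
    (hF : ContinuousAt F 0) (hF0 : 0 < F 0)
    (h : ∀ᶠ s in nhds 0, pot K ρ (γ s) - pot K ρ p = s ^ n * F s) :
    ¬ IsLocalMaxOn (pot K ρ) unitSphere p := by
  intro hmax
  have ht : Filter.Tendsto γ (nhds 0) (nhdsWithin p unitSphere) := by
    rw [tendsto_nhdsWithin_iff]
    exact ⟨h0 ▸ hγ, hs⟩
  have h1 := ht.eventually hmax
  have h2 := hF.eventually (lt_mem_nhds hF0)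
  -- Approaching through `s > 0` makes `s ^ n` positive whatever the parity of `n`.
  have h3 : ∀ᶠ s in nhdsWithin (0 : ℝ) (Set.Ioi 0), False := by
    filter_upwards [nhdsWithin_le_nhds h1, nhdsWithin_le_nhds h2, nhdsWithin_le_nhds h,
      self_mem_nhdsWithin] with s hs1 hs2 hs3 hs4
    have := mul_pos (pow_pos (Set.mem_Ioi.1 hs4) n) hs2
    linarith
  exact h3.exists.elim fun _ h => h

theorem Octupole.add_smul_mem_unitSphere {p w : E3} (hp : p ∈ unitSphere) (hw : inner ℝ p w = 0)
    {a : ℝ} (ha : a ^ 2 + inner ℝ w w = 1) : a • p + w ∈ unitSphere := by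
  rw [mem_unitSphere] at hp ⊢
  simp only [inner_coord] at hw ha
  simp only [PiLp.add_apply, PiLp.smul_apply, smul_eq_mul]
  linear_combination a ^ 2 * hp + 2 * a * hw + ha

/-- Normal form of the curve `√(1 - |w|²) p + w` on the sphere. -/
theorem Octupole.sqrt_curve {K ρ : ℝ} {p : E3} (hp : p ∈ critPts (pot K ρ)) {w : ℝ → E3}
    (hw : ∀ s, inner ℝ p (w s) = 0) (hc : Continuous w) (h0 : w 0 = 0) (n : ℕ) {F : ℝ → ℝ}
    (hF : ContinuousAt F 0) (hF0 : 0 < F 0)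
    (h : ∀ s a, a = Real.sqrt (1 - inner ℝ (w s) (w s)) → a ^ 2 + inner ℝ (w s) (w s) = 1 →
      0 ≤ a → - (pot K ρ p / 2) * (1 - a) ^ 2 * (a + 2)
      + a / 2 * tanHess K ρ p (w s) (w s) + pot K ρ (w s) = s ^ n * F s) :
    ¬ IsLocalMaxOn (pot K ρ) unitSphere p := by
  have hcc : Continuous fun s => inner ℝ (w s) (w s) := by fun_prop
  have hev : ∀ᶠ s in nhds (0 : ℝ), inner ℝ (w s) (w s) < (1 : ℝ) := by
    refine hcc.continuousAt.eventually (gt_mem_nhds ?_)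
    simp [h0]
  have hsq : ∀ᶠ s in nhds (0 : ℝ),
      Real.sqrt (1 - inner ℝ (w s) (w s)) ^ 2 + inner ℝ (w s) (w s) = 1 := by
    filter_upwards [hev] with s hs
    rw [Real.sq_sqrt (by linarith)]; ring
  refine not_isLocalMaxOn_of_curve (γ := fun s => Real.sqrt (1 - inner ℝ (w s) (w s)) • p + w s)
    n (by fun_prop) (by simp [h0]) ?_ hF hF0 ?_
  · filter_upwards [hsq] with s hs
    exact add_smul_mem_unitSphere hp.1 (hw s) hs
  · filter_upwards [hsq] with s hs
    rw [pot_sphere_expansion K ρ hp _ (hw s) _ hs]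
    exact h s _ rfl hs (Real.sqrt_nonneg _)

theorem Octupole.pot_smul (K ρ a : ℝ) (p : E3) : pot K ρ (a • p) = a ^ 3 * pot K ρ p := by
  simp [pot]; ring

theorem Octupole.tanHess_smul_self (K ρ a : ℝ) (p u : E3) :
    tanHess K ρ p (a • u) (a • u) = a ^ 2 * tanHess K ρ p u u := by
  have := tanHess_combination_self K ρ a 0 p u u
  simpa using this

theorem Octupole.not_isLocalMaxOn_of_tanHess_pos {K ρ : ℝ} {p : E3}
    (hp : p ∈ critPts (pot K ρ)) {w : E3} (hw : inner ℝ p w = 0) (hQ : 0 < tanHess K ρ p w w) :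
    ¬ IsLocalMaxOn (pot K ρ) unitSphere p := by
  set n : ℝ := inner ℝ w w with hn
  have hss (s : ℝ) : inner ℝ (s • w) (s • w) = s ^ 2 * n := by
    rw [real_inner_smul_left, real_inner_smul_right]; ring
  refine sqrt_curve hp (w := fun s => s • w) (fun s => by rw [real_inner_smul_right, hw, mul_zero])
    (by fun_prop) (by simp) 2
    (F := fun s => - (pot K ρ p / 2) * s ^ 2 * n ^ 2 / (1 + Real.sqrt (1 - s ^ 2 * n)) ^ 2
      * (Real.sqrt (1 - s ^ 2 * n) + 2) + Real.sqrt (1 - s ^ 2 * n) / 2 * tanHess K ρ p w w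
      + s * pot K ρ w) ?_ ?_ ?_
  · have : (1 + Real.sqrt (1 - (0 : ℝ) ^ 2 * n)) ^ 2 ≠ 0 := by norm_num
    fun_prop (disch := exact this)
  · simp; exact hQ
  · intro s a ha h1 h0
    rw [hss] at ha h1
    rw [← ha, tanHess_smul_self, pot_smul]
    have h2 : (1 + a) ≠ 0 := by positivity
    -- From `(1 - a)(1 + a) = s² n`: the radial correction is of order four, with a denominator that
    -- stays away from zero.
    have h3 : (1 - a) ^ 2 = s ^ 2 * (s ^ 2 * n ^ 2 / (1 + a) ^ 2) := by
      field_simp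
      linear_combination -(s ^ 2 * n + 1 - a ^ 2) * h1
    rw [h3]
    ring

theorem Octupole.not_isLocalMinOn_of_tanHess_neg {K ρ : ℝ} {p : E3}
    (hp : p ∈ critPts (pot K ρ)) {w : E3} (hw : inner ℝ p w = 0) (hQ : tanHess K ρ p w w < 0) :
    ¬ IsLocalMinOn (pot K ρ) unitSphere p := by
  rw [← isLocalMaxOn_neg]
  refine not_isLocalMaxOn_of_tanHess_pos (neg_mem_critPts.2 hp) (w := w) ?_ ?_
  · rw [inner_neg_left, hw, neg_zero]
  · rw [tanHess_neg]; linarith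

/-- By compactness of the tangent unit circle the quadratic term is at most `-δ|w|²`. It dominates
the cubic term, bounded by `C|w|³`, and the radial correction of order `|w|⁴`. -/
theorem Octupole.isLocalMaxOn_of_tanHess_neg {K ρ : ℝ} {p : E3}
    (hp : p ∈ critPts (pot K ρ)) (hQ : ∀ w, inner ℝ p w = 0 → w ≠ 0 → tanHess K ρ p w w < 0) :
    IsLocalMaxOn (pot K ρ) unitSphere p := by
  obtain ⟨δ, hδ, hδQ⟩ : ∃ δ > 0, ∀ w, inner ℝ p w = 0 → ‖w‖ = 1 → tanHess K ρ p w w ≤ -δ := by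
    set S : Set E3 := {w | inner ℝ p w = 0} ∩ Metric.sphere 0 1 with hS
    have hSc : IsCompact S := by
      refine (isCompact_sphere (0 : E3) 1).inter_left ?_
      exact isClosed_eq (by fun_prop) continuous_const
    rcases S.eq_empty_or_nonempty with he | hne
    · refine ⟨1, one_pos, fun w h1 h2 => ?_⟩
      have : w ∈ S := ⟨h1, by simpa using h2⟩
      rw [he] at this; exact this.elim
    · obtain ⟨w0, hw0, hmax⟩ := hSc.exists_isMaxOn hne (continuous_tanHess K ρ p).continuousOn
      refine ⟨-tanHess K ρ p w0 w0, ?_, fun w h1 h2 => ?_⟩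
      · have := hQ w0 hw0.1 (by
          rintro rfl
          have := hw0.2
          simp at this)
        linarith
      · have : w ∈ S := ⟨h1, by simpa using h2⟩
        have : tanHess K ρ p w w ≤ tanHess K ρ p w0 w0 := hmax this
        linarith
  obtain ⟨C, hC⟩ := (isCompact_sphere (0 : E3) 1).exists_bound_of_continuousOn
    (continuous_pot K ρ).continuousOn
  have hscale (w : E3) (hw : w ≠ 0) : ‖‖w‖⁻¹ • w‖ = 1 := by
    rw [norm_smul, norm_inv, norm_norm, inv_mul_cancel₀ (norm_ne_zero_iff.2 hw)]
  have hww (w : E3) (hw : w ≠ 0) : w = ‖w‖ • (‖w‖⁻¹ • w) := by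
    rw [smul_smul, mul_inv_cancel₀ (norm_ne_zero_iff.2 hw), one_smul]
  have hpp : inner ℝ p p = (1 : ℝ) := by
    have := (mem_unitSphere p).1 hp.1
    rw [inner_coord]; linarith
  -- The sum of the three bounds divided by `|w|²`, as a function of `q`; at `q = p` it equals
  -- `-δ/2`.
  have hB : ContinuousAt (fun q : E3 => |pot K ρ p| / 2 * ((1 - inner ℝ p q) * (inner ℝ p q + 2)
      / (1 + inner ℝ p q)) - inner ℝ p q / 2 * δ
      + C * ‖q - (inner ℝ p q : ℝ) • p‖) p := by
    have : (1 + inner ℝ p p : ℝ) ≠ 0 := by rw [hpp]; norm_num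
    fun_prop (disch := exact this)
  have hB0 := hB.eventually_lt_const (u := 0) (by simp only [hpp]; simp [hδ])
  have ha0 : ∀ᶠ q in nhds p, (0 : ℝ) < inner ℝ p q := by
    refine (show Continuous fun q : E3 => (inner ℝ p q : ℝ) by fun_prop).continuousAt.eventually
      (lt_mem_nhds ?_)
    simp only [hpp]; exact one_pos
  filter_upwards [nhdsWithin_le_nhds hB0, nhdsWithin_le_nhds ha0, self_mem_nhdsWithin]
    with q h1 h2 h3
  set a : ℝ := inner ℝ p q with ha
  set w : E3 := q - a • p with hw
  have hq : q = a • p + w := by rw [hw]; abel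
  have hpw : inner ℝ p w = (0 : ℝ) := by
    rw [hw, inner_sub_right, real_inner_smul_right, hpp, ← ha]; ring
  have hqq : inner ℝ q q = (1 : ℝ) := by
    have := (mem_unitSphere q).1 h3
    rw [inner_coord]; linarith
  have haw : a ^ 2 + inner ℝ w w = 1 := by
    rw [← hqq, hq, inner_add_left, inner_add_right, inner_add_right, real_inner_smul_left,
      real_inner_smul_left, real_inner_smul_right, real_inner_smul_right, hpp, hpw,
      real_inner_comm p w, hpw]; ring
  have hexp := pot_sphere_expansion K ρ hp w hpw a haw
  rw [← hq] at hexp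
  rcases eq_or_ne w 0 with hw0 | hw0
  · rw [hw0] at haw
    have : a = 1 := by
      rw [inner_zero_left] at haw
      nlinarith
    rw [hq, hw0, this]; simp
  · have hn : inner ℝ w w = ‖w‖ ^ 2 := real_inner_self_eq_norm_sq w
    have hnp : 0 < ‖w‖ := norm_pos_iff.2 hw0
    have e1 : tanHess K ρ p w w ≤ ‖w‖ ^ 2 * (-δ) := by
      conv_lhs => rw [hww w hw0]
      rw [tanHess_smul_self]
      refine mul_le_mul_of_nonneg_left (hδQ _ ?_ (hscale w hw0)) (by positivity)
      rw [real_inner_smul_right, hpw, mul_zero]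
    have e2 : pot K ρ w ≤ ‖w‖ ^ 2 * (C * ‖w‖) := by
      conv_lhs => rw [hww w hw0]
      rw [pot_smul]
      have := hC (‖w‖⁻¹ • w) (by simpa using hscale w hw0)
      have := (le_abs_self _).trans this
      calc _ ≤ ‖w‖ ^ 3 * C := mul_le_mul_of_nonneg_left this (by positivity)
        _ = _ := by ring
    have e3 : (1 - a) ^ 2 * (a + 2) = ‖w‖ ^ 2 * ((1 - a) * (a + 2) / (1 + a)) := by
      have : 1 + a ≠ 0 := by positivity
      field_simp
      rw [hn] at haw
      linear_combination (a - 1) * haw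
    have e4 : - (pot K ρ p / 2) * (1 - a) ^ 2 * (a + 2)
        ≤ ‖w‖ ^ 2 * (|pot K ρ p| / 2 * ((1 - a) * (a + 2) / (1 + a))) := by
      have : 0 ≤ (1 - a) ^ 2 * (a + 2) := by positivity
      have h5 := mul_le_mul_of_nonneg_right (neg_abs_le (pot K ρ p)) this
      rw [show ‖w‖ ^ 2 * (|pot K ρ p| / 2 * ((1 - a) * (a + 2) / (1 + a)))
        = |pot K ρ p| / 2 * (‖w‖ ^ 2 * ((1 - a) * (a + 2) / (1 + a))) by ring, ← e3]
      linarith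
    have e5 : a / 2 * tanHess K ρ p w w ≤ ‖w‖ ^ 2 * (- (a / 2 * δ)) := by
      calc _ ≤ a / 2 * (‖w‖ ^ 2 * (-δ)) := mul_le_mul_of_nonneg_left e1 (by positivity)
        _ = _ := by ring
    have e6 := mul_neg_of_pos_of_neg (pow_pos hnp 2) h1
    change pot K ρ q ≤ pot K ρ p
    linarith

theorem Octupole.isLocalMinOn_of_tanHess_pos {K ρ : ℝ} {p : E3}
    (hp : p ∈ critPts (pot K ρ)) (hQ : ∀ w, inner ℝ p w = 0 → w ≠ 0 → 0 < tanHess K ρ p w w) :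
    IsLocalMinOn (pot K ρ) unitSphere p := by
  rw [← isLocalMaxOn_neg]
  refine isLocalMaxOn_of_tanHess_neg (neg_mem_critPts.2 hp) fun w h1 h2 => ?_
  rw [tanHess_neg]
  rw [inner_neg_left, neg_eq_zero] at h1
  linarith [hQ w h1 h2]

/-! ### Tangent frames and binary quadratic forms -/

/-- `u₁, u₂` is a basis of the tangent plane `p^⊥`. -/
structure Octupole.IsTangentFrame (p u₁ u₂ : E3) : Prop where
  left : inner ℝ p u₁ = 0
  right : inner ℝ p u₂ = 0
  span : ∀ w, inner ℝ p w = 0 → ∃ α β : ℝ, w = α • u₁ + β • u₂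
  indep : ∀ α β : ℝ, α • u₁ + β • u₂ = 0 → α = 0 ∧ β = 0

theorem Octupole.inner_self_of_mem_unitSphere {p : E3} (hp : p ∈ unitSphere) :
    inner ℝ p p = (1 : ℝ) := by
  have := (mem_unitSphere p).1 hp
  rw [inner_coord]; linarith

theorem Octupole.exists_orthonormal_frame {p : E3} (hp : p ∈ unitSphere) :
    ∃ e₁ e₂ : E3, Orthonormal ℝ ![p, e₁, e₂] ∧ IsTangentFrame p e₁ e₂ := by
  have hv : Orthonormal ℝ (({0} : Set (Fin 3)).domRestrict fun _ => p) := by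
    constructor
    · intro i
      change ‖p‖ = 1
      simpa [unitSphere] using hp
    · intro i j hij
      exact absurd (Subsingleton.elim i j) hij
  obtain ⟨b, hb⟩ := hv.exists_orthonormalBasis_extension_of_card_eq (by simp)
  have hb0 : b 0 = p := hb 0 rfl
  have hvec : ![p, b 1, b 2] = b := by
    funext i; fin_cases i
    · exact hb0.symm
    · rfl
    · rfl
  have ho : Orthonormal ℝ ![p, b 1, b 2] := hvec ▸ b.orthonormal
  have h01 : inner ℝ p (b 1) = (0 : ℝ) := by rw [← hb0]; exact b.orthonormal.2 (by decide)
  have h02 : inner ℝ p (b 2) = (0 : ℝ) := by rw [← hb0]; exact b.orthonormal.2 (by decide)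
  have h12 : inner ℝ (b 1) (b 2) = (0 : ℝ) := b.orthonormal.2 (by decide)
  refine ⟨b 1, b 2, ho, h01, h02, fun w hw => ?_, fun α β h => ⟨?_, ?_⟩⟩
  · refine ⟨inner ℝ (b 1) w, inner ℝ (b 2) w, ?_⟩
    have := b.sum_repr' w
    rw [Fin.sum_univ_three, hb0, hw, zero_smul, zero_add] at this
    exact this.symm
  · have := congrArg (fun x => inner ℝ (b 1) x) h
    simpa [inner_add_right, real_inner_smul_right, h12] using this
  · have := congrArg (fun x => inner ℝ (b 2) x) h
    simpa [inner_add_right, real_inner_smul_right, real_inner_comm (b 1) (b 2), h12] using this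

theorem Octupole.indefinite_form {a b c : ℝ} (h : a * c - b ^ 2 < 0) :
    (∃ s t : ℝ, 0 < s ^ 2 * a + 2 * s * t * b + t ^ 2 * c) ∧
      ∃ s t : ℝ, s ^ 2 * a + 2 * s * t * b + t ^ 2 * c < 0 := by
  rcases lt_trichotomy a 0 with ha | ha | ha
  -- The vector `(-b, a)` gives the value `a(ac - b²)`, of sign opposite to that of `a`.
  · exact ⟨⟨-b, a, by nlinarith [mul_pos_of_neg_of_neg ha h]⟩, ⟨1, 0, by linarith⟩⟩
  · subst ha
    have hb : b ≠ 0 := by rintro rfl; simp at h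
    refine ⟨⟨(1 - c) / (2 * b), 1, ?_⟩, ⟨(-1 - c) / (2 * b), 1, ?_⟩⟩
    · have : 2 * ((1 - c) / (2 * b)) * 1 * b = 1 - c := by field_simp
      rw [this]; linarith
    · have : 2 * ((-1 - c) / (2 * b)) * 1 * b = -1 - c := by field_simp
      rw [this]; linarith
  · exact ⟨⟨1, 0, by linarith⟩, ⟨-b, a, by nlinarith [mul_neg_of_pos_of_neg ha h]⟩⟩

/-- Completing the square. The extra factor `a` treats positive and negative definite forms
together. -/
theorem Octupole.definite_form {a b c s t : ℝ} (h : 0 < a * c - b ^ 2) (hst : ¬ (s = 0 ∧ t = 0)) :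
    0 < a * (s ^ 2 * a + 2 * s * t * b + t ^ 2 * c) := by
  have e : a * (s ^ 2 * a + 2 * s * t * b + t ^ 2 * c)
      = (a * s + b * t) ^ 2 + (a * c - b ^ 2) * t ^ 2 := by ring
  rw [e]
  by_cases ht : t = 0
  · subst ht
    have ha : a ≠ 0 := by rintro rfl; nlinarith [sq_nonneg b]
    have hs : s ≠ 0 := fun hs => hst ⟨hs, rfl⟩
    have := mul_ne_zero ha hs
    simp only [mul_zero, add_zero]
    positivity
  · have := mul_pos h (pow_pos (abs_pos.2 ht) 2)
    rw [sq_abs] at this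
    positivity

/-- Indefiniteness does not depend on the frame. This carries the sign of the determinant from a
convenient tangent basis to an orthonormal one, as the index requires: a nonnegative determinant
would make the form semidefinite. -/
theorem Octupole.tanHess_det_neg_of_indefinite {K ρ : ℝ} {p e₁ e₂ : E3}
    (hf : IsTangentFrame p e₁ e₂) {u v : E3} (hu : inner ℝ p u = 0) (hv : inner ℝ p v = 0)
    (hpos : 0 < tanHess K ρ p u u) (hneg : tanHess K ρ p v v < 0) :
    tanHess K ρ p e₁ e₁ * tanHess K ρ p e₂ e₂ - tanHess K ρ p e₁ e₂ ^ 2 < 0 := by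
  obtain ⟨α, β, rfl⟩ := hf.span u hu
  obtain ⟨γ, δ, rfl⟩ := hf.span v hv
  rw [tanHess_combination_self] at hpos hneg
  set a := tanHess K ρ p e₁ e₁
  set b := tanHess K ρ p e₁ e₂
  set c := tanHess K ρ p e₂ e₂
  by_contra hcon
  push Not at hcon
  have h1 : 0 ≤ a * (α ^ 2 * a + 2 * α * β * b + β ^ 2 * c) := by
    nlinarith [sq_nonneg (a * α + b * β), mul_nonneg hcon (sq_nonneg β)]
  have h2 : 0 ≤ a * (γ ^ 2 * a + 2 * γ * δ * b + δ ^ 2 * c) := by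
    nlinarith [sq_nonneg (a * γ + b * δ), mul_nonneg hcon (sq_nonneg δ)]
  have ha : a = 0 := le_antisymm (nonpos_of_mul_nonneg_left h2 hneg)
    (nonneg_of_mul_nonneg_left h1 hpos)
  rw [ha] at hcon hpos hneg
  have hb : b = 0 := by nlinarith
  rw [hb] at hpos hneg
  have hc1 : 0 < c := by
    by_contra h; push Not at h; nlinarith [mul_nonneg_of_nonpos_of_nonpos h (neg_nonpos.2 (sq_nonneg β))]
  nlinarith [mul_nonneg hc1.le (sq_nonneg δ)]

/-! ### The index at a nondegenerate saddle -/

/-- The components of the tangential gradient on a small circle, divided by `sin r`. -/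
noncomputable def Octupole.circleField (K ρ : ℝ) (p e₁ e₂ e : E3) (r t : ℝ) : ℝ :=
  Real.cos r * inner ℝ (hessPot K ρ p (Real.cos t • e₁ + Real.sin t • e₂)) e
    + Real.sin r * inner ℝ (gradPot K ρ (Real.cos t • e₁ + Real.sin t • e₂)) e
    - 3 * pot K ρ (geodesicCircle p e₁ e₂ r t) * inner ℝ (Real.cos t • e₁ + Real.sin t • e₂) e

/-- The term `cos² r ∇Φ(p)` is radial at a critical point and so orthogonal to `e`; all other terms
contain `sin r`. The quotient extends continuously to `r = 0`, where it is the Hessian applied to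
the direction. -/
theorem Octupole.inner_sphereGradient_circle {K ρ : ℝ} {p e₁ e₂ : E3}
    (hp : p ∈ critPts (pot K ρ)) {e : E3} (he : inner ℝ p e = 0) (r t : ℝ) :
    inner ℝ e (sphereGradient (pot K ρ) (geodesicCircle p e₁ e₂ r t))
      = Real.sin r * circleField K ρ p e₁ e₂ e r t := by
  have hq : gradPot K ρ (geodesicCircle p e₁ e₂ r t) = _ :=
    gradPot_combination K ρ (Real.cos r) (Real.sin r) p (Real.cos t • e₁ + Real.sin t • e₂)
  have hi : inner ℝ (geodesicCircle p e₁ e₂ r t) e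
      = Real.sin r * inner ℝ (Real.cos t • e₁ + Real.sin t • e₂) e := by
    rw [geodesicCircle, inner_add_left, real_inner_smul_left, real_inner_smul_left, he]; ring
  rw [sphereGradient_pot, circleField, real_inner_comm, inner_sub_left, real_inner_smul_left, hq,
    hi, ((mem_critPts K ρ p).1 hp).2]
  simp only [inner_add_left (𝕜 := ℝ) (_ + _), inner_add_left (𝕜 := ℝ) (_ • _ • p), real_inner_smul_left, he]
  ring

theorem Octupole.continuous_circleField (K ρ : ℝ) (p e₁ e₂ e : E3) :
    Continuous fun x : ℝ × ℝ => circleField K ρ p e₁ e₂ e x.1 x.2 := by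
  have h1 (x : E3) : Continuous fun u => inner ℝ (hessPot K ρ p u) x := by
    simp only [inner_coord, hessPot]; simp; fun_prop
  have h2 (x : E3) : Continuous fun u => inner ℝ (gradPot K ρ u) x := by
    simp only [inner_coord, gradPot]; simp; fun_prop
  have h3 := continuous_pot K ρ
  have h4 : Continuous fun x : ℝ × ℝ => Real.cos x.2 • e₁ + Real.sin x.2 • e₂ := by fun_prop
  have h5 : Continuous fun x : ℝ × ℝ => geodesicCircle p e₁ e₂ x.1 x.2 := by
    unfold geodesicCircle; fun_prop
  unfold circleField
  have := (h1 e).comp h4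
  have := (h2 e).comp h4
  have := h3.comp h5
  simp only [Function.comp_def] at *
  fun_prop

theorem Octupole.continuous_circleField_right (K ρ : ℝ) (p e₁ e₂ e : E3) (r : ℝ) :
    Continuous fun t => circleField K ρ p e₁ e₂ e r t := by
  have h : Continuous fun t : ℝ => ((r, t) : ℝ × ℝ) := continuous_const.prodMk continuous_id
  have h2 := (continuous_circleField K ρ p e₁ e₂ e).comp h
  simp only [Function.comp_def] at h2
  exact h2

theorem Octupole.circleField_two_pi (K ρ : ℝ) (p e₁ e₂ e : E3) (r : ℝ) :
    circleField K ρ p e₁ e₂ e r (2 * Real.pi) = circleField K ρ p e₁ e₂ e r 0 := by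
  simp [circleField, geodesicCircle]

theorem Octupole.hasIndex_of_circleField {K ρ : ℝ} {p e₁ e₂ : E3} {k : ℤ}
    (hp : p ∈ critPts (pot K ρ)) (ho : Orthonormal ℝ ![p, e₁, e₂])
    (h : ∀ᶠ r in nhdsWithin (0 : ℝ) (Set.Ioi 0), HasWindingNumber (fun t =>
      (circleField K ρ p e₁ e₂ e₁ r t : ℂ)
        + (circleField K ρ p e₁ e₂ e₂ r t : ℂ) * Complex.I) k) :
    HasIndex (pot K ρ) p k := by
  have h1 : inner ℝ p e₁ = (0 : ℝ) := ho.2 (i := 0) (j := 1) (by decide)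
  have h2 : inner ℝ p e₂ = (0 : ℝ) := ho.2 (i := 0) (j := 2) (by decide)
  refine ⟨e₁, e₂, ho, ?_⟩
  have hpi : ∀ᶠ r in nhdsWithin (0 : ℝ) (Set.Ioi 0), r < Real.pi :=
    nhdsWithin_le_nhds (gt_mem_nhds Real.pi_pos)
  filter_upwards [h, hpi, self_mem_nhdsWithin] with r hr hrpi hr0
  refine hr.pos_mul (Real.sin_pos_of_pos_of_lt_pi hr0 hrpi) fun t _ => ?_
  rw [inner_sphereGradient_circle hp h1, inner_sphereGradient_circle hp h2]
  push_cast
  ring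

/-- The tube lemma: compactness of the interval of angles reduces uniform statements on small
circles to conditions near each `(0, t)`. -/
theorem Octupole.eventually_forall_circle {P : ℝ → ℝ → Prop}
    (h : ∀ t ∈ Set.Icc 0 (2 * Real.pi), ∀ᶠ x : ℝ × ℝ in nhds (0, t), P x.1 x.2) :
    ∀ᶠ r in nhdsWithin (0 : ℝ) (Set.Ioi 0), ∀ t ∈ Set.Icc 0 (2 * Real.pi), P r t :=
  nhdsWithin_le_nhds (isCompact_Icc.eventually_forall_of_forall_eventually h)

theorem Octupole.exp_neg_one_mul (t : ℝ) : Complex.exp ((((-1 : ℤ) * t : ℝ) : ℂ) * Complex.I)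
    = ((Real.cos t : ℝ) : ℂ) - (Real.sin t : ℝ) * Complex.I := by
  rw [Complex.exp_mul_I, ← Complex.ofReal_cos, ← Complex.ofReal_sin]
  simp [sub_eq_add_neg]

/-- In complex notation a symmetric matrix acts as `z ↦ τ z + β z̄`, with `τ = (a+c)/2` and `β =
(a-c)/2 + ib`, and its determinant is `τ² - |β|²`. If this is negative the antilinear part
dominates, and on the unit circle that part is `β exp(-it)`. -/
theorem Octupole.hasIndex_neg_one {K ρ : ℝ} {p e₁ e₂ : E3}
    (hp : p ∈ critPts (pot K ρ)) (ho : Orthonormal ℝ ![p, e₁, e₂])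
    (hdet : tanHess K ρ p e₁ e₁ * tanHess K ρ p e₂ e₂ - tanHess K ρ p e₁ e₂ ^ 2 < 0) :
    HasIndex (pot K ρ) p (-1) := by
  set a := tanHess K ρ p e₁ e₁ with ha
  set b := tanHess K ρ p e₁ e₂ with hb
  set c := tanHess K ρ p e₂ e₂ with hc
  have c1 := continuous_circleField K ρ p e₁ e₂ e₁
  have c2 := continuous_circleField K ρ p e₁ e₂ e₂
  have s1 (t : ℝ) : circleField K ρ p e₁ e₂ e₁ 0 t = Real.cos t * a + Real.sin t * b := by
    have e : circleField K ρ p e₁ e₂ e₁ 0 t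
      = tanHess K ρ p (Real.cos t • e₁ + Real.sin t • e₂) e₁ := by
      simp [circleField, geodesicCircle, tanHess]
    rw [e, tanHess_combination, tanHess_comm K ρ p e₂]
  have s2 (t : ℝ) : circleField K ρ p e₁ e₂ e₂ 0 t = Real.cos t * b + Real.sin t * c := by
    have e : circleField K ρ p e₁ e₂ e₂ 0 t
      = tanHess K ρ p (Real.cos t • e₁ + Real.sin t • e₂) e₂ := by
      simp [circleField, geodesicCircle, tanHess]
    rw [e, tanHess_combination]
  set u : ℝ := (a - c) / 2 with hu
  have hR : ((a + c) / 2) ^ 2 < u ^ 2 + b ^ 2 := by rw [hu]; linarith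
  set β : ℂ := ⟨u, b⟩ with hβ
  have hβ0 : β ≠ 0 := by
    intro h
    rw [Complex.ext_iff] at h
    have h1 : u = 0 := h.1
    have h2 : b = 0 := h.2
    rw [h1, h2] at hR
    nlinarith [sq_nonneg ((a + c) / 2)]
  apply hasIndex_of_circleField hp ho
  have key : ∀ᶠ r in nhdsWithin (0 : ℝ) (Set.Ioi 0), ∀ t ∈ Set.Icc 0 (2 * Real.pi),
      0 < circleField K ρ p e₁ e₂ e₁ r t * (u * Real.cos t + b * Real.sin t)
        + circleField K ρ p e₁ e₂ e₂ r t * (b * Real.cos t - u * Real.sin t) := by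
    refine eventually_forall_circle (P := fun r t =>
      0 < circleField K ρ p e₁ e₂ e₁ r t * (u * Real.cos t + b * Real.sin t)
        + circleField K ρ p e₁ e₂ e₂ r t * (b * Real.cos t - u * Real.sin t)) fun t _ => ?_
    have hcont : Continuous fun x : ℝ × ℝ =>
      circleField K ρ p e₁ e₂ e₁ x.1 x.2 * (u * Real.cos x.2 + b * Real.sin x.2)
        + circleField K ρ p e₁ e₂ e₂ x.1 x.2 * (b * Real.cos x.2 - u * Real.sin x.2) := by
      fun_prop
    refine hcont.continuousAt.eventually (lt_mem_nhds ?_)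
    simp only [s1, s2]
    set C := Real.cos t
    set S := Real.sin t
    have hCS : C ^ 2 + S ^ 2 = 1 := Real.cos_sq_add_sin_sq t
    -- `x` is the real part of `β̄ z²` with `|z| = 1`, hence `|x| ≤ |β|`, and the pairing to be
    -- bounded is `|β|² + τ x`.
    set x : ℝ := u * (C ^ 2 - S ^ 2) + 2 * b * (C * S) with hx
    have hx2 : x ^ 2 ≤ u ^ 2 + b ^ 2 := by
      have : u ^ 2 + b ^ 2 = x ^ 2 + (2 * u * (C * S) - b * (C ^ 2 - S ^ 2)) ^ 2 := by
        rw [hx]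
        linear_combination (-(u ^ 2 + b ^ 2) * (C ^ 2 + S ^ 2 + 1)) * hCS
      rw [this]; nlinarith [sq_nonneg (2 * u * (C * S) - b * (C ^ 2 - S ^ 2))]
    have e : (C * a + S * b) * (u * C + b * S) + (C * b + S * c) * (b * C - u * S)
        = (u ^ 2 + b ^ 2) + (a + c) / 2 * x := by
      rw [hx, hu]
      linear_combination ((a - c) ^ 2 / 4 + b ^ 2) * hCS
    rw [e]
    have h2 : |(a + c) / 2 * x| < u ^ 2 + b ^ 2 := by
      refine abs_lt_of_sq_lt_sq ?_ (by positivity)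
      have hpos : 0 < u ^ 2 + b ^ 2 := lt_of_le_of_lt (sq_nonneg _) hR
      calc ((a + c) / 2 * x) ^ 2 = ((a + c) / 2) ^ 2 * x ^ 2 := by ring
        _ ≤ ((a + c) / 2) ^ 2 * (u ^ 2 + b ^ 2) :=
          mul_le_mul_of_nonneg_left hx2 (sq_nonneg _)
        _ < (u ^ 2 + b ^ 2) * (u ^ 2 + b ^ 2) := mul_lt_mul_of_pos_right hR hpos
        _ = _ := by ring
    linarith [(abs_lt.1 h2).1]
  filter_upwards [key] with r hr
  refine winding_of_re_pos β hβ0 (-1) ?_ (by simp only [circleField_two_pi]) fun t ht => ?_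
  · exact ((Complex.continuous_ofReal.comp
      (continuous_circleField_right K ρ p e₁ e₂ e₁ r)).add ((Complex.continuous_ofReal.comp
      (continuous_circleField_right K ρ p e₁ e₂ e₂ r)).mul continuous_const)).continuousOn
  · rw [Complex.mem_slitPlane_iff, exp_neg_one_mul]
    left
    have := hr t ht
    simp only [hβ, map_mul, map_sub, Complex.conj_ofReal, Complex.conj_I,
      Complex.mul_re, Complex.add_re, Complex.ofReal_re, Complex.ofReal_im, Complex.I_re,
      Complex.I_im, Complex.mul_im, Complex.add_im, Complex.sub_re, Complex.sub_im,
      Complex.neg_re, Complex.neg_im, Complex.conj_re, Complex.conj_im]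
    nlinarith

/-- A critical point at which the Hessian is indefinite. -/
theorem Octupole.saddle_of_det_neg {K ρ : ℝ} {p u₁ u₂ : E3} (hp : p ∈ critPts (pot K ρ))
    (hf : IsTangentFrame p u₁ u₂)
    (hdet : tanHess K ρ p u₁ u₁ * tanHess K ρ p u₂ u₂ - tanHess K ρ p u₁ u₂ ^ 2 < 0) :
    p ∈ saddles (pot K ρ) ∧ ¬ IsDegenerateAt (pot K ρ) p ∧ HasIndex (pot K ρ) p (-1) := by
  obtain ⟨⟨s, t, hpos⟩, ⟨s', t', hneg⟩⟩ := indefinite_form hdet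
  have htan (s t : ℝ) : inner ℝ p (s • u₁ + t • u₂) = (0 : ℝ) := by
    rw [inner_add_right, real_inner_smul_right, real_inner_smul_right, hf.left, hf.right]; ring
  rw [← tanHess_combination_self] at hpos hneg
  refine ⟨⟨hp, not_isLocalMaxOn_of_tanHess_pos hp (htan s t) hpos,
    not_isLocalMinOn_of_tanHess_neg hp (htan s' t') hneg⟩, ?_, ?_⟩
  · rintro ⟨u, hu0, hu, h⟩
    obtain ⟨α, β, rfl⟩ := hf.span u hu
    have h1 := h u₁ hf.left
    have h2 := h u₂ hf.right
    rw [sphereHessian_pot, tanHess_combination] at h1 h2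
    rw [tanHess_comm K ρ p u₂ u₁] at h1
    set a := tanHess K ρ p u₁ u₁
    set b := tanHess K ρ p u₁ u₂
    set c := tanHess K ρ p u₂ u₂
    -- Cramer's rule: the determinant annihilates both coordinates of a kernel vector.
    have hα : (a * c - b ^ 2) * α = 0 := by linear_combination c * h1 - b * h2
    have hβ : (a * c - b ^ 2) * β = 0 := by linear_combination a * h2 - b * h1
    rcases mul_eq_zero.1 hα with h | h
    · exact hdet.ne h
    · rcases mul_eq_zero.1 hβ with h' | h'
      · exact hdet.ne h'
      · exact hu0 (by rw [h, h']; simp)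
  · obtain ⟨e₁, e₂, ho, hf'⟩ := exists_orthonormal_frame hp.1
    exact hasIndex_neg_one hp ho
      (tanHess_det_neg_of_indefinite hf' (htan s t) (htan s' t') hpos hneg)

/-- A critical point at which the Hessian is definite. -/
theorem Octupole.extremal_of_det_pos {K ρ : ℝ} {p u₁ u₂ : E3} (hp : p ∈ critPts (pot K ρ))
    (hf : IsTangentFrame p u₁ u₂)
    (hdet : 0 < tanHess K ρ p u₁ u₁ * tanHess K ρ p u₂ u₂ - tanHess K ρ p u₁ u₂ ^ 2) :
    p ∉ saddles (pot K ρ) ∧ ¬ (p ∈ maxPts (pot K ρ) ∧ p ∈ minPts (pot K ρ)) := by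
  have ha : tanHess K ρ p u₁ u₁ ≠ 0 := by
    intro h; rw [h] at hdet; nlinarith [sq_nonneg (tanHess K ρ p u₁ u₂)]
  have hdef (w : E3) (hw : inner ℝ p w = 0) (hw0 : w ≠ 0) :
      0 < tanHess K ρ p u₁ u₁ * tanHess K ρ p w w := by
    obtain ⟨α, β, rfl⟩ := hf.span w hw
    rw [tanHess_combination_self]
    refine definite_form hdet fun h => hw0 ?_
    rw [h.1, h.2]; simp
  rcases lt_or_gt_of_ne ha with h | h
  · refine ⟨fun hs => hs.2.1 (isLocalMaxOn_of_tanHess_neg hp fun w h1 h2 => ?_), fun hmm =>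
      not_isLocalMinOn_of_tanHess_neg hp hf.left h hmm.2.2⟩
    exact neg_of_mul_pos_right (hdef w h1 h2) h.le
  · refine ⟨fun hs => hs.2.2 (isLocalMinOn_of_tanHess_pos hp fun w h1 h2 => ?_), fun hmm =>
      not_isLocalMaxOn_of_tanHess_pos hp hf.left h hmm.1.2⟩
    exact pos_of_mul_pos_right (hdef w h1 h2) h.le

/-! ### The mirror plane `x = 0` -/

noncomputable def Octupole.eX : E3 := !₂[1, 0, 0]

/-- The unit tangent at `p` to the great circle `x = 0`. -/
noncomputable def Octupole.eT (p : E3) : E3 := !₂[0, -p 2, p 1]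

/-- The second derivative of `pot` in the direction `x`, a linear form where `x = 0`. -/
noncomputable def Octupole.mirrorForm (K ρ : ℝ) (p : E3) : ℝ := -3 * (ρ + 1) * p 2 - 6 * K * p 1

section
variable {K ρ : ℝ} {p : E3}

theorem Octupole.orthonormal_mirror (hp : p ∈ unitSphere) (h0 : p 0 = 0) :
    Orthonormal ℝ ![p, eX, eT p] := by
  have h := (mem_unitSphere p).1 hp
  rw [orthonormal_iff_ite]
  intro i j
  rw [h0] at h
  fin_cases i <;> fin_cases j <;> simp only [inner_coord] <;> simp [eX, eT, h0] <;> linarith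

theorem Octupole.isTangentFrame_mirror (hp : p ∈ unitSphere) (h0 : p 0 = 0) :
    IsTangentFrame p eX (eT p) := by
  have h := (mem_unitSphere p).1 hp
  rw [h0] at h
  refine ⟨by simp [inner_coord, eX, h0], by simp [inner_coord, eT]; ring, fun w hw => ?_,
    fun α β hab => ?_⟩
  · rw [inner_coord, h0] at hw
    refine ⟨w 0, p 1 * w 2 - p 2 * w 1, ext3 ?_ ?_ ?_⟩
    · simp [eX, eT]
    · simp [eX, eT]; linear_combination (-w 1) * h + p 1 * hw
    · simp [eX, eT]; linear_combination (-w 2) * h + p 2 * hw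
  · have e0 := congrArg (fun v : E3 => v 0) hab
    have e1 := congrArg (fun v : E3 => v 1) hab
    have e2 := congrArg (fun v : E3 => v 2) hab
    simp [eX, eT] at e0 e1 e2
    refine ⟨e0, ?_⟩
    rcases e1 with e1 | e1
    · exact e1
    · rcases e2 with e2 | e2
      · exact e2
      · rw [e1, e2] at h; norm_num at h

/-- Only even powers of `α` survive, by the symmetry `x ↦ -x`. The coefficients `pot K ρ (eT p)` and
`mirrorForm K ρ (eT p)` are the whole cubic part of the local expansion. -/
theorem Octupole.pot_mirror (α β : ℝ) : pot K ρ (α • eX + β • eT p)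
    = β ^ 3 * pot K ρ (eT p) + α ^ 2 * β / 2 * mirrorForm K ρ (eT p) := by
  simp [pot, eX, eT, mirrorForm]; ring

theorem Octupole.gradPot_mirror_left (α β : ℝ) :
    inner ℝ (gradPot K ρ (α • eX + β • eT p)) eX = α * β * mirrorForm K ρ (eT p) := by
  simp [inner_coord, gradPot, eX, eT, mirrorForm]; ring

theorem Octupole.gradPot_mirror_right (α β : ℝ) :
    inner ℝ (gradPot K ρ (α • eX + β • eT p)) (eT p)
      = 3 * β ^ 2 * pot K ρ (eT p) + α ^ 2 / 2 * mirrorForm K ρ (eT p) := by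
  simp [inner_coord, gradPot, pot, eX, eT, mirrorForm]; ring

theorem Octupole.tanHess_mirror_left :
    tanHess K ρ p eX eX = mirrorForm K ρ p - 3 * pot K ρ p := by
  simp only [tanHess, inner_coord]
  simp [hessPot, eX, mirrorForm]

theorem Octupole.tanHess_mirror_mixed (h0 : p 0 = 0) : tanHess K ρ p eX (eT p) = 0 := by
  simp [tanHess, inner_coord, hessPot, eX, eT, h0]

/-- The cubic form is harmonic, so its Hessian in space is traceless. The radial entry is `6Φ(p)`
and the multiplier removes `3Φ(p)` in each of two tangent directions, leaving the tangential trace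
`-12Φ(p)`. -/
theorem Octupole.tanHess_mirror_right (hp : p ∈ unitSphere) (h0 : p 0 = 0) :
    tanHess K ρ p (eT p) (eT p) = -12 * pot K ρ p - tanHess K ρ p eX eX := by
  have h := (mem_unitSphere p).1 hp
  rw [h0] at h
  simp only [tanHess, inner_coord]
  simp [hessPot, eX, eT, h0, pot]
  linear_combination (3 * (ρ + 1) * p 2 + 6 * K * p 1 - 3 * (p 2 ^ 3 - 3 * p 1 ^ 2 * p 2
    + 3 / 2 * (ρ + 1) * p 1 ^ 2 * p 2 + K * p 1 * p 1 ^ 2)) * h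

end

/-! ### Degenerate saddles with a nonzero cubic term: fold and monkey saddle -/

section
variable {K ρ : ℝ} {p : E3}

theorem Octupole.isDegenerateAt_of_frame {u₁ u₂ : E3} (hf : IsTangentFrame p u₁ u₂)
    (h11 : tanHess K ρ p u₁ u₁ = 0) (h12 : tanHess K ρ p u₁ u₂ = 0) :
    IsDegenerateAt (pot K ρ) p := by
  refine ⟨u₁, ?_, hf.left, fun v hv => ?_⟩
  · rintro rfl
    exact one_ne_zero (hf.indep 1 0 (by simp)).1
  · obtain ⟨α, β, rfl⟩ := hf.span v hv
    rw [sphereHessian_pot, tanHess_comm, tanHess_combination, tanHess_comm K ρ p u₂, h11, h12]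
    ring

theorem Octupole.IsTangentFrame.symm {u₁ u₂ : E3} (hf : IsTangentFrame p u₁ u₂) :
    IsTangentFrame p u₂ u₁ := by
  refine ⟨hf.right, hf.left, fun w hw => ?_, fun α β h => ?_⟩
  · obtain ⟨α, β, h⟩ := hf.span w hw
    exact ⟨β, α, by rw [h, add_comm]⟩
  · exact (hf.indep β α (by rw [← h, add_comm])).symm

/-- The normalized field on small circles in terms of the tangential Hessian. -/
theorem Octupole.circleField_eq {e₁ e₂ e : E3} (r t : ℝ) :
    circleField K ρ p e₁ e₂ e r t
      = Real.cos r * tanHess K ρ p (Real.cos t • e₁ + Real.sin t • e₂) e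
      + Real.sin r * inner ℝ (gradPot K ρ (Real.cos t • e₁ + Real.sin t • e₂)) e
      + 3 * (Real.cos r * pot K ρ p - pot K ρ (geodesicCircle p e₁ e₂ r t))
        * inner ℝ (Real.cos t • e₁ + Real.sin t • e₂) e := by
  rw [circleField, tanHess]; ring

theorem Octupole.pot_geodesicCircle {e₁ e₂ : E3} (hp : p ∈ critPts (pot K ρ))
    (ho : Orthonormal ℝ ![p, e₁, e₂]) (r t : ℝ) :
    pot K ρ (geodesicCircle p e₁ e₂ r t) = Real.cos r ^ 3 * pot K ρ p
      + Real.cos r * Real.sin r ^ 2 / 2 *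
        (tanHess K ρ p (Real.cos t • e₁ + Real.sin t • e₂) (Real.cos t • e₁ + Real.sin t • e₂)
          + 3 * pot K ρ p)
      + Real.sin r ^ 3 * pot K ρ (Real.cos t • e₁ + Real.sin t • e₂) := by
  have h01 : inner ℝ p e₁ = (0 : ℝ) := ho.2 (i := 0) (j := 1) (by decide)
  have h02 : inner ℝ p e₂ = (0 : ℝ) := ho.2 (i := 0) (j := 2) (by decide)
  have h12 : inner ℝ e₁ e₂ = (0 : ℝ) := ho.2 (i := 1) (j := 2) (by decide)
  have h11 : inner ℝ e₁ e₁ = (1 : ℝ) := by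
    rw [real_inner_self_eq_norm_sq, show ‖e₁‖ = 1 from ho.1 1]; norm_num
  have h22 : inner ℝ e₂ e₂ = (1 : ℝ) := by
    rw [real_inner_self_eq_norm_sq, show ‖e₂‖ = 1 from ho.1 2]; norm_num
  have hu : inner ℝ (Real.cos t • e₁ + Real.sin t • e₂) (Real.cos t • e₁ + Real.sin t • e₂)
      = (1 : ℝ) := by
    simp only [inner_add_left, inner_add_right, real_inner_smul_left, real_inner_smul_right, h11,
      h12, h22, real_inner_comm e₁ e₂]
    linear_combination Real.sin_sq_add_cos_sq t
  have hpu : inner ℝ p (Real.cos t • e₁ + Real.sin t • e₂) = (0 : ℝ) := by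
    simp only [inner_add_right, real_inner_smul_right, h01, h02]; ring
  rw [geodesicCircle, pot_combination, ((mem_critPts K ρ p).1 hp).2, real_inner_smul_left, hpu,
    tanHess, hu]
  ring

theorem Octupole.sin_pos_eventually : ∀ᶠ r in nhdsWithin (0 : ℝ) (Set.Ioi 0), 0 < Real.sin r := by
  have hpi : ∀ᶠ r in nhdsWithin (0 : ℝ) (Set.Ioi 0), r < Real.pi :=
    nhdsWithin_le_nhds (gt_mem_nhds Real.pi_pos)
  filter_upwards [hpi, self_mem_nhdsWithin] with r hr h0
  exact Real.sin_pos_of_pos_of_lt_pi h0 hr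

theorem Octupole.continuousOn_circleLoop {e₁ e₂ : E3} (r : ℝ) :
    ContinuousOn (fun t => (circleField K ρ p e₁ e₂ e₁ r t : ℂ)
        + (circleField K ρ p e₁ e₂ e₂ r t : ℂ) * Complex.I) (Set.Icc 0 (2 * Real.pi)) :=
  ((Complex.continuous_ofReal.comp
    (continuous_circleField_right K ρ p e₁ e₂ e₁ r)).add ((Complex.continuous_ofReal.comp
    (continuous_circleField_right K ρ p e₁ e₂ e₂ r)).mul continuous_const)).continuousOn

theorem Octupole.inner_orthonormal_frame {e₁ e₂ : E3} (ho : Orthonormal ℝ ![p, e₁, e₂])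
    (α β : ℝ) : inner ℝ (α • e₁ + β • e₂) e₁ = α ∧ inner ℝ (α • e₁ + β • e₂) e₂ = β := by
  have h12 : inner ℝ e₁ e₂ = (0 : ℝ) := ho.2 (i := 1) (j := 2) (by decide)
  have h11 : inner ℝ e₁ e₁ = (1 : ℝ) := by
    rw [real_inner_self_eq_norm_sq, show ‖e₁‖ = 1 from ho.1 1]; norm_num
  have h22 : inner ℝ e₂ e₂ = (1 : ℝ) := by
    rw [real_inner_self_eq_norm_sq, show ‖e₂‖ = 1 from ho.1 2]; norm_num
  constructor <;> simp only [inner_add_left, real_inner_smul_left, h11, h12, h22,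
    real_inner_comm e₁ e₂] <;> ring

/-- In a null direction of the Hessian the cubic term leads, since the radial correction is of order
four. -/
theorem Octupole.not_isLocalMaxOn_of_cubic_pos (hp : p ∈ critPts (pot K ρ)) {e : E3}
    (he : inner ℝ p e = 0) (hn : inner ℝ e e = (1 : ℝ)) (hQ : tanHess K ρ p e e = 0)
    (hm : 0 < pot K ρ e) : ¬ IsLocalMaxOn (pot K ρ) unitSphere p := by
  have hss (s : ℝ) : inner ℝ (s • e) (s • e) = s ^ 2 := by
    rw [real_inner_smul_left, real_inner_smul_right, hn]; ring
  refine sqrt_curve hp (w := fun s => s • e) (fun s => by rw [real_inner_smul_right, he, mul_zero])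
    (by fun_prop) (by simp) 3
    (F := fun s => - (pot K ρ p / 2) * s / (1 + Real.sqrt (1 - s ^ 2)) ^ 2
      * (Real.sqrt (1 - s ^ 2) + 2) + pot K ρ e) ?_ ?_ ?_
  · have : (1 + Real.sqrt (1 - (0 : ℝ) ^ 2)) ^ 2 ≠ 0 := by norm_num
    fun_prop (disch := exact this)
  · simp; exact hm
  · intro s a ha h1 h0
    rw [hss] at ha h1
    rw [← ha, tanHess_smul_self, pot_smul, hQ]
    have h2 : (1 + a) ≠ 0 := by positivity
    have h3 : (1 - a) ^ 2 = s ^ 2 * (s ^ 2 / (1 + a) ^ 2) := by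
      field_simp
      linear_combination -(s ^ 2 + 1 - a ^ 2) * h1
    rw [h3]
    ring

theorem Octupole.not_isLocalMaxOn_of_cubic (hp : p ∈ critPts (pot K ρ)) {e : E3}
    (he : inner ℝ p e = 0) (hn : inner ℝ e e = (1 : ℝ)) (hQ : tanHess K ρ p e e = 0)
    (hm : pot K ρ e ≠ 0) : ¬ IsLocalMaxOn (pot K ρ) unitSphere p := by
  rcases lt_or_gt_of_ne hm with h | h
  · refine not_isLocalMaxOn_of_cubic_pos hp (e := -e) ?_ ?_ ?_ ?_
    · rw [inner_neg_right, he, neg_zero]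
    · rw [inner_neg_neg, hn]
    · rw [← neg_one_smul ℝ, tanHess_smul_self, hQ, mul_zero]
    · rw [pot_neg]; linarith
  · exact not_isLocalMaxOn_of_cubic_pos hp he hn hQ h

/-- A leading term of odd degree takes both signs. -/
theorem Octupole.saddle_of_cubic (hp : p ∈ critPts (pot K ρ)) {e : E3}
    (he : inner ℝ p e = 0) (hn : inner ℝ e e = (1 : ℝ)) (hQ : tanHess K ρ p e e = 0)
    (hm : pot K ρ e ≠ 0) : p ∈ saddles (pot K ρ) := by
  refine ⟨hp, not_isLocalMaxOn_of_cubic hp he hn hQ hm, ?_⟩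
  rw [← isLocalMaxOn_neg]
  refine not_isLocalMaxOn_of_cubic (neg_mem_critPts.2 hp) (e := e) ?_ hn ?_ hm
  · rw [inner_neg_left, he, neg_zero]
  · rw [tanHess_neg, hQ, neg_zero]

theorem Octupole.inner_eT_self (hp : p ∈ unitSphere) (h0 : p 0 = 0) :
    inner ℝ (eT p) (eT p) = (1 : ℝ) := by
  have h := (mem_unitSphere p).1 hp
  rw [h0] at h
  rw [inner_coord]; simp [eT]; linarith

/-- A fold point (saddle-node): index `0`. -/
theorem Octupole.hasIndex_zero_of_fold (hp : p ∈ critPts (pot K ρ)) (h0 : p 0 = 0)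
    (h11 : tanHess K ρ p eX eX ≠ 0) (h22 : tanHess K ρ p (eT p) (eT p) = 0)
    (hm : pot K ρ (eT p) ≠ 0) : HasIndex (pot K ρ) p 0 := by
  have ho := orthonormal_mirror hp.1 h0
  have h12 := tanHess_mirror_mixed (K := K) (ρ := ρ) h0
  set m := pot K ρ (eT p) with hmdef
  set l := mirrorForm K ρ (eT p)
  set P := pot K ρ p with hP
  set a := tanHess K ρ p eX eX
  have c1 := continuous_circleField K ρ p eX (eT p) eX
  apply hasIndex_of_circleField hp ho
  set B : ℝ → ℝ → ℝ := fun r t =>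
    3 * P * Real.sin t * Real.cos r * Real.sin r + 3 * Real.sin t ^ 2 * m + Real.cos t ^ 2 / 2 * l
      - 3 * Real.sin t * (Real.cos r * Real.sin r / 2 * (Real.cos t ^ 2 * a + 3 * P)
        + Real.sin r ^ 2 * (Real.sin t ^ 3 * m + Real.cos t ^ 2 * Real.sin t / 2 * l)) with hB
  have s1 (t : ℝ) : circleField K ρ p eX (eT p) eX 0 t = Real.cos t * a := by
    rw [circleField_eq]
    simp only [geodesicCircle, Real.cos_zero, Real.sin_zero, zero_smul, one_smul, add_zero,
      tanHess_combination, tanHess_comm K ρ p (eT p) eX, h12]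
    ring
  have s2 (r t : ℝ) : circleField K ρ p eX (eT p) (eT p) r t = Real.sin r * B r t := by
    rw [circleField_eq, pot_geodesicCircle hp ho, pot_mirror, gradPot_mirror_right,
      (inner_orthonormal_frame ho _ _).2, tanHess_combination_self, tanHess_combination, h12, h22]
    simp only [hB]
    have := Real.sin_sq_add_cos_sq r
    linear_combination (3 * P * Real.cos r * Real.sin t) * (-this)
  -- The first component tends to `a cos t`, and at its zeros the second component divided by `sin
  -- r` tends to `3m`. The loop therefore avoids the ray opposite to `i m` and can be compared with
  -- that constant.
  have key : ∀ᶠ r in nhdsWithin (0 : ℝ) (Set.Ioi 0), ∀ t ∈ Set.Icc 0 (2 * Real.pi),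
      circleField K ρ p eX (eT p) eX r t ≠ 0 ∨ 0 < B r t * m := by
    refine eventually_forall_circle (P := fun r t =>
      circleField K ρ p eX (eT p) eX r t ≠ 0 ∨ 0 < B r t * m) fun t _ => ?_
    by_cases hc : Real.cos t = 0
    · have hcont : Continuous fun x : ℝ × ℝ => B x.1 x.2 * m := by
        simp only [hB]; fun_prop
      have h2 : 0 < B 0 t * m := by
        have hs : Real.sin t ^ 2 = 1 := by
          have := Real.sin_sq_add_cos_sq t; rw [hc] at this; linarith
        simp only [hB, hc, Real.sin_zero, hs]
        have : 0 < m ^ 2 := by positivity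
        linarith
      filter_upwards [hcont.continuousAt.eventually (lt_mem_nhds h2)] with x hx
      exact Or.inr hx
    · have h2 : circleField K ρ p eX (eT p) eX 0 t ≠ 0 := by
        rw [s1]; exact mul_ne_zero hc h11
      filter_upwards [c1.continuousAt.eventually_ne (y := (0 : ℝ)) (x := ((0 : ℝ), t)) h2] with x hx
      exact Or.inl hx
  filter_upwards [key, sin_pos_eventually] with r hr hs
  refine winding_of_re_pos ((m : ℂ) * Complex.I) (by simpa using hm) 0 (continuousOn_circleLoop r)
    (by simp only [circleField_two_pi]) fun t ht => ?_
  rw [Complex.mem_slitPlane_iff, s2]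
  simp only [Int.cast_zero, zero_mul, Complex.ofReal_zero, Complex.exp_zero, mul_one, map_mul,
    Complex.conj_ofReal, Complex.conj_I, Complex.mul_re, Complex.add_re, Complex.ofReal_re,
    Complex.ofReal_im, Complex.I_re, Complex.I_im, Complex.mul_im, Complex.add_im,
    Complex.neg_re, Complex.neg_im]
  rcases hr t ht with h | h
  · right
    intro h'
    exact mul_ne_zero h hm (by linarith)
  · left
    have := mul_pos hs h
    linarith

/-- A monkey saddle: index `-2`. -/
theorem Octupole.hasIndex_neg_two {e₁ e₂ : E3} (hp : p ∈ critPts (pot K ρ))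
    (ho : Orthonormal ℝ ![p, e₁, e₂]) (hP : pot K ρ p = 0)
    (hQ : ∀ u v, inner ℝ p u = 0 → inner ℝ p v = 0 → tanHess K ρ p u v = 0) {κ : ℝ} (hκ : κ ≠ 0)
    (h1 : ∀ α β : ℝ, inner ℝ (gradPot K ρ (α • e₁ + β • e₂)) e₁ = -2 * κ * α * β)
    (h2 : ∀ α β : ℝ, inner ℝ (gradPot K ρ (α • e₁ + β • e₂)) e₂ = κ * (β ^ 2 - α ^ 2)) :
    HasIndex (pot K ρ) p (-2) := by
  have h01 : inner ℝ p e₁ = (0 : ℝ) := ho.2 (i := 0) (j := 1) (by decide)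
  have h02 : inner ℝ p e₂ = (0 : ℝ) := ho.2 (i := 0) (j := 2) (by decide)
  have hpu (t : ℝ) : inner ℝ p (Real.cos t • e₁ + Real.sin t • e₂) = (0 : ℝ) := by
    simp only [inner_add_right, real_inner_smul_right, h01, h02]; ring
  apply hasIndex_of_circleField hp ho
  set A : ℝ → ℝ → ℝ := fun r t => -2 * κ * Real.cos t * Real.sin t
    - 3 * (Real.sin r ^ 2 * pot K ρ (Real.cos t • e₁ + Real.sin t • e₂)) * Real.cos t with hA
  set B : ℝ → ℝ → ℝ := fun r t => κ * (Real.sin t ^ 2 - Real.cos t ^ 2)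
    - 3 * (Real.sin r ^ 2 * pot K ρ (Real.cos t • e₁ + Real.sin t • e₂)) * Real.sin t with hB
  have s1 (r t : ℝ) : circleField K ρ p e₁ e₂ e₁ r t = Real.sin r * A r t := by
    rw [circleField_eq, pot_geodesicCircle hp ho, h1, (inner_orthonormal_frame ho _ _).1,
      hQ _ _ (hpu t) (hpu t), hQ _ _ (hpu t) h01, hP]
    simp only [hA]; ring
  have s2 (r t : ℝ) : circleField K ρ p e₁ e₂ e₂ r t = Real.sin r * B r t := by
    rw [circleField_eq, pot_geodesicCircle hp ho, h2, (inner_orthonormal_frame ho _ _).2,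
      hQ _ _ (hpu t) (hpu t), hQ _ _ (hpu t) h02, hP]
    simp only [hB]; ring
  have hpc : Continuous fun t : ℝ => pot K ρ (Real.cos t • e₁ + Real.sin t • e₂) :=
    (continuous_pot K ρ).comp (by fun_prop)
  have hpc2 : Continuous fun x : ℝ × ℝ => pot K ρ (Real.cos x.2 • e₁ + Real.sin x.2 • e₂) :=
    hpc.comp continuous_snd
  -- In the limit `r = 0` the loop `A + iB` is `-κ i exp(-2it)`, so its pairing with that reference
  -- loop is `κ²`.
  have key : ∀ᶠ r in nhdsWithin (0 : ℝ) (Set.Ioi 0), ∀ t ∈ Set.Icc 0 (2 * Real.pi),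
      0 < - κ * (A r t * Real.sin (2 * t) + B r t * Real.cos (2 * t)) := by
    refine eventually_forall_circle (P := fun r t =>
      0 < - κ * (A r t * Real.sin (2 * t) + B r t * Real.cos (2 * t))) fun t _ => ?_
    have hcont : Continuous fun x : ℝ × ℝ =>
        - κ * (A x.1 x.2 * Real.sin (2 * x.2) + B x.1 x.2 * Real.cos (2 * x.2)) := by
      simp only [hA, hB]; fun_prop
    refine hcont.continuousAt.eventually (lt_mem_nhds ?_)
    have e : - κ * (A 0 t * Real.sin (2 * t) + B 0 t * Real.cos (2 * t)) = κ ^ 2 := by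
      simp only [hA, hB, Real.sin_zero, Real.sin_two_mul, Real.cos_two_mul']
      have := Real.sin_sq_add_cos_sq t
      linear_combination κ ^ 2 * (Real.sin t ^ 2 + Real.cos t ^ 2 + 1) * this
    simp only [e]
    positivity
  filter_upwards [key, sin_pos_eventually] with r hr hs
  refine winding_of_re_pos (-(κ : ℂ) * Complex.I) (by simpa using hκ) (-2)
    (continuousOn_circleLoop r) (by simp only [circleField_two_pi]) fun t ht => ?_
  have e : Complex.exp ((((-2 : ℤ) * t : ℝ) : ℂ) * Complex.I)
      = ((Real.cos (2 * t) : ℝ) : ℂ) - (Real.sin (2 * t) : ℝ) * Complex.I := by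
    rw [Complex.exp_mul_I, ← Complex.ofReal_cos, ← Complex.ofReal_sin,
      show ((-2 : ℤ) * t : ℝ) = -(2 * t) by push_cast; ring, Real.cos_neg, Real.sin_neg]
    push_cast; ring
  rw [Complex.mem_slitPlane_iff, s1, s2, e]
  left
  have := mul_pos hs (hr t ht)
  simp only [map_mul, map_sub, map_neg, Complex.conj_ofReal, Complex.conj_I,
    Complex.mul_re, Complex.add_re, Complex.ofReal_re, Complex.ofReal_im, Complex.I_re,
    Complex.I_im, Complex.mul_im, Complex.add_im, Complex.sub_re, Complex.sub_im,
    Complex.neg_re, Complex.neg_im]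
  nlinarith

end

/-! ### Degenerate saddles of pitchfork type -/

section
variable {K ρ : ℝ} {p : E3}

/-- Along `eX` itself the Hessian vanishes and, by symmetry, so does the cubic term. Bending the
curve into `s eX + σ s² eT` couples both directions at order four, and `hl` says that the best
bending makes the quartic coefficient positive. -/
theorem Octupole.pitchfork_not_isLocalMaxOn (hp : p ∈ critPts (pot K ρ)) (h0 : p 0 = 0)
    (h11 : tanHess K ρ p eX eX = 0) (hP : 0 < pot K ρ p)
    (hl : 36 * pot K ρ p ^ 2 < mirrorForm K ρ (eT p) ^ 2) :
    ¬ IsLocalMaxOn (pot K ρ) unitSphere p := by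
  have ho := orthonormal_mirror hp.1 h0
  have hf := isTangentFrame_mirror hp.1 h0
  have h12 := tanHess_mirror_mixed (K := K) (ρ := ρ) h0
  have h22 := tanHess_mirror_right (K := K) (ρ := ρ) hp.1 h0
  rw [h11, sub_zero] at h22
  set m := pot K ρ (eT p) with hmdef
  set l := mirrorForm K ρ (eT p)
  set P := pot K ρ p with hPdef
  -- This maximizes the quartic coefficient `-3P/8 - 6Pσ² + σl/2`; the maximum is `(l² -
  -- 36P²)/(96P)`.
  set σ : ℝ := l / (24 * P) with hσ
  have hss (s : ℝ) : inner ℝ (s • eX + (σ * s ^ 2) • eT p) (s • eX + (σ * s ^ 2) • eT p)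
      = s ^ 2 * (1 + σ ^ 2 * s ^ 2) := by
    rw [inner_add_right, real_inner_smul_right, real_inner_smul_right,
      (inner_orthonormal_frame ho _ _).1, (inner_orthonormal_frame ho _ _).2]
    ring
  refine sqrt_curve hp (w := fun s => s • eX + (σ * s ^ 2) • eT p)
    (fun s => by
      rw [inner_add_right, real_inner_smul_right, real_inner_smul_right, hf.left, hf.right]; ring)
    (by fun_prop) (by simp) 4
    (F := fun s => - (P / 2) * (1 + σ ^ 2 * s ^ 2) ^ 2
        / (1 + Real.sqrt (1 - s ^ 2 * (1 + σ ^ 2 * s ^ 2))) ^ 2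
        * (Real.sqrt (1 - s ^ 2 * (1 + σ ^ 2 * s ^ 2)) + 2)
      - 6 * Real.sqrt (1 - s ^ 2 * (1 + σ ^ 2 * s ^ 2)) * P * σ ^ 2 + σ ^ 3 * s ^ 2 * m
      + σ * l / 2) ?_ ?_ ?_
  · have : (1 + Real.sqrt (1 - (0 : ℝ) ^ 2 * (1 + σ ^ 2 * 0 ^ 2))) ^ 2 ≠ 0 := by norm_num
    fun_prop (disch := exact this)
  · have e : - (P / 2) * (1 + σ ^ 2 * 0 ^ 2) ^ 2
        / (1 + Real.sqrt (1 - 0 ^ 2 * (1 + σ ^ 2 * 0 ^ 2))) ^ 2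
        * (Real.sqrt (1 - 0 ^ 2 * (1 + σ ^ 2 * 0 ^ 2)) + 2)
      - 6 * Real.sqrt (1 - 0 ^ 2 * (1 + σ ^ 2 * 0 ^ 2)) * P * σ ^ 2 + σ ^ 3 * 0 ^ 2 * m
      + σ * l / 2 = (l ^ 2 - 36 * P ^ 2) / (96 * P) := by
      simp only [ne_eq, OfNat.ofNat_ne_zero, not_false_eq_true, zero_pow, zero_mul, sub_zero,
        Real.sqrt_one, mul_zero, add_zero]
      rw [hσ]
      field_simp
      ring
    simp only [e]
    exact div_pos (by linarith) (by linarith)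
  · intro s a ha h1 ha0
    rw [hss] at ha h1
    rw [← ha, tanHess_combination_self, pot_mirror, h11, h12, h22]
    have h2 : (1 + a) ≠ 0 := by positivity
    have h3 : (1 - a) ^ 2 = s ^ 4 * ((1 + σ ^ 2 * s ^ 2) ^ 2 / (1 + a) ^ 2) := by
      field_simp
      linear_combination -(s ^ 2 * (1 + σ ^ 2 * s ^ 2) + 1 - a ^ 2) * h1
    rw [h3]
    ring

theorem Octupole.mirrorForm_eT_neg : mirrorForm K ρ (eT (-p)) = - mirrorForm K ρ (eT p) := by
  simp [mirrorForm, eT]; ring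

theorem Octupole.pitchfork_saddle_of_pos (hp : p ∈ critPts (pot K ρ)) (h0 : p 0 = 0)
    (h11 : tanHess K ρ p eX eX = 0) (hP : 0 < pot K ρ p)
    (hl : 36 * pot K ρ p ^ 2 < mirrorForm K ρ (eT p) ^ 2) : p ∈ saddles (pot K ρ) := by
  refine ⟨hp, pitchfork_not_isLocalMaxOn hp h0 h11 hP hl, ?_⟩
  refine not_isLocalMinOn_of_tanHess_neg hp (isTangentFrame_mirror hp.1 h0).right ?_
  rw [tanHess_mirror_right hp.1 h0, h11]
  linarith

theorem Octupole.pitchfork_saddle (hp : p ∈ critPts (pot K ρ)) (h0 : p 0 = 0)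
    (h11 : tanHess K ρ p eX eX = 0) (hP : pot K ρ p ≠ 0)
    (hl : 36 * pot K ρ p ^ 2 < mirrorForm K ρ (eT p) ^ 2) : p ∈ saddles (pot K ρ) := by
  rcases lt_or_gt_of_ne hP with h | h
  · rw [← neg_mem_saddles]
    refine pitchfork_saddle_of_pos (neg_mem_critPts.2 hp) (by simp [h0]) ?_ ?_ ?_
    · rw [tanHess_neg, h11, neg_zero]
    · rw [pot_neg]; linarith
    · rw [pot_neg, mirrorForm_eT_neg]; linarith
  · exact pitchfork_saddle_of_pos hp h0 h11 h hl

/-- By symmetry the field has the form `(cos t · A, B)`, to which `winding_neg_one` applies after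
multiplication by `-P`. The point is the sign of `A` on the zeros of `B`: there `A` is of second
order in `sin r`, and its leading coefficient times `P` is `(l² - 36P²)/24`. -/
theorem Octupole.hasIndex_neg_one_of_pitchfork (hp : p ∈ critPts (pot K ρ)) (h0 : p 0 = 0)
    (h11 : tanHess K ρ p eX eX = 0) (hP : pot K ρ p ≠ 0)
    (hl : 36 * pot K ρ p ^ 2 < mirrorForm K ρ (eT p) ^ 2) : HasIndex (pot K ρ) p (-1) := by
  have ho := orthonormal_mirror hp.1 h0
  have h12 := tanHess_mirror_mixed (K := K) (ρ := ρ) h0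
  have h22 := tanHess_mirror_right (K := K) (ρ := ρ) hp.1 h0
  rw [h11, sub_zero] at h22
  set m := pot K ρ (eT p) with hmdef
  set l := mirrorForm K ρ (eT p)
  set P := pot K ρ p with hPdef
  apply hasIndex_of_circleField hp ho
  set Φ : ℝ → ℝ → ℝ := fun r t => Real.cos r ^ 3 * P + Real.cos r * Real.sin r ^ 2 / 2 *
    (3 * P - 12 * P * Real.sin t ^ 2) + Real.sin r ^ 3 *
      (Real.sin t ^ 3 * m + Real.cos t ^ 2 * Real.sin t / 2 * l) with hΦ
  set A : ℝ → ℝ → ℝ := fun r t => 3 * Real.cos r * P + Real.sin r * Real.sin t * l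
    - 3 * Φ r t with hA
  set B : ℝ → ℝ → ℝ := fun r t => -9 * Real.cos r * P * Real.sin t
    + Real.sin r * (3 * Real.sin t ^ 2 * m + Real.cos t ^ 2 / 2 * l)
    - 3 * Real.sin t * Φ r t with hB
  -- `D` is defined by `B = sin r cos² t · l / 2 - D sin t`. On `B = 0` this expresses `sin t` as a
  -- multiple of `sin r`, and substitution into `A` leaves `sin² r · G`.
  set D : ℝ → ℝ → ℝ := fun r t => 9 * Real.cos r * P + 3 * Φ r t
    - 3 * Real.sin r * Real.sin t * m with hD
  set G : ℝ → ℝ → ℝ := fun r t => 3 * P * Real.cos r - 3 / 2 * Real.cos r *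
    (3 * P - 12 * P * Real.sin t ^ 2) - 3 * Real.sin r *
      (Real.sin t ^ 3 * m + Real.cos t ^ 2 * Real.sin t / 2 * l)
    + Real.cos t ^ 2 * l ^ 2 / (2 * D r t) with hG
  have hpot (r t : ℝ) : pot K ρ (geodesicCircle p eX (eT p) r t) = Φ r t := by
    rw [pot_geodesicCircle hp ho, pot_mirror, tanHess_combination_self, h11, h12, h22]
    simp only [hΦ]; ring
  have s1 (r t : ℝ) : circleField K ρ p eX (eT p) eX r t = Real.cos t * A r t := by
    rw [circleField_eq, hpot, gradPot_mirror_left, (inner_orthonormal_frame ho _ _).1,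
      tanHess_combination, tanHess_comm K ρ p (eT p) eX, h11, h12]
    simp only [hA]; ring
  have s2 (r t : ℝ) : circleField K ρ p eX (eT p) (eT p) r t = B r t := by
    rw [circleField_eq, hpot, gradPot_mirror_right, (inner_orthonormal_frame ho _ _).2,
      tanHess_combination, h12, h22]
    simp only [hB]; ring
  have cΦ : Continuous fun x : ℝ × ℝ => Φ x.1 x.2 := by simp only [hΦ]; fun_prop
  have cB : Continuous fun x : ℝ × ℝ => B x.1 x.2 := by simp only [hB]; fun_prop
  have cD : Continuous fun x : ℝ × ℝ => D x.1 x.2 := by simp only [hD]; fun_prop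
  have hB0 (t : ℝ) : B 0 t = -12 * P * Real.sin t := by simp [hB, hΦ]; ring
  have hD0 (t : ℝ) : D 0 t = 12 * P := by simp [hD, hΦ]; ring
  have hAG (r t : ℝ) (hd : D r t ≠ 0) (hb : B r t = 0) : A r t = Real.sin r ^ 2 * G r t := by
    have h1 : Real.sin t = Real.sin r * Real.cos t ^ 2 * l / (2 * D r t) := by
      rw [eq_div_iff (by simpa using hd)]
      simp only [hB] at hb
      simp only [hD]
      linear_combination (-2) * hb
    have h2 : Real.sin r * Real.sin t * l
        = Real.sin r ^ 2 * (Real.cos t ^ 2 * l ^ 2 / (2 * D r t)) := by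
      nth_rw 1 [h1]; ring
    have h3 := Real.sin_sq_add_cos_sq r
    simp only [hA, hG, h2, hΦ]
    linear_combination (-3 * P * Real.cos r) * h3
  have key : ∀ᶠ r in nhdsWithin (0 : ℝ) (Set.Ioi 0), ∀ t ∈ Set.Icc 0 (2 * Real.pi),
      D r t ≠ 0 ∧ (B r t ≠ 0 ∨ 0 < P * G r t) := by
    refine eventually_forall_circle (P := fun r t =>
      D r t ≠ 0 ∧ (B r t ≠ 0 ∨ 0 < P * G r t)) fun t _ => ?_
    have hd0 : D 0 t ≠ 0 := by rw [hD0]; simpa using hP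
    have hd := cD.continuousAt.eventually_ne (y := (0 : ℝ)) (x := ((0 : ℝ), t)) hd0
    by_cases hs : Real.sin t = 0
    · have hc2 : Real.cos t ^ 2 = 1 := by
        have := Real.sin_sq_add_cos_sq t; rw [hs] at this; linarith
      have hcont : ContinuousAt (fun x : ℝ × ℝ => P * G x.1 x.2) (0, t) := by
        have h2 : 2 * D ((0 : ℝ), t).1 ((0 : ℝ), t).2 ≠ 0 := mul_ne_zero two_ne_zero hd0
        have h3 := cD.continuousAt (x := ((0 : ℝ), t))
        simp only [hG]
        refine continuousAt_const.mul (ContinuousAt.add (by fun_prop) (ContinuousAt.div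
          (by fun_prop) (by fun_prop) h2))
      have h2 : 0 < P * G 0 t := by
        have e : P * G 0 t = (l ^ 2 - 36 * P ^ 2) / 24 := by
          simp only [hG, hD0, hs, hc2, Real.cos_zero, Real.sin_zero]
          field_simp
          ring
        rw [e]; linarith
      filter_upwards [hd, hcont.eventually (lt_mem_nhds h2)] with x hx1 hx2
      exact ⟨hx1, Or.inr hx2⟩
    · have h2 : B 0 t ≠ 0 := by
        rw [hB0]
        exact mul_ne_zero (mul_ne_zero (by norm_num) hP) hs
      filter_upwards [hd, cB.continuousAt.eventually_ne (y := (0 : ℝ)) (x := ((0 : ℝ), t)) h2]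
        with x hx1 hx2
      exact ⟨hx1, Or.inl hx2⟩
  have key2 : ∀ᶠ r in nhdsWithin (0 : ℝ) (Set.Ioi 0), ∀ t ∈ Set.Icc 0 (2 * Real.pi),
      Real.cos t = 0 → 0 < -P * B r t * Real.sin t := by
    have : ∀ᶠ r in nhdsWithin (0 : ℝ) (Set.Ioi 0), ∀ t ∈ Set.Icc 0 (2 * Real.pi),
        Real.cos t ≠ 0 ∨ 0 < -P * B r t * Real.sin t := by
      refine eventually_forall_circle (P := fun r t =>
        Real.cos t ≠ 0 ∨ 0 < -P * B r t * Real.sin t) fun t _ => ?_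
      by_cases hc : Real.cos t = 0
      · have hcont : Continuous fun x : ℝ × ℝ => -P * B x.1 x.2 * Real.sin x.2 := by fun_prop
        have h2 : 0 < -P * B 0 t * Real.sin t := by
          have hs : Real.sin t ^ 2 = 1 := by
            have := Real.sin_sq_add_cos_sq t; rw [hc] at this; linarith
          have e : -P * B 0 t * Real.sin t = 12 * P ^ 2 := by
            rw [hB0]; linear_combination 12 * P ^ 2 * hs
          rw [e]; positivity
        filter_upwards [hcont.continuousAt.eventually (lt_mem_nhds h2)] with x hx
        exact Or.inr hx
      · have hcont : Continuous fun x : ℝ × ℝ => Real.cos x.2 := by fun_prop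
        filter_upwards [hcont.continuousAt.eventually_ne (y := (0 : ℝ)) (x := ((0 : ℝ), t)) hc]
          with x hx
        exact Or.inl hx
    filter_upwards [this] with r hr t ht hc
    exact (hr t ht).resolve_left (not_not.2 hc)
  filter_upwards [key, key2, sin_pos_eventually] with r hr hr2 hs
  -- The factor `-P` normalizes signs for both signs of `P`; it is undone afterwards by a positive
  -- factor, with a change of sign of the loop if `P > 0`.
  have hw := winding_neg_one (a := fun t => -P * A r t) (b := fun t => -P * B r t)
    (by simp only [hA, hΦ]; fun_prop) (by simp only [hB, hΦ]; fun_prop)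
    (by simp [hA, hΦ]) (by simp [hB, hΦ]) (fun t ht hb => ?_) (fun t ht hc => hr2 t ht hc)
  · rcases lt_or_gt_of_ne hP with h | h
    · refine hw.pos_mul (c := (-P)⁻¹) (inv_pos.2 (by linarith)) fun t _ => ?_
      have hPc : (P : ℂ) ≠ 0 := by exact_mod_cast hP
      rw [s1, s2]
      push_cast
      field_simp
      ring
    · refine (hw.pos_mul (w' := fun t => -((circleField K ρ p eX (eT p) eX r t : ℂ)
        + (circleField K ρ p eX (eT p) (eT p) r t : ℂ) * Complex.I)) (c := P⁻¹)
        (inv_pos.2 h) fun t _ => ?_).neg fun t _ => by simp only [neg_neg]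
      have hPc : (P : ℂ) ≠ 0 := by exact_mod_cast hP
      rw [s1, s2]
      push_cast
      field_simp
      ring
  · have hb0 : B r t = 0 := (mul_eq_zero.1 hb).resolve_left (neg_ne_zero.2 hP)
    obtain ⟨hd, hg⟩ := hr t ht
    have := hg.resolve_left (not_not.2 hb0)
    rw [hAG r t hd hb0]
    have := mul_pos (pow_pos hs 2) this
    linarith

end

/-! ### Algebraic equations for the critical points -/

/-- The quadratic condition that relates `x²` to `y, z` at critical points with `x ≠ 0`. -/
def Octupole.formB (K ρ : ℝ) (x y z : ℝ) : ℝ :=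
  2 * (2 + ρ) * z ^ 2 - (1 + ρ) * x ^ 2 + (ρ - 1) * y ^ 2 + 4 * K * y * z

/-- The quadratic condition on `(y, z)` at critical points with `x ≠ 0`. -/
def Octupole.formC (K ρ : ℝ) (y z : ℝ) : ℝ :=
  K * (2 + ρ) * (z ^ 2 - y ^ 2) + y * z * (2 * K ^ 2 - ρ * (1 + ρ))

/-- The quadratic condition on `(y, z)` at critical points with `x = 0 ≠ y`. -/
def Octupole.formE (K ρ : ℝ) (y z : ℝ) : ℝ :=
  2 * (2 - ρ) * z ^ 2 - 2 * K * y * z + (ρ - 1) * y ^ 2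

section
variable {K ρ : ℝ} {p : E3}

theorem Octupole.mem_critPts_iff_exists :
    p ∈ critPts (pot K ρ) ↔ p ∈ unitSphere ∧ ∃ ν : ℝ, gradPot K ρ p = ν • p := by
  rw [mem_critPts]
  refine and_congr_right fun hp => ⟨fun h => ⟨_, h⟩, fun ⟨ν, h⟩ => ?_⟩
  have h2 := inner_gradPot_self K ρ p
  rw [h, real_inner_smul_right, inner_self_of_mem_unitSphere hp, mul_one] at h2
  rw [h, h2]

theorem Octupole.mem_critPts_iff_coord :
    p ∈ critPts (pot K ρ) ↔ p ∈ unitSphere ∧ ∃ ν : ℝ,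
      -3 * (ρ + 1) * p 0 * p 2 - 6 * K * p 0 * p 1 = ν * p 0 ∧
      3 * (ρ - 1) * p 1 * p 2 + 3 * K * (p 1 ^ 2 - p 0 ^ 2) = ν * p 1 ∧
      3 * p 2 ^ 2 - 3 / 2 * (ρ + 1) * p 0 ^ 2 + 3 / 2 * (ρ - 1) * p 1 ^ 2 = ν * p 2 := by
  rw [mem_critPts_iff_exists]
  refine and_congr_right fun hp => exists_congr fun ν => ⟨fun h => ?_, fun h => ?_⟩
  · refine ⟨?_, ?_, ?_⟩
    · simpa [gradPot] using congrArg (fun v : E3 => v 0) h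
    · simpa [gradPot] using congrArg (fun v : E3 => v 1) h
    · simpa [gradPot] using congrArg (fun v : E3 => v 2) h
  · refine ext3 ?_ ?_ ?_
    · simpa [gradPot] using h.1
    · simpa [gradPot] using h.2.1
    · simpa [gradPot] using h.2.2

/-- For `x = 0` the first equation is void, and the other two say that the derivative along the
mirror circle, a multiple of `y · formE`, vanishes. -/
theorem Octupole.mem_critPts_of_x_eq_zero (h0 : p 0 = 0) :
    p ∈ critPts (pot K ρ) ↔ p ∈ unitSphere ∧ (p 1 = 0 ∨ formE K ρ (p 1) (p 2) = 0) := by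
  rw [mem_critPts_iff_coord]
  refine and_congr_right fun hp => ?_
  have hS := (mem_unitSphere p).1 hp
  rw [h0] at hS ⊢
  rw [← mul_eq_zero, formE]
  constructor
  · rintro ⟨ν, -, h1, h2⟩
    linear_combination 2 / 3 * p 1 * h2 - 2 / 3 * p 2 * h1
  · intro h
    refine ⟨p 1 * (3 * (ρ - 1) * p 1 * p 2 + 3 * K * (p 1 ^ 2 - 0 ^ 2))
      + p 2 * (3 * p 2 ^ 2 - 3 / 2 * (ρ + 1) * 0 ^ 2 + 3 / 2 * (ρ - 1) * p 1 ^ 2),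
      by ring, ?_, ?_⟩
    · linear_combination (-3 / 2 * p 2) * h
        - (3 * (ρ - 1) * p 1 * p 2 + 3 * K * (p 1 ^ 2 - 0 ^ 2)) * hS
    · linear_combination (3 / 2 * p 1) * h
        - (3 * p 2 ^ 2 - 3 / 2 * (ρ + 1) * 0 ^ 2 + 3 / 2 * (ρ - 1) * p 1 ^ 2) * hS

/-- Dividing the first equation by `x` gives the multiplier as a linear form in `y, z`. The third
equation is then `formB`, and eliminating `x²` from the second by means of it gives `formC`. -/
theorem Octupole.mem_critPts_of_x_ne_zero (hρ : 0 ≤ ρ) (h0 : p 0 ≠ 0) :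
    p ∈ critPts (pot K ρ) ↔ p ∈ unitSphere ∧ formB K ρ (p 0) (p 1) (p 2) = 0 ∧
      formC K ρ (p 1) (p 2) = 0 := by
  rw [mem_critPts_iff_coord]
  refine and_congr_right fun hp => ?_
  have h1ρ : (1 + ρ) ≠ 0 := by positivity
  constructor
  · rintro ⟨ν, h1, h2, h3⟩
    have hν : ν = -3 * (ρ + 1) * p 2 - 6 * K * p 1 := mul_right_cancel₀ h0 (by linarith)
    subst hν
    have hB : formB K ρ (p 0) (p 1) (p 2) = 0 := by
      rw [formB]; linear_combination 2 / 3 * h3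
    refine ⟨hB, ?_⟩
    rw [formB] at hB
    rw [formC]
    linear_combination (K / 2) * hB - (1 + ρ) / 6 * h2
  · rintro ⟨hB, hC⟩
    rw [formB] at hB
    rw [formC] at hC
    refine ⟨-3 * (ρ + 1) * p 2 - 6 * K * p 1, by ring, ?_, ?_⟩
    · refine mul_left_cancel₀ h1ρ ?_
      linear_combination (3 * K) * hB - 6 * hC
    · linear_combination 3 / 2 * hB

theorem Octupole.isTangentFrame_of_x_ne_zero (h0 : p 0 ≠ 0) :
    IsTangentFrame p !₂[-p 1, p 0, 0] !₂[-p 2, 0, p 0] := by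
  refine ⟨by rw [inner_coord]; simp; ring, by rw [inner_coord]; simp; ring, fun w hw => ?_,
    fun α β h => ?_⟩
  · rw [inner_coord] at hw
    refine ⟨w 1 / p 0, w 2 / p 0, ext3 ?_ ?_ ?_⟩
    · simp; field_simp; linarith
    · simp; field_simp
    · simp; field_simp
  · have e1 := congrArg (fun v : E3 => v 1) h
    have e2 := congrArg (fun v : E3 => v 2) h
    simp [h0] at e1 e2
    exact ⟨e1, e2⟩

/-- Up to a positive factor, the determinant of the Hessian where `x ≠ 0`. -/
theorem Octupole.tanHess_det_of_x_ne_zero (h0 : p 0 ≠ 0)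
    (hp : p ∈ critPts (pot K ρ)) :
    tanHess K ρ p !₂[-p 1, p 0, 0] !₂[-p 1, p 0, 0] *
      tanHess K ρ p !₂[-p 2, 0, p 0] !₂[-p 2, 0, p 0] -
      tanHess K ρ p !₂[-p 1, p 0, 0] !₂[-p 2, 0, p 0] ^ 2
      = 9 * p 0 ^ 4 * ((8 * K * p 1 + 2 * ρ * p 2) * ((5 + 3 * ρ) * p 2 + 2 * K * p 1)
        - (2 * ρ * p 1 + 2 * K * p 2) ^ 2) := by
  have hμ : 3 * pot K ρ p = -3 * (ρ + 1) * p 2 - 6 * K * p 1 := by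
    have h := congrArg (fun v : E3 => v 0) ((mem_critPts K ρ p).1 hp).2
    simp [gradPot] at h
    exact mul_right_cancel₀ h0 (by linarith)
  have e1 : tanHess K ρ p !₂[-p 1, p 0, 0] !₂[-p 1, p 0, 0]
      = 3 * p 0 ^ 2 * (8 * K * p 1 + 2 * ρ * p 2) := by
    simp only [tanHess, inner_coord, hμ]
    simp [hessPot]; ring
  have e2 : tanHess K ρ p !₂[-p 1, p 0, 0] !₂[-p 2, 0, p 0]
      = 3 * p 0 ^ 2 * (2 * ρ * p 1 + 2 * K * p 2) := by
    simp only [tanHess, inner_coord, hμ]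
    simp [hessPot]; ring
  have e3 : tanHess K ρ p !₂[-p 2, 0, p 0] !₂[-p 2, 0, p 0]
      = 3 * p 0 ^ 2 * ((5 + 3 * ρ) * p 2 + 2 * K * p 1) := by
    simp only [tanHess, inner_coord, hμ]
    simp [hessPot]; ring
  rw [e1, e2, e3]; ring

/-- This decides the type of every critical point off the mirror plane when `K > 0`: the right side
is then nonnegative, so the determinant has the sign of `yz`. For `K = 0` both sides vanish and the
determinant is evaluated directly. -/
theorem Octupole.det_mul_yz (hρ : 0 ≤ ρ) (h0 : p 0 ≠ 0) (hp : p ∈ critPts (pot K ρ)) :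
    ((8 * K * p 1 + 2 * ρ * p 2) * ((5 + 3 * ρ) * p 2 + 2 * K * p 1)
        - (2 * ρ * p 1 + 2 * K * p 2) ^ 2) * (p 1 * p 2)
      = 2 * K * (2 + ρ) * (p 1 ^ 2 + p 2 ^ 2) := by
  obtain ⟨hS, hB, hC⟩ := (mem_critPts_of_x_ne_zero hρ h0).1 hp
  rw [mem_unitSphere] at hS
  rw [formB] at hB
  rw [formC] at hC
  have h1ρ : (1 + ρ) ≠ 0 := by positivity
  refine mul_left_cancel₀ h1ρ ?_
  linear_combination (4 * ρ * p 1 ^ 2 - 2 * (5 + 3 * ρ) * p 2 ^ 2) * hC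
    + 2 * K * (2 + ρ) * (p 1 ^ 2 + p 2 ^ 2) * (hB + (1 + ρ) * hS)

/-- The determinant of the Hessian where `x = 0 ≠ y`. -/
theorem Octupole.tanHess_mirror_crit (h0 : p 0 = 0) (h1 : p 1 ≠ 0) (hp : p ∈ critPts (pot K ρ)) :
    pot K ρ p = (ρ - 1) * p 2 + K * p 1 ∧
    tanHess K ρ p eX eX = -3 * (2 * ρ * p 2 + 3 * K * p 1) ∧
      tanHess K ρ p (eT p) (eT p) = 3 * (2 * (2 - ρ) * p 2 - K * p 1) := by
  have hμ : pot K ρ p = (ρ - 1) * p 2 + K * p 1 := by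
    have h := congrArg (fun v : E3 => v 1) ((mem_critPts K ρ p).1 hp).2
    simp [gradPot, h0] at h
    exact mul_right_cancel₀ h1 (by linarith)
  have e1 : tanHess K ρ p eX eX = -3 * (2 * ρ * p 2 + 3 * K * p 1) := by
    rw [tanHess_mirror_left, hμ, mirrorForm]; ring
  refine ⟨hμ, e1, ?_⟩
  rw [tanHess_mirror_right hp.1 h0, e1, hμ]; ring

/-! ### Lines and finite sets of points -/

/-- A pair of antipodal points on the circle `x = 0`. -/
def Octupole.lineZ (α β : ℝ) : Set E3 := {p | p ∈ unitSphere ∧ p 0 = 0 ∧ β * p 1 = α * p 2}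

/-- The critical points with `x ≠ 0` over the line spanned by `(η, ζ)`. -/
def Octupole.orbitW (K ρ η ζ : ℝ) : Set E3 :=
  {p | p ∈ unitSphere ∧ p 0 ≠ 0 ∧ ζ * p 1 = η * p 2 ∧ formB K ρ (p 0) (p 1) (p 2) = 0}

/-- Finiteness is carried along because additivity of `ncard` over disjoint unions needs it. -/
def Octupole.HasCard (s : Set E3) (n : ℕ) : Prop := s.Finite ∧ s.ncard = n

theorem Octupole.HasCard.union {s t : Set E3} {m n : ℕ} (hs : HasCard s m) (ht : HasCard t n)
    (h : Disjoint s t) : HasCard (s ∪ t) (m + n) :=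
  ⟨hs.1.union ht.1, by rw [Set.ncard_union_eq h hs.1 ht.1, hs.2, ht.2]⟩

theorem Octupole.hasCard_lineZ {α β : ℝ} (h : α ^ 2 + β ^ 2 ≠ 0) : HasCard (lineZ α β) 2 := by
  have hpos : 0 < α ^ 2 + β ^ 2 := lt_of_le_of_ne (by positivity) (Ne.symm h)
  set n := Real.sqrt (α ^ 2 + β ^ 2) with hn
  have hn2 : n ^ 2 = α ^ 2 + β ^ 2 := Real.sq_sqrt hpos.le
  have hn0 : 0 < n := Real.sqrt_pos.2 hpos
  set q : E3 := !₂[0, α / n, β / n] with hq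
  have hq0 : q 0 = 0 := by simp [hq]
  have hq1 : q 1 = α / n := by simp [hq]
  have hq2 : q 2 = β / n := by simp [hq]
  have e : lineZ α β = {q, -q} := by
    ext p
    simp only [lineZ, Set.mem_ofPred_eq, Set.mem_insert_iff, Set.mem_singleton_iff, mem_unitSphere]
    constructor
    · rintro ⟨hS, h0, h1⟩
      rw [h0] at hS
      set r := (α * p 1 + β * p 2) / n with hr
      have e1 : p 1 = r * (α / n) := by
        rw [hr]; field_simp; rw [hn2]; linear_combination β * h1
      have e2 : p 2 = r * (β / n) := by
        rw [hr]; field_simp; rw [hn2]; linear_combination (-α) * h1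
      have hr2 : r ^ 2 = 1 := by
        have : (r * (α / n)) ^ 2 + (r * (β / n)) ^ 2 = r ^ 2 := by
          field_simp; rw [hn2]
        rw [← this, ← e1, ← e2]; linarith
      rcases sq_eq_sq_iff_eq_or_eq_neg.1 (hr2.trans (one_pow 2).symm) with hr | hr
      · left; apply ext3 <;> simp [hq0, hq1, hq2, h0, e1, e2, hr]
      · right; apply ext3 <;> simp [hq0, hq1, hq2, h0, e1, e2, hr]
    · have hS : (α / n) ^ 2 + (β / n) ^ 2 = 1 := by field_simp; exact hn2.symm
      rintro (rfl | rfl)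
      · refine ⟨by rw [hq0, hq1, hq2]; linarith, hq0, by rw [hq1, hq2]; ring⟩
      · refine ⟨?_, by simp [hq0], ?_⟩
        · simp only [PiLp.neg_apply, hq0, hq1, hq2]; linarith
        · simp only [PiLp.neg_apply, hq1, hq2]; ring
  have hne : q ≠ -q := by
    intro hqq
    have e1 := congrArg (fun v : E3 => v 1) hqq
    have e2 := congrArg (fun v : E3 => v 2) hqq
    simp only [PiLp.neg_apply, hq1, hq2] at e1 e2
    have f1 : α / n = 0 := by linarith
    have f2 : β / n = 0 := by linarith
    rw [div_eq_zero_iff, or_iff_left hn0.ne'] at f1 f2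
    exact h (by rw [f1, f2]; ring)
  rw [e]
  exact ⟨by simp, Set.ncard_pair hne⟩

/-- With `(y, z) = r(η, ζ)` the condition `formB` reads `x² = r² q`, and the sphere fixes `r²`. For
`q > 0` the signs of `x` and `r` are free. -/
theorem Octupole.hasCard_orbitW {η ζ : ℝ} (hρ : 0 ≤ ρ) (hηζ : η ^ 2 + ζ ^ 2 ≠ 0)
    (hq : 0 < 2 * (2 + ρ) * ζ ^ 2 + (ρ - 1) * η ^ 2 + 4 * K * η * ζ) :
    HasCard (orbitW K ρ η ζ) 4 := by
  have h1ρ : 0 < 1 + ρ := by positivity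
  have hpos : 0 < η ^ 2 + ζ ^ 2 := lt_of_le_of_ne (by positivity) (Ne.symm hηζ)
  set q := (2 * (2 + ρ) * ζ ^ 2 + (ρ - 1) * η ^ 2 + 4 * K * η * ζ) / (1 + ρ) with hqdef
  have hq0 : 0 < q := div_pos hq h1ρ
  have hqe : (1 + ρ) * q = 2 * (2 + ρ) * ζ ^ 2 + (ρ - 1) * η ^ 2 + 4 * K * η * ζ := by
    rw [hqdef]; field_simp
  set n := Real.sqrt (q + (η ^ 2 + ζ ^ 2)) with hn
  have hn2 : n ^ 2 = q + (η ^ 2 + ζ ^ 2) := Real.sq_sqrt (by positivity)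
  have hn0 : 0 < n := Real.sqrt_pos.2 (by positivity)
  set x := Real.sqrt q with hx
  have hx2 : x ^ 2 = q := Real.sq_sqrt hq0.le
  have hx0 : 0 < x := Real.sqrt_pos.2 hq0
  set f : ℝ → ℝ → E3 := fun ε δ => !₂[ε * (x / n), δ * (η / n), δ * (ζ / n)] with hf
  have f0 (ε δ : ℝ) : f ε δ 0 = ε * (x / n) := by simp [hf]
  have f1 (ε δ : ℝ) : f ε δ 1 = δ * (η / n) := by simp [hf]
  have f2 (ε δ : ℝ) : f ε δ 2 = δ * (ζ / n) := by simp [hf]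
  have hinj (ε δ ε' δ' : ℝ) (h : f ε δ = f ε' δ') : ε = ε' ∧ δ = δ' := by
    have e0 := congrArg (fun v : E3 => v 0) h
    have e1 := congrArg (fun v : E3 => v 1) h
    have e2 := congrArg (fun v : E3 => v 2) h
    simp only [f0, f1, f2] at e0 e1 e2
    refine ⟨mul_right_cancel₀ (by positivity) e0, ?_⟩
    by_cases hη : η = 0
    · have hζ : ζ ≠ 0 := by rintro rfl; simp [hη] at hpos
      exact mul_right_cancel₀ (div_ne_zero hζ hn0.ne') e2
    · exact mul_right_cancel₀ (div_ne_zero hη hn0.ne') e1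
  have hmem (ε δ : ℝ) (hε : ε ^ 2 = 1) (hδ : δ ^ 2 = 1) : f ε δ ∈ orbitW K ρ η ζ := by
    refine ⟨?_, ?_, ?_, ?_⟩
    · rw [mem_unitSphere, f0, f1, f2]
      rw [mul_pow, mul_pow, mul_pow, hε, hδ]
      field_simp
      rw [hx2, hn2]; ring
    · rw [f0]
      have : ε ≠ 0 := by rintro rfl; norm_num at hε
      positivity
    · rw [f1, f2]; ring
    · rw [formB, f0, f1, f2, mul_pow, mul_pow, mul_pow, hε, hδ]
      have : δ * (η / n) * (δ * (ζ / n)) = η * ζ / n ^ 2 := by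
        field_simp; rw [hδ]; ring
      rw [mul_assoc (4 * K), this, div_pow, div_pow, div_pow, hx2]
      field_simp
      rw [hqe]; ring
  have e : orbitW K ρ η ζ = {f 1 1, f 1 (-1), f (-1) 1, f (-1) (-1)} := by
    ext p
    constructor
    · rintro ⟨hS, h0, h1, hB⟩
      rw [mem_unitSphere] at hS
      rw [formB] at hB
      set r := (η * p 1 + ζ * p 2) / (η ^ 2 + ζ ^ 2) with hr
      have e1 : p 1 = r * η := by
        rw [hr]; field_simp; linear_combination ζ * h1
      have e2 : p 2 = r * ζ := by
        rw [hr]; field_simp; linear_combination (-η) * h1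
      have hx' : p 0 ^ 2 = r ^ 2 * q := by
        refine mul_left_cancel₀ h1ρ.ne' ?_
        rw [show (1 + ρ) * (r ^ 2 * q) = r ^ 2 * ((1 + ρ) * q) by ring, hqe]
        rw [e1, e2] at hB
        linear_combination -hB
      have hrn : (r * n) ^ 2 = 1 := by
        rw [hx', e1, e2] at hS
        rw [mul_pow, hn2]; linarith
      have hpn : (p 0 * n / x) ^ 2 = 1 := by
        rw [div_pow, mul_pow, hx', hx2, ← hrn]; field_simp
      have key : p = f (p 0 * n / x) (r * n) := by
        apply ext3
        · rw [f0]; field_simp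
        · rw [f1, e1]; field_simp
        · rw [f2, e2]; field_simp
      rw [key]
      rcases sq_eq_sq_iff_eq_or_eq_neg.1 (hrn.trans (one_pow 2).symm) with h | h <;>
        rcases sq_eq_sq_iff_eq_or_eq_neg.1 (hpn.trans (one_pow 2).symm) with h' | h' <;> rw [h, h'] <;> simp
    · rintro (rfl | rfl | rfl | rfl) <;> apply hmem <;> norm_num
  have hne {ε δ ε' δ' : ℝ} (h : ¬ (ε = ε' ∧ δ = δ')) : f ε δ ≠ f ε' δ' :=
    fun h' => h (hinj _ _ _ _ h')
  rw [e]
  refine ⟨by simp, ?_⟩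
  rw [Set.ncard_insert_of_notMem, Set.ncard_insert_of_notMem, Set.ncard_pair]
  · exact hne (by norm_num)
  · rintro (h | h)
    · exact hne (by norm_num) h
    · exact hne (by norm_num) h
  · rintro (h | h | h)
    · exact hne (by norm_num) h
    · exact hne (by norm_num) h
    · exact hne (by norm_num) h

theorem Octupole.orbitW_eq_empty {η ζ : ℝ} (hρ : 0 ≤ ρ) (hηζ : η ^ 2 + ζ ^ 2 ≠ 0)
    (hq : 2 * (2 + ρ) * ζ ^ 2 + (ρ - 1) * η ^ 2 + 4 * K * η * ζ ≤ 0) :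
    orbitW K ρ η ζ = ∅ := by
  have h1ρ : 0 < 1 + ρ := by positivity
  rw [Set.eq_empty_iff_forall_notMem]
  rintro p ⟨hS, h0, h1, hB⟩
  rw [formB] at hB
  set r := (η * p 1 + ζ * p 2) / (η ^ 2 + ζ ^ 2) with hr
  have e1 : p 1 = r * η := by
    rw [hr]; field_simp; linear_combination ζ * h1
  have e2 : p 2 = r * ζ := by
    rw [hr]; field_simp; linear_combination (-η) * h1
  have h2 : (1 + ρ) * p 0 ^ 2
      = r ^ 2 * (2 * (2 + ρ) * ζ ^ 2 + (ρ - 1) * η ^ 2 + 4 * K * η * ζ) := by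
    rw [e1, e2] at hB; linear_combination -hB
  have h3 : 0 < (1 + ρ) * p 0 ^ 2 := by positivity
  nlinarith [mul_nonneg (sq_nonneg r) (neg_nonneg.2 hq)]

theorem Octupole.disjoint_lineZ {α β α' β' : ℝ} (h : α * β' - α' * β ≠ 0) :
    Disjoint (lineZ α β) (lineZ α' β') := by
  rw [Set.disjoint_left]
  rintro p ⟨hS, h0, h1⟩ ⟨-, -, h2⟩
  rw [mem_unitSphere, h0] at hS
  have e1 : p 1 = 0 := by
    refine (mul_eq_zero.1 (?_ : (α * β' - α' * β) * p 1 = 0)).resolve_left h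
    linear_combination α * h2 - α' * h1
  have e2 : p 2 = 0 := by
    refine (mul_eq_zero.1 (?_ : (α * β' - α' * β) * p 2 = 0)).resolve_left h
    linear_combination β * h2 - β' * h1
  rw [e1, e2] at hS
  norm_num at hS

theorem Octupole.disjoint_lineZ_orbitW {α β η ζ : ℝ} :
    Disjoint (lineZ α β) (orbitW K ρ η ζ) := by
  rw [Set.disjoint_left]
  rintro p ⟨-, h0, -⟩ ⟨-, h1, -⟩
  exact h1 h0

theorem Octupole.disjoint_orbitW {η ζ : ℝ} (hρ : 0 ≤ ρ) (hηζ : η ^ 2 + ζ ^ 2 ≠ 0) :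
    Disjoint (orbitW K ρ η ζ) (orbitW K ρ (-ζ) η) := by
  rw [Set.disjoint_left]
  rintro p ⟨-, h0, h1, hB⟩ ⟨-, -, h2, -⟩
  have e1 : p 1 = 0 := by
    refine (mul_eq_zero.1 (?_ : (η ^ 2 + ζ ^ 2) * p 1 = 0)).resolve_left hηζ
    linear_combination η * h2 + ζ * h1
  have e2 : p 2 = 0 := by
    refine (mul_eq_zero.1 (?_ : (η ^ 2 + ζ ^ 2) * p 2 = 0)).resolve_left hηζ
    linear_combination ζ * h2 - η * h1
  rw [formB, e1, e2] at hB
  have : (1 + ρ) * p 0 ^ 2 ≠ 0 := by positivity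
  exact this (by linarith)

end

section
variable {K ρ : ℝ} {p : E3}

/-- A nonzero traceless binary quadratic form vanishes on two perpendicular lines. One of them meets
the open first quadrant if `K > 0` and is the `z`-axis if `K = 0`. -/
theorem Octupole.exists_axis (hK : 0 ≤ K) (hρ : 0 ≤ ρ) (h : 0 < K ∨ 0 < ρ) :
    ∃ η ζ : ℝ, 0 ≤ η ∧ 0 < ζ ∧ (0 < K → 0 < η) ∧ (K = 0 → η = 0) ∧ formC K ρ η ζ = 0 ∧
      ∀ y z, formC K ρ y z = 0 ↔ ζ * y = η * z ∨ η * y = -ζ * z := by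
  rcases hK.eq_or_lt with rfl | hK0
  · have hρ0 : 0 < ρ := h.resolve_left (lt_irrefl _)
    refine ⟨0, 1, le_rfl, one_pos, fun h => (lt_irrefl _ h).elim, fun _ => rfl, by simp [formC],
      fun y z => ?_⟩
    have : ρ * (1 + ρ) ≠ 0 := by positivity
    have e : formC 0 ρ y z = -(ρ * (1 + ρ)) * (y * z) := by rw [formC]; ring
    rw [e, mul_eq_zero, neg_eq_zero, or_iff_right this, mul_eq_zero]
    simp [eq_comm]
  · set b := 2 * K ^ 2 - ρ * (1 + ρ) with hb
    set a := K * (2 + ρ) with ha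
    have ha0 : 0 < a := by positivity
    set s := Real.sqrt (b ^ 2 + 4 * a ^ 2) with hs
    have hs2 : s ^ 2 = b ^ 2 + 4 * a ^ 2 := Real.sq_sqrt (by positivity)
    have hsb : 0 < s - b := by
      have : |b| < s := by
        rw [hs]; apply Real.lt_sqrt_of_sq_lt; rw [sq_abs]; nlinarith
      linarith [le_abs_self b]
    -- `(s - b)/(2a)` is the positive root of `a τ² + b τ - a`, where `τ = z/y`.
    have hC : formC K ρ (2 * a) (s - b) = 0 := by
      rw [formC, ← ha, ← hb]; linear_combination a * hs2
    refine ⟨2 * a, s - b, by positivity, hsb, fun _ => by positivity,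
      fun h => (hK0.ne' h).elim, hC, fun y z => ?_⟩
    rw [formC, ← ha, ← hb] at hC
    have e : (2 * a) * (s - b) * formC K ρ y z
        = -a * (((s - b) * y - 2 * a * z) * (2 * a * y + (s - b) * z)) := by
      rw [formC, ← ha, ← hb]
      linear_combination (y * z) * hC
    have hne : (2 * a) * (s - b) ≠ 0 := by positivity
    constructor
    · intro h
      rw [h, mul_zero, eq_comm, mul_eq_zero, mul_eq_zero] at e
      rcases e with e | e | e
      · linarith
      · left; linarith
      · right; linarith
    · intro h
      refine (mul_eq_zero.1 (?_ : (2 * a) * (s - b) * formC K ρ y z = 0)).resolve_left hne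
      rw [e]
      rcases h with h | h
      · rw [h]; ring
      · rw [h]; ring

theorem Octupole.mem_lineZ_one {t : ℝ} (hp : p ∈ lineZ 1 t) : p 1 ≠ 0 := by
  intro h
  obtain ⟨hS, h0, h1⟩ := hp
  rw [mem_unitSphere] at hS
  have : p 2 = 0 := by rw [h] at h1; linarith
  rw [h, h0, this] at hS
  norm_num at hS

/-- The critical points on the circle `x = 0` off the poles. -/
def Octupole.circlePts (K ρ : ℝ) : Set E3 :=
  {p | p ∈ unitSphere ∧ p 0 = 0 ∧ p 1 ≠ 0 ∧ formE K ρ (p 1) (p 2) = 0}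

theorem Octupole.critPts_eq (hρ : 0 ≤ ρ) {η ζ : ℝ}
    (hC : ∀ y z, formC K ρ y z = 0 ↔ ζ * y = η * z ∨ η * y = -ζ * z) :
    critPts (pot K ρ) = lineZ 0 1 ∪ circlePts K ρ ∪ (orbitW K ρ η ζ ∪ orbitW K ρ (-ζ) η) := by
  ext p
  simp only [Set.mem_union, lineZ, circlePts, orbitW, Set.mem_ofPred_eq]
  by_cases h0 : p 0 = 0
  · rw [mem_critPts_of_x_eq_zero h0]
    simp only [h0, one_mul, zero_mul, true_and, ne_eq, not_true_eq_false, false_and, and_false,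
      or_false]
    tauto
  · rw [mem_critPts_of_x_ne_zero hρ h0, hC]
    simp only [h0, false_and, and_false, ne_eq, not_false_eq_true, true_and, false_or]
    tauto

/-- The hypotheses are Vieta's relations for `formE` as a quadratic in `z/y`; `ρ < 2` keeps its
degree equal to two. -/
theorem Octupole.circlePts_eq (hρ2 : ρ < 2) {t₁ t₂ : ℝ}
    (hs : 2 * (2 - ρ) * (t₁ + t₂) = 2 * K) (hp : 2 * (2 - ρ) * (t₁ * t₂) = ρ - 1) :
    circlePts K ρ = lineZ 1 t₁ ∪ lineZ 1 t₂ := by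
  have hE (y z : ℝ) : formE K ρ y z = 2 * (2 - ρ) * ((t₁ * y - z) * (t₂ * y - z)) := by
    rw [formE]; linear_combination (y * z) * hs - y ^ 2 * hp
  have h2 : 2 * (2 - ρ) ≠ 0 := by
    have : 0 < 2 - ρ := by linarith
    positivity
  ext p
  constructor
  · rintro ⟨hS, h0, -, h⟩
    rw [hE, mul_eq_zero, or_iff_right h2, mul_eq_zero] at h
    rcases h with h | h
    · exact Or.inl ⟨hS, h0, by linarith⟩
    · exact Or.inr ⟨hS, h0, by linarith⟩
  · rintro (h | h)
    · refine ⟨h.1, h.2.1, mem_lineZ_one h, ?_⟩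
      rw [hE, h.2.2]; ring
    · refine ⟨h.1, h.2.1, mem_lineZ_one h, ?_⟩
      rw [hE, h.2.2]; ring

theorem Octupole.circlePts_eq_empty (hρ2 : ρ < 2) (hd : K ^ 2 < 2 * (2 - ρ) * (ρ - 1)) :
    circlePts K ρ = ∅ := by
  rw [Set.eq_empty_iff_forall_notMem]
  rintro p ⟨-, -, h1, hE⟩
  rw [formE] at hE
  have : 0 < p 1 ^ 2 := by positivity
  nlinarith [sq_nonneg (2 * (2 - ρ) * p 2 - K * p 1), mul_pos this (sub_pos.2 hd)]

/-! ### Types of the critical points -/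

/-- For a critical point: exactly one of local maximum and local minimum. -/
def Octupole.IsExtremal (K ρ : ℝ) (p : E3) : Prop :=
  p ∉ saddles (pot K ρ) ∧ ¬ (p ∈ maxPts (pot K ρ) ∧ p ∈ minPts (pot K ρ))

def Octupole.IsRegularSaddle (K ρ : ℝ) (p : E3) : Prop :=
  p ∈ saddles (pot K ρ) ∧ ¬ IsDegenerateAt (pot K ρ) p ∧ HasIndex (pot K ρ) p (-1)

theorem Octupole.pole_crit (hp : p ∈ lineZ 0 1) : p ∈ critPts (pot K ρ) := by
  rw [mem_critPts_of_x_eq_zero hp.2.1]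
  refine ⟨hp.1, Or.inl ?_⟩
  have := hp.2.2
  linarith

theorem Octupole.pole_coord (hp : p ∈ lineZ 0 1) : p 0 = 0 ∧ p 1 = 0 ∧ p 2 ^ 2 = 1 := by
  obtain ⟨hS, h0, h1⟩ := hp
  rw [mem_unitSphere] at hS
  have h1' : p 1 = 0 := by linarith
  rw [h0, h1'] at hS
  exact ⟨h0, h1', by linarith⟩

theorem Octupole.pole_tanHess (hp : p ∈ lineZ 0 1) :
    pot K ρ p = p 2 ∧ tanHess K ρ p eX eX = -3 * (2 + ρ) * p 2 ∧
      tanHess K ρ p (eT p) (eT p) = 3 * (ρ - 2) * p 2 := by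
  obtain ⟨h0, h1, h2⟩ := pole_coord hp
  have hP : pot K ρ p = p 2 := by
    rw [pot, h0, h1]; linear_combination p 2 * h2
  have h11 : tanHess K ρ p eX eX = -3 * (2 + ρ) * p 2 := by
    rw [tanHess_mirror_left, hP, mirrorForm, h1]; ring
  refine ⟨hP, h11, ?_⟩
  rw [tanHess_mirror_right hp.1 h0, h11, hP]; ring

theorem Octupole.pole_extremal (hρ : 0 ≤ ρ) (hρ2 : ρ < 2) (hp : p ∈ lineZ 0 1) :
    IsExtremal K ρ p := by
  obtain ⟨h0, h1, h2⟩ := pole_coord hp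
  obtain ⟨-, h11, h22⟩ := pole_tanHess (K := K) (ρ := ρ) hp
  refine extremal_of_det_pos (pole_crit hp) (isTangentFrame_mirror hp.1 h0) ?_
  rw [h11, h22, tanHess_mirror_mixed h0]
  have : 0 < 9 * (2 + ρ) * (2 - ρ) := by
    have : 0 < 2 - ρ := by linarith
    positivity
  nlinarith

theorem Octupole.northPole_mem : northPole ∈ lineZ 0 1 := by
  refine ⟨?_, by simp [northPole], by simp [northPole]⟩
  rw [mem_unitSphere]; simp [northPole]

theorem Octupole.southPole_eq : southPole = -northPole := by
  apply ext3 <;> simp [southPole, northPole]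

theorem Octupole.southPole_mem : southPole ∈ lineZ 0 1 := by
  refine ⟨?_, by simp [southPole], by simp [southPole]⟩
  rw [mem_unitSphere]; simp [southPole]

theorem Octupole.mem_poles_iff : p ∈ lineZ 0 1 ↔ p = northPole ∨ p = southPole := by
  constructor
  · intro hp
    obtain ⟨h0, h1, h2⟩ := pole_coord hp
    rcases sq_eq_sq_iff_eq_or_eq_neg.1 (h2.trans (one_pow 2).symm) with h | h
    · left; apply ext3 <;> simp [northPole, h0, h1, h]
    · right; apply ext3 <;> simp [southPole, h0, h1, h]
  · rintro (rfl | rfl)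
    exacts [northPole_mem, southPole_mem]

/-- The Hessian is degenerate here, so a direct estimate replaces it: on the sphere the potential is
`(3z - z³)/2 - 6x²z`, and `1 - (3z - z³)/2 = (z-1)²(z+2)/2`. -/
theorem Octupole.northPole_isLocalMaxOn : IsLocalMaxOn (pot 0 2) unitSphere northPole := by
  have hc : ∀ᶠ q in nhds northPole, (0 : ℝ) < q 2 := by
    have : Continuous fun q : E3 => q 2 := by fun_prop
    exact this.continuousAt.eventually (lt_mem_nhds (by simp [northPole]))
  filter_upwards [nhdsWithin_le_nhds hc, self_mem_nhdsWithin] with q h1 h2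
  have hS := (mem_unitSphere q).1 h2
  have e : pot 0 2 northPole = 1 := by simp [pot, northPole]
  rw [e, pot]
  have hz : q 2 ≤ 1 := by nlinarith [sq_nonneg (q 0), sq_nonneg (q 1)]
  have h3 : 0 ≤ q 0 ^ 2 * q 2 := by positivity
  have h4 : q 1 ^ 2 * q 2 = (1 - q 0 ^ 2 - q 2 ^ 2) * q 2 := by
    linear_combination q 2 * hS
  nlinarith [mul_nonneg (sq_nonneg (q 2 - 1)) (by linarith : 0 ≤ q 2 + 2)]

theorem Octupole.northPole_mem_maxPts : northPole ∈ maxPts (pot 0 2) :=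
  ⟨pole_crit northPole_mem, northPole_isLocalMaxOn⟩

theorem Octupole.southPole_mem_minPts : southPole ∈ minPts (pot 0 2) := by
  refine ⟨pole_crit southPole_mem, ?_⟩
  rw [southPole_eq, isLocalMinOn_neg]
  exact northPole_isLocalMaxOn

theorem Octupole.pole_degenerate (hp : p ∈ lineZ 0 1) : IsDegenerateAt (pot 0 2) p := by
  obtain ⟨h0, h1, h2⟩ := pole_coord hp
  obtain ⟨-, -, h22⟩ := pole_tanHess (K := 0) (ρ := 2) hp
  refine isDegenerateAt_of_frame (isTangentFrame_mirror hp.1 h0).symm (by rw [h22]; ring) ?_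
  rw [tanHess_comm, tanHess_mirror_mixed h0]

theorem Octupole.pole_extremal_end (hp : p ∈ lineZ 0 1) : IsExtremal 0 2 p := by
  have hN : ¬ IsLocalMinOn (pot 0 2) unitSphere northPole := by
    refine not_isLocalMinOn_of_tanHess_neg (pole_crit northPole_mem)
      (isTangentFrame_mirror northPole_mem.1 (pole_coord northPole_mem).1).left ?_
    rw [(pole_tanHess northPole_mem).2.1]
    simp [northPole]
  rcases mem_poles_iff.1 hp with rfl | rfl
  · exact ⟨fun h => h.2.1 northPole_isLocalMaxOn, fun h => hN h.2.2⟩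
  · refine ⟨fun h => h.2.2 southPole_mem_minPts.2, fun h => hN ?_⟩
    rw [← isLocalMaxOn_neg, ← southPole_eq]
    exact h.1.2

theorem Octupole.orbitW_crit (hρ : 0 ≤ ρ) {η ζ : ℝ}
    (hC : ∀ y z, ζ * y = η * z → formC K ρ y z = 0) (hp : p ∈ orbitW K ρ η ζ) :
    p ∈ critPts (pot K ρ) :=
  (mem_critPts_of_x_ne_zero hρ hp.2.1).2 ⟨hp.1, hp.2.2.2, hC _ _ hp.2.2.1⟩

theorem Octupole.orbitW_yz_ne_zero (hρ : 0 ≤ ρ) {η ζ : ℝ} (hp : p ∈ orbitW K ρ η ζ) :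
    ¬ (p 1 = 0 ∧ p 2 = 0) := by
  rintro ⟨h1, h2⟩
  have h := hp.2.2.2
  have h0 := hp.2.1
  rw [formB, h1, h2] at h
  have : (1 + ρ) * p 0 ^ 2 ≠ 0 := by positivity
  exact this (by linarith)

/-- For `K > 0` the line lies in the quadrants `yz > 0`, and `det_mul_yz` makes the Hessian
definite. -/
theorem Octupole.orbitW_extremal (hK : 0 ≤ K) (hρ : 0 ≤ ρ) (h : 0 < K ∨ 0 < ρ) {η ζ : ℝ}
    (hη : 0 < K → 0 < η) (hη0 : K = 0 → η = 0) (hζ : 0 < ζ)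
    (hC : ∀ y z, ζ * y = η * z → formC K ρ y z = 0) (hp : p ∈ orbitW K ρ η ζ) :
    IsExtremal K ρ p := by
  have hc := orbitW_crit hρ hC hp
  have h0 := hp.2.1
  have hyz := orbitW_yz_ne_zero hρ hp
  refine extremal_of_det_pos hc (isTangentFrame_of_x_ne_zero h0) ?_
  rw [tanHess_det_of_x_ne_zero h0 hc]
  refine mul_pos (by positivity) ?_
  have hd := det_mul_yz hρ h0 hc
  have h1 := hp.2.2.1
  rcases hK.eq_or_lt with hK0 | hK0
  · have hρ0 : 0 < ρ := h.resolve_left (by rw [← hK0]; exact lt_irrefl _)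
    rw [hη0 hK0.symm, zero_mul] at h1
    have hy : p 1 = 0 := (mul_eq_zero.1 h1).resolve_left hζ.ne'
    have hz : p 2 ≠ 0 := fun hz => hyz ⟨hy, hz⟩
    rw [← hK0, hy]
    have : 0 < 2 * ρ * (5 + 3 * ρ) * p 2 ^ 2 := by positivity
    nlinarith
  · have hη' := hη hK0
    have hyzpos : 0 < p 1 * p 2 := by
      have hz : p 2 ≠ 0 := by
        intro hz
        rw [hz, mul_zero] at h1
        exact hyz ⟨(mul_eq_zero.1 h1).resolve_left hζ.ne', hz⟩
      have e : ζ * (p 1 * p 2) = η * p 2 ^ 2 := by linear_combination p 2 * h1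
      exact pos_of_mul_pos_right (e ▸ by positivity) hζ.le
    have hpos : 0 < 2 * K * (2 + ρ) * (p 1 ^ 2 + p 2 ^ 2) := by
      have : p 1 ≠ 0 := left_ne_zero_of_mul hyzpos.ne'
      positivity
    rw [← hd] at hpos
    exact pos_of_mul_pos_left hpos hyzpos.le

/-- On the perpendicular line `yz < 0` if `K > 0`, which reverses the sign of the determinant. -/
theorem Octupole.orbitW_saddle (hK : 0 ≤ K) (hρ : 0 ≤ ρ) (h : 0 < K ∨ 0 < ρ) {η ζ : ℝ}
    (hη : 0 < K → 0 < η) (hη0 : K = 0 → η = 0) (hζ : 0 < ζ)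
    (hC : ∀ y z, η * y = -ζ * z → formC K ρ y z = 0) (hp : p ∈ orbitW K ρ (-ζ) η) :
    IsRegularSaddle K ρ p := by
  have hc := orbitW_crit hρ hC hp
  have h0 := hp.2.1
  have hyz := orbitW_yz_ne_zero hρ hp
  refine saddle_of_det_neg hc (isTangentFrame_of_x_ne_zero h0) ?_
  rw [tanHess_det_of_x_ne_zero h0 hc]
  refine mul_neg_of_pos_of_neg (by positivity) ?_
  have hd := det_mul_yz hρ h0 hc
  have h1 := hp.2.2.1
  rcases hK.eq_or_lt with hK0 | hK0
  · have hρ0 : 0 < ρ := h.resolve_left (by rw [← hK0]; exact lt_irrefl _)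
    rw [hη0 hK0.symm, zero_mul, eq_comm] at h1
    have hz : p 2 = 0 := (mul_eq_zero.1 h1).resolve_left (neg_ne_zero.2 hζ.ne')
    have hy : p 1 ≠ 0 := fun hy => hyz ⟨hy, hz⟩
    rw [← hK0, hz]
    have : 0 < 4 * ρ ^ 2 * p 1 ^ 2 := by positivity
    nlinarith
  · have hη' := hη hK0
    have hyzneg : p 1 * p 2 < 0 := by
      have hz : p 2 ≠ 0 := by
        intro hz
        rw [hz, mul_zero] at h1
        exact hyz ⟨(mul_eq_zero.1 h1).resolve_left hη'.ne', hz⟩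
      have e : η * (p 1 * p 2) = -(ζ * p 2 ^ 2) := by linear_combination p 2 * h1
      have e2 : 0 < ζ * p 2 ^ 2 := by positivity
      exact neg_of_mul_neg_right (e ▸ by linarith) hη'.le
    have hpos : 0 < 2 * K * (2 + ρ) * (p 1 ^ 2 + p 2 ^ 2) := by
      have : p 1 ≠ 0 := left_ne_zero_of_mul hyzneg.ne
      positivity
    rw [← hd] at hpos
    exact neg_of_mul_pos_left hpos hyzneg.le

/-- The points of the lines `z = t y` on the circle `x = 0`. -/
theorem Octupole.lineZ_type {t : ℝ} (hp : p ∈ lineZ 1 t) (hc : p ∈ critPts (pot K ρ)) :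
    (0 < (2 * ρ * t + 3 * K) * (2 * (2 - ρ) * t - K) → IsRegularSaddle K ρ p) ∧
    ((2 * ρ * t + 3 * K) * (2 * (2 - ρ) * t - K) < 0 → IsExtremal K ρ p) := by
  have hy := mem_lineZ_one hp
  obtain ⟨-, h11, h22⟩ := tanHess_mirror_crit hp.2.1 hy hc
  have hz : p 2 = t * p 1 := by have := hp.2.2; linarith
  have e : tanHess K ρ p eX eX * tanHess K ρ p (eT p) (eT p) - tanHess K ρ p eX (eT p) ^ 2
      = -(9 * p 1 ^ 2) * ((2 * ρ * t + 3 * K) * (2 * (2 - ρ) * t - K)) := by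
    rw [h11, h22, tanHess_mirror_mixed hp.2.1, hz]; ring
  have hy2 : 0 < 9 * p 1 ^ 2 := by positivity
  refine ⟨fun h => saddle_of_det_neg hc (isTangentFrame_mirror hp.1 hp.2.1) ?_,
    fun h => extremal_of_det_pos hc (isTangentFrame_mirror hp.1 hp.2.1) ?_⟩
  · rw [e]; nlinarith [mul_pos hy2 h]
  · rw [e]; nlinarith [mul_neg_of_pos_of_neg hy2 h]

/-! ### Cardinalities -/

theorem Octupole.orbitW_pos_card (hK : 0 ≤ K) (hρ : 0 ≤ ρ) {η ζ : ℝ}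
    (hη : 0 < K → 0 < η) (hη0 : K = 0 → η = 0) (hζ : 0 < ζ) (hC : formC K ρ η ζ = 0) :
    HasCard (orbitW K ρ η ζ) 4 := by
  refine hasCard_orbitW hρ (by positivity) ?_
  rcases hK.eq_or_lt with hK0 | hK0
  · rw [hη0 hK0.symm]
    have : 0 < 2 * (2 + ρ) * ζ ^ 2 := by positivity
    linarith
  · have hη' := hη hK0
    refine pos_of_mul_pos_right (a := K) ?_ hK0.le
    -- After multiplication by `K`, the relation `formC = 0` eliminates `ζ²` and only nonnegative
    -- terms remain.
    have e : K * (2 * (2 + ρ) * ζ ^ 2 + (ρ - 1) * η ^ 2 + 4 * K * η * ζ)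
        = (1 + ρ) * η * (3 * K * η + 2 * ρ * ζ) := by
      rw [formC] at hC; linear_combination 2 * hC
    rw [e]; positivity

/-- The discriminant of the first branch of the bifurcation curve. -/
def Octupole.branchDisc (K ρ : ℝ) : ℝ := 3 * (6 - ρ) * K ^ 2 - 2 * ρ ^ 2 * (1 - ρ)

theorem Octupole.orbitW_neg_sign (hK : 0 < K) (hρ : 0 ≤ ρ) {η ζ : ℝ}
    (hη : 0 < η) (hζ : 0 < ζ) (hC : formC K ρ η ζ = 0) :
    ∃ c d : ℝ, 0 < c ∧ 0 < d ∧
      c * (2 * (2 + ρ) * η ^ 2 + (ρ - 1) * (-ζ) ^ 2 + 4 * K * (-ζ) * η) = d * branchDisc K ρ := by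
  rw [formC] at hC
  -- `w` is the quotient of `9K · formC` by the linear form `3Kζ - 2ρη`, with remainder `-η² ·
  -- branchDisc`. Since `formC = 0` and `w > 0`, that linear form has the sign of `branchDisc`.
  set w := 3 * K * (2 + ρ) * ζ + 6 * K ^ 2 * η + ρ * η * (1 - ρ) with hw
  have hw0 : 0 < w := by
    have h1 : ζ * (K * (2 + ρ) * ζ + 2 * K ^ 2 * η - ρ * (1 + ρ) * η) = K * (2 + ρ) * η ^ 2 := by
      linear_combination hC
    have h2 : 0 < K * (2 + ρ) * ζ + 2 * K ^ 2 * η - ρ * (1 + ρ) * η :=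
      pos_of_mul_pos_right (h1 ▸ by positivity) hζ.le
    have h3 : 0 ≤ ρ * (4 + 2 * ρ) * η := by positivity
    rw [hw]; nlinarith
  refine ⟨K * w, (1 + ρ) * ζ * η ^ 2, by positivity, by positivity, ?_⟩
  have e1 : K * (2 * (2 + ρ) * η ^ 2 + (ρ - 1) * (-ζ) ^ 2 + 4 * K * (-ζ) * η)
      = (1 + ρ) * ζ * (3 * K * ζ - 2 * ρ * η) := by linear_combination (-2) * hC
  have e2 : (3 * K * ζ - 2 * ρ * η) * w = η ^ 2 * branchDisc K ρ := by
    rw [hw, branchDisc]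
    linear_combination 9 * K * hC
  calc _ = w * (K * (2 * (2 + ρ) * η ^ 2 + (ρ - 1) * (-ζ) ^ 2 + 4 * K * (-ζ) * η)) := by ring
    _ = (1 + ρ) * ζ * ((3 * K * ζ - 2 * ρ * η) * w) := by rw [e1]; ring
    _ = _ := by rw [e2]; ring

theorem Octupole.orbitW_neg_card (hK : 0 ≤ K) (hρ : 0 ≤ ρ) {η ζ : ℝ}
    (hη : 0 < K → 0 < η) (hη0 : K = 0 → η = 0) (hζ : 0 < ζ) (hC : formC K ρ η ζ = 0)
    (h : 0 < K ∧ 0 < branchDisc K ρ ∨ 1 < ρ) (hρ2 : ρ ≤ 2) : HasCard (orbitW K ρ (-ζ) η) 4 := by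
  refine hasCard_orbitW hρ (by rw [neg_sq]; positivity) ?_
  rcases hK.eq_or_lt with hK0 | hK0
  · have h1 : 1 < ρ := h.resolve_left fun h => by rw [← hK0] at h; exact lt_irrefl _ h.1
    rw [hη0 hK0.symm]
    have : 0 < (ρ - 1) * ζ ^ 2 := mul_pos (by linarith) (by positivity)
    linarith
  · have hM : 0 < branchDisc K ρ := by
      rcases h with h | h
      · exact h.2
      · rw [branchDisc]
        have : 0 ≤ ρ ^ 2 * (ρ - 1) := mul_nonneg (by positivity) (by linarith)
        have : 0 < (6 - ρ) * K ^ 2 := mul_pos (by linarith) (by positivity)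
        linarith
    obtain ⟨c, d, hc, hd, e⟩ := orbitW_neg_sign hK0 hρ (hη hK0) hζ hC
    exact pos_of_mul_pos_right (e ▸ mul_pos hd hM) hc.le

theorem Octupole.orbitW_neg_empty (hK : 0 ≤ K) (hρ : 0 ≤ ρ) {η ζ : ℝ}
    (hη : 0 < K → 0 < η) (hη0 : K = 0 → η = 0) (hζ : 0 < ζ) (hC : formC K ρ η ζ = 0)
    (hρ1 : ρ ≤ 1) (h : branchDisc K ρ ≤ 0) : orbitW K ρ (-ζ) η = ∅ := by
  refine orbitW_eq_empty hρ (by rw [neg_sq]; positivity) ?_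
  rcases hK.eq_or_lt with hK0 | hK0
  · rw [hη0 hK0.symm]
    have : (ρ - 1) * ζ ^ 2 ≤ 0 := mul_nonpos_of_nonpos_of_nonneg (by linarith) (by positivity)
    linarith
  · obtain ⟨c, d, hc, hd, e⟩ := orbitW_neg_sign hK0 hρ (hη hK0) hζ hC
    have : c * (2 * (2 + ρ) * η ^ 2 + (ρ - 1) * (-ζ) ^ 2 + 4 * K * (-ζ) * η) ≤ 0 := by
      rw [e]; exact mul_nonpos_of_nonneg_of_nonpos hd.le h
    by_contra hcon
    push Not at hcon
    linarith [mul_pos hc hcon]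

theorem Octupole.neg_mem_maxPts : -p ∈ maxPts (pot K ρ) ↔ p ∈ minPts (pot K ρ) := by
  simp only [maxPts, minPts, Set.mem_ofPred_eq, neg_mem_critPts, isLocalMaxOn_neg]

/-- The numbers of critical points, maxima, minima and saddles. -/
theorem Octupole.counts {E S : Set E3} {n s : ℕ} (hcrit : critPts (pot K ρ) = E ∪ S)
    (hE : ∀ p ∈ E, IsExtremal K ρ p) (hS : ∀ p ∈ S, p ∈ saddles (pot K ρ))
    (hEc : HasCard E (2 * n)) (hSc : HasCard S s) :
    (critPts (pot K ρ)).ncard = 2 * n + s ∧ (maxPts (pot K ρ)).ncard = n ∧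
      (minPts (pot K ρ)).ncard = n ∧ saddles (pot K ρ) = S := by
  have hdis : Disjoint E S := by
    rw [Set.disjoint_left]; intro p h1 h2; exact (hE p h1).1 (hS p h2)
  have hsad : saddles (pot K ρ) = S := by
    apply Set.Subset.antisymm
    · intro p hp
      have hc : p ∈ critPts (pot K ρ) := hp.1
      rw [hcrit] at hc
      exact hc.resolve_left fun h => (hE p h).1 hp
    · exact hS
  have hun : maxPts (pot K ρ) ∪ minPts (pot K ρ) = E := by
    apply Set.Subset.antisymm
    · rintro p (hp | hp)
      · have hc : p ∈ critPts (pot K ρ) := hp.1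
        rw [hcrit] at hc
        exact hc.resolve_right fun h => (hS p h).2.1 hp.2
      · have hc : p ∈ critPts (pot K ρ) := hp.1
        rw [hcrit] at hc
        exact hc.resolve_right fun h => (hS p h).2.2 hp.2
    · intro p hp
      have hc : p ∈ critPts (pot K ρ) := by rw [hcrit]; exact Or.inl hp
      by_contra h
      rw [Set.mem_union, not_or] at h
      exact (hE p hp).1 ⟨hc, fun h' => h.1 ⟨hc, h'⟩, fun h' => h.2 ⟨hc, h'⟩⟩
  have hmm : Disjoint (maxPts (pot K ρ)) (minPts (pot K ρ)) := by
    rw [Set.disjoint_left]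
    intro p h1 h2
    exact (hE p (hun ▸ Or.inl h1)).2 ⟨h1, h2⟩
  have heq : (maxPts (pot K ρ)).ncard = (minPts (pot K ρ)).ncard := by
    -- The antipodal bijection splits the `2 * n` extrema evenly.
    have : maxPts (pot K ρ) = (fun p => -p) '' minPts (pot K ρ) := by
      ext p
      constructor
      · intro h
        exact ⟨-p, neg_mem_maxPts.1 (by rwa [neg_neg]), neg_neg p⟩
      · rintro ⟨q, hq, rfl⟩
        exact neg_mem_maxPts.2 hq
    rw [this, Set.ncard_image_of_injective _ neg_injective]
  have hfin : (maxPts (pot K ρ)).Finite ∧ (minPts (pot K ρ)).Finite := by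
    rw [← Set.finite_union, hun]; exact hEc.1
  have hcard := Set.ncard_union_eq hmm hfin.1 hfin.2
  rw [hun, hEc.2] at hcard
  refine ⟨?_, by omega, by omega, hsad⟩
  rw [hcrit]
  exact (hEc.union hSc hdis).2

end

/-! ### The bifurcation curve and the roots on the mirror circle -/

section
variable {K ρ : ℝ} {p : E3}

theorem Octupole.continuousOn_bifurcationCurve :
    ContinuousOn bifurcationCurve (Set.Icc 0 2) := by
  have e : ∀ ρ ∈ Set.Icc (0 : ℝ) 2, bifurcationCurve ρ
      = if ρ ≤ 1 then Real.sqrt (2 * ρ ^ 2 * (1 - ρ) / (3 * (6 - min ρ 2)))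
        -- Replacing `ρ` by `min ρ 2` in the denominator keeps it positive on the whole line, so the
        -- two pieces can be glued as globally continuous functions.
        else Real.sqrt (2 * (2 - ρ) * (ρ - 1)) := by
    intro ρ hρ
    rw [bifurcationCurve, min_eq_left hρ.2]
  refine ContinuousOn.congr (Continuous.continuousOn ?_) e
  refine Continuous.if_le ?_ ?_ continuous_id continuous_const ?_
  · refine Real.continuous_sqrt.comp (Continuous.div (by fun_prop) (by fun_prop) fun x => ?_)
    have := min_le_right x 2
    linarith
  · fun_prop
  · rintro x rfl
    norm_num

theorem Octupole.bifurcationCurve_nonneg (ρ : ℝ) : 0 ≤ bifurcationCurve ρ := by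
  rw [bifurcationCurve]; split_ifs <;> exact Real.sqrt_nonneg _

theorem Octupole.branchDisc_eq (hρ1 : ρ ≤ 1) :
    branchDisc K ρ = 3 * (6 - ρ) * (K ^ 2 - bifurcationCurve ρ ^ 2) := by
  have h6 : 0 < 6 - ρ := by linarith
  rw [bifurcationCurve, if_pos hρ1, Real.sq_sqrt, branchDisc]
  · field_simp
  · have : 0 ≤ 1 - ρ := by linarith
    positivity

theorem Octupole.sq_bifurcationCurve (hρ1 : 1 ≤ ρ) (hρ2 : ρ ≤ 2) :
    bifurcationCurve ρ ^ 2 = 2 * (2 - ρ) * (ρ - 1) := by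
  rcases hρ1.eq_or_lt with rfl | h
  · simp [bifurcationCurve]
  · rw [bifurcationCurve, if_neg (by linarith), Real.sq_sqrt]
    have : 0 ≤ 2 - ρ := by linarith
    have : 0 ≤ ρ - 1 := by linarith
    positivity

theorem Octupole.circlePts_roots (hρ2 : ρ < 2) {d : ℝ}
    (hd : d ^ 2 = K ^ 2 - 2 * (2 - ρ) * (ρ - 1)) :
    circlePts K ρ = lineZ 1 ((K + d) / (2 * (2 - ρ))) ∪ lineZ 1 ((K - d) / (2 * (2 - ρ))) := by
  have h2 : 2 - ρ ≠ 0 := by linarith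
  refine circlePts_eq hρ2 ?_ ?_
  · field_simp; ring
  · field_simp; linear_combination -hd

theorem Octupole.mem_critPts_of_mem_circlePts (h : p ∈ circlePts K ρ) :
    p ∈ critPts (pot K ρ) :=
  (mem_critPts_of_x_eq_zero h.2.1).2 ⟨h.1, Or.inr h.2.2.2⟩

theorem Octupole.upper_root_saddle (hK : 0 ≤ K) (hρ : 0 ≤ ρ) (hρ2 : ρ < 2) (h : 0 < K ∨ 0 < ρ)
    {d : ℝ} (hd0 : 0 < d) (hd : d ^ 2 = K ^ 2 - 2 * (2 - ρ) * (ρ - 1))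
    (hp : p ∈ lineZ 1 ((K + d) / (2 * (2 - ρ)))) : IsRegularSaddle K ρ p := by
  have hc : p ∈ critPts (pot K ρ) :=
    mem_critPts_of_mem_circlePts (by rw [circlePts_roots hρ2 hd]; exact Or.inl hp)
  have h2 : 0 < 2 - ρ := by linarith
  refine (lineZ_type hp hc).1 (mul_pos ?_ ?_)
  · rcases h with h | h <;> positivity
  · have : 2 * (2 - ρ) * ((K + d) / (2 * (2 - ρ))) - K = d := by field_simp; ring
    rw [this]; exact hd0

/-- At the smaller root the factor is `(K(6-2ρ) - ρd)/(2-ρ)`; multiplying by its conjugate in `d`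
gives `branchDisc`. So this root changes type exactly where the orbit over the perpendicular line
appears. -/
theorem Octupole.lower_root_sign (hρ2 : ρ < 2) {d : ℝ}
    (hd : d ^ 2 = K ^ 2 - 2 * (2 - ρ) * (ρ - 1)) :
    (K * (6 - 2 * ρ) + ρ * d) * (2 * ρ * ((K - d) / (2 * (2 - ρ))) + 3 * K) = branchDisc K ρ ∧
      2 * (2 - ρ) * ((K - d) / (2 * (2 - ρ))) - K = -d := by
  have h2 : 2 - ρ ≠ 0 := by linarith
  constructor
  · rw [branchDisc]; field_simp
    linear_combination (-ρ ^ 2) * hd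
  · field_simp; ring

theorem Octupole.lower_root_pos (hK : 0 ≤ K) (hρ : 0 ≤ ρ) (hρ2 : ρ < 2) (h : 0 < K ∨ 0 < ρ)
    {d : ℝ} (hd0 : 0 < d) : 0 < K * (6 - 2 * ρ) + ρ * d := by
  have h2 : 0 < 6 - 2 * ρ := by linarith
  rcases h with h | h <;> positivity

theorem Octupole.lower_root_extremal (hK : 0 < K) (hρ : 0 ≤ ρ) (hρ2 : ρ < 2)
    {d : ℝ} (hd0 : 0 < d) (hd : d ^ 2 = K ^ 2 - 2 * (2 - ρ) * (ρ - 1)) (hM : 0 < branchDisc K ρ)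
    (hp : p ∈ lineZ 1 ((K - d) / (2 * (2 - ρ)))) : IsExtremal K ρ p := by
  have hc : p ∈ critPts (pot K ρ) :=
    mem_critPts_of_mem_circlePts (by rw [circlePts_roots hρ2 hd]; exact Or.inr hp)
  obtain ⟨e1, e2⟩ := lower_root_sign hρ2 hd
  refine (lineZ_type hp hc).2 (mul_neg_of_pos_of_neg ?_ ?_)
  · exact pos_of_mul_pos_right (e1 ▸ hM) (lower_root_pos hK.le hρ hρ2 (Or.inl hK) hd0).le
  · rw [e2]; linarith

theorem Octupole.lower_root_saddle (hK : 0 ≤ K) (hρ : 0 < ρ) (hρ2 : ρ < 2)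
    {d : ℝ} (hd0 : 0 < d) (hd : d ^ 2 = K ^ 2 - 2 * (2 - ρ) * (ρ - 1)) (hM : branchDisc K ρ < 0)
    (hp : p ∈ lineZ 1 ((K - d) / (2 * (2 - ρ)))) : IsRegularSaddle K ρ p := by
  have hc : p ∈ critPts (pot K ρ) :=
    mem_critPts_of_mem_circlePts (by rw [circlePts_roots hρ2 hd]; exact Or.inr hp)
  obtain ⟨e1, e2⟩ := lower_root_sign hρ2 hd
  refine (lineZ_type hp hc).1 (mul_pos_of_neg_of_neg ?_ ?_)
  · exact neg_of_mul_neg_right (e1 ▸ hM) (lower_root_pos hK hρ.le hρ2 (Or.inr hρ) hd0).le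
  · rw [e2]; linarith

/-- On the first branch of the bifurcation curve the lower root is a degenerate saddle. -/
theorem Octupole.lower_root_pitchfork (hK : 0 < K) (hρ : 0 < ρ) (hρ1 : ρ < 1)
    {d : ℝ} (hd0 : 0 < d) (hd : d ^ 2 = K ^ 2 - 2 * (2 - ρ) * (ρ - 1)) (hM : branchDisc K ρ = 0)
    (hp : p ∈ lineZ 1 ((K - d) / (2 * (2 - ρ)))) :
    p ∈ saddles (pot K ρ) ∧ IsDegenerateAt (pot K ρ) p ∧ HasIndex (pot K ρ) p (-1) := by
  have hρ2 : ρ < 2 := by linarith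
  have hc : p ∈ critPts (pot K ρ) :=
    mem_critPts_of_mem_circlePts (by rw [circlePts_roots hρ2 hd]; exact Or.inr hp)
  obtain ⟨e1, e2⟩ := lower_root_sign hρ2 hd
  set t := (K - d) / (2 * (2 - ρ)) with ht
  have hy := mem_lineZ_one hp
  have hz : p 2 = t * p 1 := by have := hp.2.2; linarith
  have h0 := hp.2.1
  obtain ⟨hP, h11, h22⟩ := tanHess_mirror_crit h0 hy hc
  have ht0 : 2 * ρ * t + 3 * K = 0 := by
    rw [hM] at e1
    exact (mul_eq_zero.1 e1).resolve_left (lower_root_pos hK.le hρ.le hρ2 (Or.inl hK) hd0).ne'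
  have h11' : tanHess K ρ p eX eX = 0 := by
    rw [h11, hz]; linear_combination (-3 * p 1) * ht0
  have hP' : 2 * ρ * pot K ρ p = K * (3 - ρ) * p 1 := by
    rw [hP, hz]; linear_combination ((ρ - 1) * p 1) * ht0
  have hl : ρ * mirrorForm K ρ (eT p) = -3 * p 1 * (ρ * (ρ + 1) + 3 * K ^ 2) := by
    have : mirrorForm K ρ (eT p) = -3 * (ρ + 1) * p 1 + 6 * K * p 2 := by
      simp [mirrorForm, eT]
    rw [this, hz]; linear_combination (3 * K * p 1) * ht0
  have hPne : pot K ρ p ≠ 0 := by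
    intro h
    rw [h, mul_zero] at hP'
    have : K * (3 - ρ) * p 1 ≠ 0 :=
      mul_ne_zero (mul_ne_zero hK.ne' (by linarith)) hy
    exact this hP'.symm
  -- This is the pitchfork inequality with the common factor `9y²` removed. Both sides are compared
  -- with `ρ²`: on the curve the left one is at most `18ρ²(1-ρ)/(3(6-ρ)) < ρ²`.
  have hKlt : K ^ 2 * (3 - ρ) ^ 2 < (ρ * (ρ + 1) + 3 * K ^ 2) ^ 2 := by
    rw [branchDisc] at hM
    have hx : 3 * (6 - ρ) * (K ^ 2 * (3 - ρ) ^ 2) = 2 * ρ ^ 2 * (1 - ρ) * (3 - ρ) ^ 2 := by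
      linear_combination (3 - ρ) ^ 2 * hM
    have h1 : (3 - ρ) ^ 2 ≤ 9 := by nlinarith
    have h2 : 2 * ρ ^ 2 * (1 - ρ) * (3 - ρ) ^ 2 ≤ 2 * ρ ^ 2 * (1 - ρ) * 9 :=
      mul_le_mul_of_nonneg_left h1 (mul_nonneg (by positivity) (by linarith))
    have hρsq : 0 < ρ ^ 2 := by positivity
    have h3 : 2 * ρ ^ 2 * (1 - ρ) * 9 < 3 * (6 - ρ) * ρ ^ 2 := by nlinarith
    have h4 : K ^ 2 * (3 - ρ) ^ 2 < ρ ^ 2 := by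
      have h6 : 0 < 3 * (6 - ρ) := by linarith
      exact lt_of_mul_lt_mul_left (by linarith) h6.le
    have h5 : ρ ^ 2 ≤ (ρ * (ρ + 1) + 3 * K ^ 2) ^ 2 :=
      pow_le_pow_left₀ hρ.le (by nlinarith [sq_nonneg K]) 2
    linarith
  have hl2 : 36 * pot K ρ p ^ 2 < mirrorForm K ρ (eT p) ^ 2 := by
    refine lt_of_mul_lt_mul_left (a := ρ ^ 2) ?_ (by positivity)
    have e3 : ρ ^ 2 * (36 * pot K ρ p ^ 2) = 9 * p 1 ^ 2 * (K ^ 2 * (3 - ρ) ^ 2) := by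
      have : ρ ^ 2 * (36 * pot K ρ p ^ 2) = 9 * (2 * ρ * pot K ρ p) ^ 2 := by ring
      rw [this, hP']; ring
    have e4 : ρ ^ 2 * mirrorForm K ρ (eT p) ^ 2
        = 9 * p 1 ^ 2 * (ρ * (ρ + 1) + 3 * K ^ 2) ^ 2 := by
      rw [← mul_pow, hl]; ring
    rw [e3, e4]
    exact mul_lt_mul_of_pos_left hKlt (by positivity)
  exact ⟨pitchfork_saddle hc h0 h11' hPne hl2,
    isDegenerateAt_of_frame (isTangentFrame_mirror hp.1 h0) h11' (tanHess_mirror_mixed h0),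
    hasIndex_neg_one_of_pitchfork hc h0 h11' hPne hl2⟩

/-- On the second branch of the bifurcation curve the double root is a saddle-node. -/
theorem Octupole.double_root_fold (hK : 0 < K) (hρ1 : 1 < ρ) (hρ2 : ρ < 2)
    (hd : K ^ 2 = 2 * (2 - ρ) * (ρ - 1)) (hp : p ∈ lineZ 1 (K / (2 * (2 - ρ)))) :
    p ∈ saddles (pot K ρ) ∧ IsDegenerateAt (pot K ρ) p ∧ HasIndex (pot K ρ) p 0 := by
  have hc : p ∈ critPts (pot K ρ) := mem_critPts_of_mem_circlePts (by
    rw [circlePts_roots (d := 0) hρ2 (by rw [hd]; ring), add_zero]; exact Or.inl hp)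
  have h2 : 0 < 2 - ρ := by linarith
  set t := K / (2 * (2 - ρ)) with ht
  have ht0 : 0 < t := by positivity
  have hKt : K = 2 * (2 - ρ) * t := by rw [ht]; field_simp
  have ht2 : 2 * (2 - ρ) * t ^ 2 = ρ - 1 := by
    refine mul_left_cancel₀ (mul_ne_zero two_ne_zero h2.ne') ?_
    rw [← hd, hKt]; ring
  have hy := mem_lineZ_one hp
  have hz : p 2 = t * p 1 := by have := hp.2.2; linarith
  have h0 := hp.2.1
  obtain ⟨-, h11, h22⟩ := tanHess_mirror_crit h0 hy hc
  have h11' : tanHess K ρ p eX eX ≠ 0 := by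
    rw [h11, hz, show -3 * (2 * ρ * (t * p 1) + 3 * K * p 1)
      = -3 * (2 * ρ * t + 3 * K) * p 1 by ring]
    have : 0 < 2 * ρ * t + 3 * K := by positivity
    exact mul_ne_zero (mul_ne_zero (by norm_num) this.ne') hy
  have h22' : tanHess K ρ p (eT p) (eT p) = 0 := by
    rw [h22, hz]; linear_combination (-3 * p 1) * hKt
  have hm : pot K ρ (eT p) ≠ 0 := by
    have e : pot K ρ (eT p) = p 1 ^ 3 * (1 + (ρ - 1) * t ^ 2 / 2) := by
      have : pot K ρ (eT p) = p 1 ^ 3 - 3 * p 2 ^ 2 * p 1 + 3 / 2 * (ρ + 1) * p 2 ^ 2 * p 1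
          - K * p 2 ^ 3 := by simp [pot, eT]; ring
      rw [this, hz]
      linear_combination (-(t ^ 3 * p 1 ^ 3)) * hKt - t ^ 2 * p 1 ^ 3 * ht2
    rw [e]
    have : 0 < 1 + (ρ - 1) * t ^ 2 / 2 := by
      have : 0 < ρ - 1 := by linarith
      positivity
    exact mul_ne_zero (pow_ne_zero 3 hy) this.ne'
  have hf := isTangentFrame_mirror hp.1 h0
  refine ⟨saddle_of_cubic hc hf.right (inner_eT_self hp.1 h0) h22' hm,
    isDegenerateAt_of_frame hf.symm h22' ?_, hasIndex_zero_of_fold hc h0 h11' h22' hm⟩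
  rw [tanHess_comm, tanHess_mirror_mixed h0]

/-- At the cusp the points on the equator are monkey saddles. -/
theorem Octupole.cusp_monkey (hp : p ∈ lineZ 1 0) :
    IsDegenerateAt (pot 0 1) p ∧ IsMonkeySaddle (pot 0 1) p := by
  have hc : p ∈ critPts (pot 0 1) := mem_critPts_of_mem_circlePts (by
    rw [circlePts_roots (d := 0) (by norm_num) (by norm_num)]; left; simpa using hp)
  have hy := mem_lineZ_one hp
  have hz : p 2 = 0 := by have := hp.2.2; linarith
  have h0 := hp.2.1
  obtain ⟨hP, h11, h22⟩ := tanHess_mirror_crit h0 hy hc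
  have h12 := tanHess_mirror_mixed (K := 0) (ρ := 1) h0
  rw [hz] at h11 h22
  have hf := isTangentFrame_mirror hp.1 h0
  have hQ (u v : E3) (hu : inner ℝ p u = 0) (hv : inner ℝ p v = 0) : tanHess 0 1 p u v = 0 := by
    obtain ⟨α, β, rfl⟩ := hf.span u hu
    obtain ⟨γ, δ, rfl⟩ := hf.span v hv
    rw [tanHess_combination, tanHess_comm 0 1 p eX, tanHess_comm 0 1 p (eT p),
      tanHess_combination, tanHess_combination, tanHess_comm 0 1 p (eT p) eX, h11, h12, h22]
    ring
  have hm : pot 0 1 (eT p) = p 1 ^ 3 := by simp [pot, eT, hz]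
  have hl : mirrorForm 0 1 (eT p) = -6 * p 1 := by
    have e : eT p 2 = p 1 := by simp [eT]
    rw [mirrorForm, e]; ring
  have hy3 : p 1 ^ 3 = p 1 := by
    have h := (mem_unitSphere p).1 hp.1
    rw [h0, hz] at h
    linear_combination p 1 * h
  refine ⟨isDegenerateAt_of_frame hf (hQ _ _ hf.left hf.left) h12, ?_, ?_, ?_⟩
  · exact saddle_of_cubic hc hf.right (inner_eT_self hp.1 h0) (hQ _ _ hf.right hf.right)
      (by rw [hm]; exact pow_ne_zero 3 hy)
  · intro u v hu hv
    rw [sphereHessian_pot, hQ u v hu hv]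
  · refine hasIndex_neg_two hc (orthonormal_mirror hp.1 h0) (by rw [hP, hz]; ring) hQ
      -- The points are `(0, ±1, 0)`, where `y³ = y`; the cubic part of the expansion is then `y(β³
      -- - 3α²β)`.
      (κ := 3 * p 1) (mul_ne_zero three_ne_zero hy) (fun α β => ?_) fun α β => ?_
    · rw [gradPot_mirror_left, hl]; ring
    · rw [gradPot_mirror_right, hl, hm, hy3]; ring

/-! ### Assembling the counts in each region -/

theorem Octupole.ncard_filter {S D N : Set E3} {P : E3 → Prop} (hS : S = D ∪ N)
    (hD : ∀ p ∈ D, P p) (hN : ∀ p ∈ N, ¬ P p) :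
    {p ∈ S | P p} = D ∧ {p ∈ S | ¬ P p} = N := by
  subst hS
  constructor
  · ext p
    exact ⟨fun h => h.1.resolve_right fun h' => hN p h' h.2, fun h => ⟨Or.inl h, hD p h⟩⟩
  · ext p
    exact ⟨fun h => h.1.resolve_left fun h' => h.2 (hD p h'), fun h => ⟨Or.inr h, hN p h⟩⟩

theorem Octupole.hasCard_line_one (t : ℝ) : HasCard (lineZ 1 t) 2 :=
  hasCard_lineZ (by positivity)

theorem Octupole.hasCard_poles : HasCard (lineZ 0 1) 2 := hasCard_lineZ (by norm_num)

theorem Octupole.disjoint_poles_line (t : ℝ) : Disjoint (lineZ 0 1) (lineZ 1 t) :=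
  disjoint_lineZ (by norm_num)

theorem Octupole.disjoint_roots (hρ2 : ρ < 2) {d : ℝ} (hd0 : 0 < d) :
    Disjoint (lineZ 1 ((K + d) / (2 * (2 - ρ)))) (lineZ 1 ((K - d) / (2 * (2 - ρ)))) := by
  have h2 : 2 - ρ ≠ 0 := by linarith
  refine disjoint_lineZ ?_
  have : 1 * ((K - d) / (2 * (2 - ρ))) - 1 * ((K + d) / (2 * (2 - ρ))) = -d / (2 - ρ) := by
    field_simp; ring
  rw [this]
  exact div_ne_zero (neg_ne_zero.2 hd0.ne') h2

theorem Octupole.disjoint_poles_line_union (s t : ℝ) :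
    Disjoint (lineZ 0 1) (lineZ 1 s ∪ lineZ 1 t) :=
  Set.disjoint_union_right.2 ⟨disjoint_poles_line s, disjoint_poles_line t⟩

theorem Octupole.filter_x {C Z W : Set E3} (hC : C = lineZ 0 1 ∪ Z ∪ W)
    (hZ : ∀ p ∈ Z, p 0 = 0) (hd : Disjoint (lineZ 0 1) Z) (hW : ∀ p ∈ W, p 0 ≠ 0) :
    {p ∈ C | p 0 = 0 ∧ p ≠ northPole ∧ p ≠ southPole} = Z ∧ {p ∈ C | p 0 ≠ 0} = W := by
  subst hC
  constructor
  · ext p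
    constructor
    · rintro ⟨(h | h) | h, h0, h1, h2⟩
      · exact ((mem_poles_iff.1 h).elim h1 h2).elim
      · exact h
      · exact (hW p h h0).elim
    · intro h
      have hp : p ∉ lineZ 0 1 := fun h' => Set.disjoint_left.1 hd h' h
      rw [mem_poles_iff, not_or] at hp
      exact ⟨Or.inl (Or.inr h), hZ p h, hp.1, hp.2⟩
  · ext p
    constructor
    · rintro ⟨(h | h) | h, h0⟩
      · exact (h0 h.2.1).elim
      · exact (h0 (hZ p h)).elim
      · exact h
    · exact fun h => ⟨Or.inr h, hW p h⟩

/-- Above the bifurcation curve. -/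
theorem Octupole.classification_above (hρ : 0 ≤ ρ) (hρ2 : ρ < 2)
    (hg : bifurcationCurve ρ < K) :
    (critPts (pot K ρ)).ncard = 14 ∧
    northPole ∈ critPts (pot K ρ) ∧ southPole ∈ critPts (pot K ρ) ∧
    {p ∈ critPts (pot K ρ) | p 0 = 0 ∧ p ≠ northPole ∧ p ≠ southPole}.ncard = 4 ∧
    {p ∈ critPts (pot K ρ) | p 0 ≠ 0}.ncard = 8 ∧
    (maxPts (pot K ρ)).ncard = 4 ∧ (minPts (pot K ρ)).ncard = 4 ∧
    (saddles (pot K ρ)).ncard = 6 := by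
  have hg0 := bifurcationCurve_nonneg ρ
  have hK0 : 0 < K := lt_of_le_of_lt hg0 hg
  have hK := hK0.le
  have hgK : bifurcationCurve ρ ^ 2 < K ^ 2 := pow_lt_pow_left₀ hg hg0 two_ne_zero
  have h2 : 0 < 2 - ρ := by linarith
  have hM : 0 < branchDisc K ρ := by
    rcases le_or_gt ρ 1 with h1 | h1
    · rw [branchDisc_eq h1]
      exact mul_pos (by linarith) (by linarith)
    · rw [branchDisc]
      have : 0 ≤ ρ ^ 2 * (ρ - 1) := mul_nonneg (by positivity) (by linarith)
      have : 0 < (6 - ρ) * K ^ 2 := mul_pos (by linarith) (by positivity)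
      linarith
  have hdisc : 0 < K ^ 2 - 2 * (2 - ρ) * (ρ - 1) := by
    rcases le_or_gt ρ 1 with h1 | h1
    · have : 0 ≤ (2 - ρ) * (1 - ρ) := mul_nonneg h2.le (by linarith)
      have : 0 < K ^ 2 := by positivity
      linarith
    · rw [← sq_bifurcationCurve h1.le hρ2.le]; linarith
  set d := Real.sqrt (K ^ 2 - 2 * (2 - ρ) * (ρ - 1)) with hd
  have hd0 : 0 < d := Real.sqrt_pos.2 hdisc
  have hd2 : d ^ 2 = K ^ 2 - 2 * (2 - ρ) * (ρ - 1) := Real.sq_sqrt hdisc.le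
  obtain ⟨η, ζ, hη0, hζ, hη, hηK, hC, hCall⟩ := exists_axis hK hρ (Or.inl hK0)
  have hcrit := critPts_eq (K := K) hρ hCall
  rw [circlePts_roots hρ2 hd2] at hcrit
  have cZ₁ := hasCard_line_one ((K + d) / (2 * (2 - ρ)))
  have cZ₂ := hasCard_line_one ((K - d) / (2 * (2 - ρ)))
  have dZ := disjoint_roots (K := K) hρ2 hd0
  set Z₁ := lineZ 1 ((K + d) / (2 * (2 - ρ)))
  set Z₂ := lineZ 1 ((K - d) / (2 * (2 - ρ)))
  set W₁ := orbitW K ρ η ζ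
  set W₂ := orbitW K ρ (-ζ) η
  have cW₁ : HasCard W₁ 4 := orbitW_pos_card hK hρ hη hηK hζ hC
  have cW₂ : HasCard W₂ 4 := orbitW_neg_card hK hρ hη hηK hζ hC (Or.inl ⟨hK0, hM⟩) hρ2.le
  have dW : Disjoint W₁ W₂ := disjoint_orbitW hρ (by positivity)
  -- Extrema: the poles, the smaller root and the orbit over the first-quadrant line, `2 + 2 + 4`.
  -- Saddles: the larger root and the perpendicular orbit, `2 + 4`.
  have hcount := counts (E := lineZ 0 1 ∪ Z₂ ∪ W₁) (S := Z₁ ∪ W₂) (n := 4) (s := 6)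
    (by rw [hcrit]; ext p; simp only [Set.mem_union]; tauto)
    (by
      rintro p ((hp | hp) | hp)
      · exact pole_extremal hρ hρ2 hp
      · exact lower_root_extremal hK0 hρ hρ2 hd0 hd2 hM hp
      · exact orbitW_extremal hK hρ (Or.inl hK0) hη hηK hζ
          (fun y z h => (hCall y z).2 (Or.inl h)) hp)
    (by
      rintro p (hp | hp)
      · exact (upper_root_saddle hK hρ hρ2 (Or.inl hK0) hd0 hd2 hp).1
      · exact (orbitW_saddle hK hρ (Or.inl hK0) hη hηK hζ
          (fun y z h => (hCall y z).2 (Or.inr h)) hp).1)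
    ((hasCard_poles.union cZ₂ (disjoint_poles_line _)).union cW₁
      (Set.disjoint_union_left.2 ⟨disjoint_lineZ_orbitW, disjoint_lineZ_orbitW⟩))
    (cZ₁.union cW₂ disjoint_lineZ_orbitW)
  obtain ⟨n1, n2, n3, n4⟩ := hcount
  refine ⟨n1, pole_crit northPole_mem, pole_crit southPole_mem, ?_, ?_, n2, n3, ?_⟩
  · rw [(filter_x hcrit (fun p hp => ?_) (disjoint_poles_line_union _ _) fun p hp => ?_).1]
    · exact (cZ₁.union cZ₂ dZ).2
    · rcases hp with hp | hp <;> exact hp.2.1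
    · rcases hp with hp | hp <;> exact hp.2.1
  · rw [(filter_x hcrit (fun p hp => ?_) (disjoint_poles_line_union _ _) fun p hp => ?_).2]
    · exact (cW₁.union cW₂ dW).2
    · rcases hp with hp | hp <;> exact hp.2.1
    · rcases hp with hp | hp <;> exact hp.2.1
  · rw [n4]
    exact (cZ₁.union cW₂ disjoint_lineZ_orbitW).2

/-- The configuration with two pairs of points on the circle `x = 0`, where `ρ < 1`. -/
theorem Octupole.counts_first_branch (hK : 0 ≤ K) (hρ : 0 < ρ) (hρ1 : ρ < 1)
    (hM : branchDisc K ρ ≤ 0) {d : ℝ} (hd0 : 0 < d)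
    (hd2 : d ^ 2 = K ^ 2 - 2 * (2 - ρ) * (ρ - 1))
    (hs : ∀ p ∈ lineZ 1 ((K - d) / (2 * (2 - ρ))), p ∈ saddles (pot K ρ)) :
    (critPts (pot K ρ)).ncard = 10 ∧ (maxPts (pot K ρ)).ncard = 3 ∧
      (minPts (pot K ρ)).ncard = 3 ∧ saddles (pot K ρ)
        = lineZ 1 ((K - d) / (2 * (2 - ρ))) ∪ lineZ 1 ((K + d) / (2 * (2 - ρ))) := by
  have hρ2 : ρ < 2 := by linarith
  obtain ⟨η, ζ, hη0, hζ, hη, hηK, hC, hCall⟩ := exists_axis hK hρ.le (Or.inr hρ)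
  have hcrit := critPts_eq (K := K) hρ.le hCall
  rw [circlePts_roots hρ2 hd2, orbitW_neg_empty hK hρ.le hη hηK hζ hC hρ1.le hM] at hcrit
  exact counts (E := lineZ 0 1 ∪ orbitW K ρ η ζ) (n := 3) (s := 4)
    (by
      rw [hcrit]; ext p
      simp only [Set.mem_union, Set.mem_empty_iff_false]; tauto)
    (by
      rintro p (hp | hp)
      · exact pole_extremal hρ.le hρ2 hp
      · exact orbitW_extremal hK hρ.le (Or.inr hρ) hη hηK hζ
          (fun y z h => (hCall y z).2 (Or.inl h)) hp)
    (by
      rintro p (hp | hp)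
      · exact hs p hp
      · exact (upper_root_saddle hK hρ.le hρ2 (Or.inr hρ) hd0 hd2 hp).1)
    (hasCard_poles.union (orbitW_pos_card hK hρ.le hη hηK hζ hC) disjoint_lineZ_orbitW)
    ((hasCard_line_one _).union (hasCard_line_one _) (disjoint_roots hρ2 hd0).symm)

theorem Octupole.exists_disc_root (hρ1 : ρ < 1) :
    ∃ d : ℝ, 0 < d ∧ d ^ 2 = K ^ 2 - 2 * (2 - ρ) * (ρ - 1) := by
  have h : 0 < K ^ 2 - 2 * (2 - ρ) * (ρ - 1) := by
    have : 0 < (2 - ρ) * (1 - ρ) := mul_pos (by linarith) (by linarith)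
    nlinarith [sq_nonneg K]
  exact ⟨_, Real.sqrt_pos.2 h, Real.sq_sqrt h.le⟩

/-- The configuration without points on the circle `x = 0` off the poles. -/
theorem Octupole.counts_no_circle (hK : 0 ≤ K) (hρ1 : 1 < ρ) (hρ2 : ρ ≤ 2)
    (hempty : circlePts K ρ = ∅) (hpole : ∀ p ∈ lineZ 0 1, IsExtremal K ρ p) :
    (critPts (pot K ρ)).ncard = 10 ∧ (maxPts (pot K ρ)).ncard = 3 ∧
      (minPts (pot K ρ)).ncard = 3 ∧ (saddles (pot K ρ)).ncard = 4 ∧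
      ∀ p ∈ saddles (pot K ρ), IsRegularSaddle K ρ p := by
  have hρ : 0 < ρ := by linarith
  obtain ⟨η, ζ, hη0, hζ, hη, hηK, hC, hCall⟩ := exists_axis hK hρ.le (Or.inr hρ)
  have hcrit := critPts_eq (K := K) hρ.le hCall
  rw [hempty] at hcrit
  have cW₂ := orbitW_neg_card hK hρ.le hη hηK hζ hC (Or.inr hρ1) hρ2
  have hreg : ∀ p ∈ orbitW K ρ (-ζ) η, IsRegularSaddle K ρ p := fun p hp =>
    orbitW_saddle hK hρ.le (Or.inr hρ) hη hηK hζ (fun y z h => (hCall y z).2 (Or.inr h)) hp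
  obtain ⟨n1, n2, n3, n4⟩ := counts (E := lineZ 0 1 ∪ orbitW K ρ η ζ)
    (S := orbitW K ρ (-ζ) η) (n := 3) (s := 4)
    (by
      rw [hcrit]; ext p
      simp only [Set.mem_union, Set.mem_empty_iff_false]; tauto)
    (by
      rintro p (hp | hp)
      · exact hpole p hp
      · exact orbitW_extremal hK hρ.le (Or.inr hρ) hη hηK hζ
          (fun y z h => (hCall y z).2 (Or.inl h)) hp)
    (fun p hp => (hreg p hp).1)
    (hasCard_poles.union (orbitW_pos_card hK hρ.le hη hηK hζ hC) disjoint_lineZ_orbitW) cW₂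
  refine ⟨n1, n2, n3, by rw [n4]; exact cW₂.2, fun p hp => hreg p (n4 ▸ hp)⟩

/-- Below the bifurcation curve. -/
theorem Octupole.classification_below (hK : 0 ≤ K) (hρ : 0 ≤ ρ) (hρ2 : ρ ≤ 2)
    (hg : K < bifurcationCurve ρ) :
    (critPts (pot K ρ)).ncard = 10 ∧ (maxPts (pot K ρ)).ncard = 3 ∧
      (minPts (pot K ρ)).ncard = 3 ∧ (saddles (pot K ρ)).ncard = 4 := by
  have hgK : K ^ 2 < bifurcationCurve ρ ^ 2 := pow_lt_pow_left₀ hg hK two_ne_zero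
  rcases lt_or_ge ρ 1 with h1 | h1
  · have hM : branchDisc K ρ < 0 := by
      rw [branchDisc_eq h1.le]
      exact mul_neg_of_pos_of_neg (by linarith) (by linarith)
    have hρ0 : 0 < ρ := by
      rcases hρ.eq_or_lt with h | h
      · rw [← h, branchDisc] at hM; nlinarith [sq_nonneg K]
      · exact h
    obtain ⟨d, hd0, hd2⟩ := exists_disc_root (K := K) h1
    obtain ⟨n1, n2, n3, n4⟩ := counts_first_branch hK hρ0 h1 hM.le hd0 hd2
      fun p hp => (lower_root_saddle hK hρ0 (by linarith) hd0 hd2 hM hp).1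
    refine ⟨n1, n2, n3, ?_⟩
    rw [n4]
    exact ((hasCard_line_one _).union (hasCard_line_one _)
      (disjoint_roots (by linarith) hd0).symm).2
  · rw [sq_bifurcationCurve h1 hρ2] at hgK
    have h2 : ρ < 2 := by
      rcases hρ2.eq_or_lt with rfl | h
      · nlinarith [sq_nonneg K]
      · exact h
    have h1' : 1 < ρ := by
      rcases h1.eq_or_lt with rfl | h
      · nlinarith [sq_nonneg K]
      · exact h
    obtain ⟨n1, n2, n3, n4, -⟩ := counts_no_circle hK h1' hρ2 (circlePts_eq_empty h2 hgK)
      fun p hp => pole_extremal hρ h2 hp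
    exact ⟨n1, n2, n3, n4⟩

/-- On the first branch of the bifurcation curve. -/
theorem Octupole.classification_first_branch (hρ : 0 < ρ) (hρ1 : ρ < 1)
    (hg : K = bifurcationCurve ρ) :
    (critPts (pot K ρ)).ncard = 10 ∧ (maxPts (pot K ρ)).ncard = 3 ∧
      (minPts (pot K ρ)).ncard = 3 ∧ (saddles (pot K ρ)).ncard = 4 ∧
      {p ∈ saddles (pot K ρ) | IsDegenerateAt (pot K ρ) p}.ncard = 2 ∧
      ∀ p ∈ saddles (pot K ρ), HasIndex (pot K ρ) p (-1) := by
  have hρ2 : ρ < 2 := by linarith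
  have hK : 0 ≤ K := hg ▸ bifurcationCurve_nonneg ρ
  have hM : branchDisc K ρ = 0 := by rw [branchDisc_eq hρ1.le, hg]; ring
  have hK0 : 0 < K := by
    refine lt_of_le_of_ne hK fun h => ?_
    rw [← h, branchDisc] at hM
    have : 0 < 2 * ρ ^ 2 * (1 - ρ) := mul_pos (by positivity) (by linarith)
    linarith
  obtain ⟨d, hd0, hd2⟩ := exists_disc_root (K := K) hρ1
  have hpf := fun p hp => lower_root_pitchfork (p := p) hK0 hρ hρ1 hd0 hd2 hM hp
  have hup := fun p hp => upper_root_saddle (p := p) hK hρ.le hρ2 (Or.inr hρ) hd0 hd2 hp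
  obtain ⟨n1, n2, n3, n4⟩ := counts_first_branch hK hρ hρ1 hM.le hd0 hd2
    fun p hp => (hpf p hp).1
  refine ⟨n1, n2, n3, ?_, ?_, ?_⟩
  · rw [n4]
    exact ((hasCard_line_one _).union (hasCard_line_one _) (disjoint_roots hρ2 hd0).symm).2
  · rw [(ncard_filter n4 (fun p hp => (hpf p hp).2.1) fun p hp => (hup p hp).2.1).1]
    exact (hasCard_line_one _).2
  · rw [n4]
    rintro p (hp | hp)
    · exact (hpf p hp).2.2
    · exact (hup p hp).2.2

/-- On the second branch of the bifurcation curve. -/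
theorem Octupole.classification_second_branch (hρ1 : 1 < ρ) (hρ2 : ρ < 2)
    (hg : K = bifurcationCurve ρ) :
    (critPts (pot K ρ)).ncard = 12 ∧ (maxPts (pot K ρ)).ncard = 3 ∧
      (minPts (pot K ρ)).ncard = 3 ∧ (saddles (pot K ρ)).ncard = 6 ∧
      {p ∈ saddles (pot K ρ) | IsDegenerateAt (pot K ρ) p}.ncard = 2 ∧
      {p ∈ saddles (pot K ρ) | ¬ IsDegenerateAt (pot K ρ) p}.ncard = 4 ∧
      (∀ p ∈ saddles (pot K ρ), IsDegenerateAt (pot K ρ) p → HasIndex (pot K ρ) p 0) ∧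
      ∀ p ∈ saddles (pot K ρ), ¬ IsDegenerateAt (pot K ρ) p → HasIndex (pot K ρ) p (-1) := by
  have hρ : 0 < ρ := by linarith
  have hK : 0 ≤ K := hg ▸ bifurcationCurve_nonneg ρ
  have hK2 : K ^ 2 = 2 * (2 - ρ) * (ρ - 1) := by rw [hg, sq_bifurcationCurve hρ1.le hρ2.le]
  have hK0 : 0 < K := by
    refine lt_of_le_of_ne hK fun h => ?_
    rw [← h] at hK2
    have : 0 < 2 * (2 - ρ) * (ρ - 1) := mul_pos (by linarith) (by linarith)
    linarith
  obtain ⟨η, ζ, hη0, hζ, hη, hηK, hC, hCall⟩ := exists_axis hK hρ.le (Or.inr hρ)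
  have hcrit := critPts_eq (K := K) hρ.le hCall
  rw [circlePts_roots (d := 0) hρ2 (by rw [hK2]; ring), add_zero, sub_zero,
    Set.union_self] at hcrit
  have cW₂ := orbitW_neg_card hK hρ.le hη hηK hζ hC (Or.inr hρ1) hρ2.le
  have hreg : ∀ p ∈ orbitW K ρ (-ζ) η, IsRegularSaddle K ρ p := fun p hp =>
    orbitW_saddle hK hρ.le (Or.inr hρ) hη hηK hζ (fun y z h => (hCall y z).2 (Or.inr h)) hp
  have hfold := fun p hp => double_root_fold (p := p) hK0 hρ1 hρ2 hK2 hp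
  have cS := (hasCard_line_one (K / (2 * (2 - ρ)))).union cW₂ disjoint_lineZ_orbitW
  obtain ⟨n1, n2, n3, n4⟩ := counts (E := lineZ 0 1 ∪ orbitW K ρ η ζ)
    (S := lineZ 1 (K / (2 * (2 - ρ))) ∪ orbitW K ρ (-ζ) η) (n := 3) (s := 6)
    (by
      rw [hcrit]; ext p
      simp only [Set.mem_union]; tauto)
    (by
      rintro p (hp | hp)
      · exact pole_extremal hρ.le hρ2 hp
      · exact orbitW_extremal hK hρ.le (Or.inr hρ) hη hηK hζ
          (fun y z h => (hCall y z).2 (Or.inl h)) hp)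
    (by
      rintro p (hp | hp)
      · exact (hfold p hp).1
      · exact (hreg p hp).1)
    (hasCard_poles.union (orbitW_pos_card hK hρ.le hη hηK hζ hC) disjoint_lineZ_orbitW) cS
  obtain ⟨f1, f2⟩ := ncard_filter (P := IsDegenerateAt (pot K ρ)) n4
    (fun p hp => (hfold p hp).2.1) fun p hp => (hreg p hp).2.1
  refine ⟨n1, n2, n3, by rw [n4]; exact cS.2, ?_, ?_, fun p hp hdeg => ?_, fun p hp hdeg => ?_⟩
  · rw [f1]; exact (hasCard_line_one _).2
  · rw [f2]; exact cW₂.2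
  · exact (hfold p (f1.subset ⟨hp, hdeg⟩)).2.2
  · exact (hreg p (f2.subset ⟨hp, hdeg⟩)).2.2

/-- At the cusp of the bifurcation curve. -/
theorem Octupole.classification_cusp :
    (critPts (pot 0 1)).ncard = 8 ∧ (maxPts (pot 0 1)).ncard = 3 ∧
      (minPts (pot 0 1)).ncard = 3 ∧ (saddles (pot 0 1)).ncard = 2 ∧
      ∀ p ∈ saddles (pot 0 1), IsDegenerateAt (pot 0 1) p ∧ IsMonkeySaddle (pot 0 1) p := by
  obtain ⟨η, ζ, hη0, hζ, hη, hηK, hC, hCall⟩ :=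
    exists_axis (le_refl (0 : ℝ)) zero_le_one (Or.inr one_pos)
  have hcrit := critPts_eq (K := 0) zero_le_one hCall
  rw [circlePts_roots (d := 0) (by norm_num) (by norm_num),
    orbitW_neg_empty le_rfl zero_le_one hη hηK hζ hC le_rfl (by simp [branchDisc]),
    add_zero, sub_zero, zero_div, Set.union_self] at hcrit
  obtain ⟨n1, n2, n3, n4⟩ := counts (E := lineZ 0 1 ∪ orbitW 0 1 η ζ)
    (S := lineZ 1 0) (n := 3) (s := 2)
    (by
      rw [hcrit]; ext p
      simp only [Set.mem_union, Set.mem_empty_iff_false]; tauto)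
    (by
      rintro p (hp | hp)
      · exact pole_extremal zero_le_one one_lt_two hp
      · exact orbitW_extremal le_rfl zero_le_one (Or.inr one_pos) hη hηK hζ
          (fun y z h => (hCall y z).2 (Or.inl h)) hp)
    (fun p hp => (cusp_monkey hp).2.1)
    (hasCard_poles.union (orbitW_pos_card le_rfl zero_le_one hη hηK hζ hC)
      disjoint_lineZ_orbitW) (hasCard_line_one 0)
  refine ⟨n1, n2, n3, by rw [n4]; exact (hasCard_line_one 0).2, fun p hp => ?_⟩
  exact cusp_monkey (n4 ▸ hp)

/-- At `K = 0`, `ρ = 2` the quadratic `formE` reduces to `y²`, so only the poles remain on the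
mirror circle. -/
theorem Octupole.circlePts_end : circlePts 0 2 = ∅ := by
  rw [Set.eq_empty_iff_forall_notMem]
  rintro p ⟨-, -, h1, hE⟩
  rw [formE] at hE
  exact pow_ne_zero 2 h1 (by linarith)

end

theorem mainTheorem8 :
    ContinuousOn bifurcationCurve (Set.Icc 0 2) ∧
    ∀ (K ρ : ℝ) (Φ : E3 → ℝ), 0 ≤ K → 0 ≤ ρ → ρ ≤ 2 →
      Φ = octupolarPotential K ρ (-(Real.pi / 2)) →
      -- above the curve
      (ρ < 2 → bifurcationCurve ρ < K →
        (critPts Φ).ncard = 14 ∧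
        northPole ∈ critPts Φ ∧ southPole ∈ critPts Φ ∧
        {p ∈ critPts Φ | p 0 = 0 ∧ p ≠ northPole ∧ p ≠ southPole}.ncard = 4 ∧
        {p ∈ critPts Φ | p 0 ≠ 0}.ncard = 8 ∧
        (maxPts Φ).ncard = 4 ∧ (minPts Φ).ncard = 4 ∧ (saddles Φ).ncard = 6) ∧
      -- below the curve
      (K < bifurcationCurve ρ →
        (critPts Φ).ncard = 10 ∧
        (maxPts Φ).ncard = 3 ∧ (minPts Φ).ncard = 3 ∧ (saddles Φ).ncard = 4) ∧
      -- on the curve, first branch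
      (K = bifurcationCurve ρ → 0 < ρ → ρ < 1 →
        (critPts Φ).ncard = 10 ∧
        (maxPts Φ).ncard = 3 ∧ (minPts Φ).ncard = 3 ∧ (saddles Φ).ncard = 4 ∧
        {p ∈ saddles Φ | IsDegenerateAt Φ p}.ncard = 2 ∧
        (∀ p ∈ saddles Φ, HasIndex Φ p (-1))) ∧
      -- on the curve, second branch
      (K = bifurcationCurve ρ → 1 < ρ → ρ < 2 →
        (critPts Φ).ncard = 12 ∧
        (maxPts Φ).ncard = 3 ∧ (minPts Φ).ncard = 3 ∧ (saddles Φ).ncard = 6 ∧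
        {p ∈ saddles Φ | IsDegenerateAt Φ p}.ncard = 2 ∧
        {p ∈ saddles Φ | ¬ IsDegenerateAt Φ p}.ncard = 4 ∧
        (∀ p ∈ saddles Φ, IsDegenerateAt Φ p → HasIndex Φ p 0) ∧
        (∀ p ∈ saddles Φ, ¬ IsDegenerateAt Φ p → HasIndex Φ p (-1))) ∧
      -- on the curve, at the cusp
      (K = bifurcationCurve ρ → ρ = 1 →
        (critPts Φ).ncard = 8 ∧
        (maxPts Φ).ncard = 3 ∧ (minPts Φ).ncard = 3 ∧ (saddles Φ).ncard = 2 ∧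
        (∀ p ∈ saddles Φ, IsDegenerateAt Φ p ∧ IsMonkeySaddle Φ p)) ∧
      -- on the curve, at its outer end
      (K = bifurcationCurve ρ → ρ = 2 →
        (critPts Φ).ncard = 10 ∧
        (maxPts Φ).ncard = 3 ∧ (minPts Φ).ncard = 3 ∧ (saddles Φ).ncard = 4 ∧
        (∀ p ∈ saddles Φ, ¬ IsDegenerateAt Φ p ∧ HasIndex Φ p (-1)) ∧
        northPole ∈ maxPts Φ ∧ IsDegenerateAt Φ northPole ∧
        southPole ∈ minPts Φ ∧ IsDegenerateAt Φ southPole) := by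
  refine ⟨continuousOn_bifurcationCurve, fun K ρ Φ hK hρ hρ2 hΦ => ?_⟩
  rw [octupolarPotential_eq] at hΦ
  subst hΦ
  refine ⟨fun h2 hg => classification_above hρ h2 hg, fun hg => classification_below hK hρ hρ2 hg,
    fun hg h0 h1 => classification_first_branch h0 h1 hg,
    fun hg h1 h2 => classification_second_branch h1 h2 hg, fun hg h1 => ?_, fun hg h2 => ?_⟩
  · subst h1
    obtain rfl : K = 0 := by rw [hg]; simp [bifurcationCurve]
    exact classification_cusp
  · subst h2
    obtain rfl : K = 0 := by rw [hg]; simp [bifurcationCurve]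
    obtain ⟨n1, n2, n3, n4, hreg⟩ := counts_no_circle le_rfl one_lt_two le_rfl circlePts_end
      fun p hp => pole_extremal_end hp
    exact ⟨n1, n2, n3, n4, fun p hp => (hreg p hp).2, northPole_mem_maxPts,
      pole_degenerate northPole_mem, southPole_mem_minPts, pole_degenerate southPole_mem⟩
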